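/- Let $G$ be a finite simple graph that can be embedded in the torus and in which no two distinct triangles ($3$-cycles) share an edge. Then $\chi_o(G)\le 8$, that is, $G$ has an odd coloring with at most $8$ colors. Here an odd coloring of $G$ is a proper vertex coloring such that for every non-isolated vertex $v$ some color appears on an odd number of neighbors of $v$, and the odd chromatic number $\chi_o(G)$ is the least $k$ for which $G$ has an odd coloring with $k$ colors. (Embeddings are described by rotation systems: $G$ embeds in the torus if and only if for some choice of a cyclic order of the edges at each vertex, the closed oriented surface obtained by gluing a disc along every facial walk has genus at most $1$, where the genus is half the first Betti number over $\mathbb{F}_2$, hence the sum of the genera of the components.) -/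

import Mathlib

namespace SimpleGraph

/-! ### Odd colorings -/

/-- A proper coloring is an *odd coloring* if every non-isolated vertex `v` sees some color on
an odd number of its neighbors. -/
def Coloring.IsOdd {V α : Type*} {G : SimpleGraph V} (C : G.Coloring α) : Prop :=
  ∀ v : V, (∃ w, G.Adj v w) → ∃ a : α, Odd {w | G.Adj v w ∧ C w = a}.ncard

/-- `G` has an odd coloring with colors from a set of `k` colors. -/
def OddColorable {V : Type*} (G : SimpleGraph V) (k : ℕ) : Prop :=
  ∃ C : G.Coloring (Fin k), C.IsOdd

/-- The odd chromatic number `χ_o(G)`: the least `k` for which `G` has an odd `k`-coloring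
(`⊤` if there is none, which never happens for finite graphs). -/
noncomputable def oddChromaticNumber {V : Type*} (G : SimpleGraph V) : ℕ∞ :=
  ⨅ k ∈ {k : ℕ | G.OddColorable k}, (k : ℕ∞)

/-! ### Adjacent triangles -/

/-- No two distinct triangles share an edge: if `uvx` and `uvy` are triangles, then `x = y`. -/
def NoAdjacentTriangles {V : Type*} (G : SimpleGraph V) : Prop :=
  ∀ u v x y : V, G.Adj u v → G.Adj u x → G.Adj v x → G.Adj u y → G.Adj v y → x = y

/-! ### Embeddings in closed orientable surfaces -/

/-- A rotation system on `G`: for every vertex `v`, a cyclic ordering of the edges at `v`.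
It is given by a permutation `next` of the darts (edges with a direction) whose cycles are
exactly the sets of darts leaving one vertex.

Rotation systems are the combinatorial description of embeddings of graphs in oriented closed
surfaces: the facial walks are the cycles of `facePerm` below, and gluing a disc to `G` along
each facial walk gives a closed oriented surface that contains `G`, with one component for each
component of `G` that has an edge. -/
structure RotationSystem {V : Type*} (G : SimpleGraph V) where
  /-- the next dart around the vertex that a dart leaves -/
  next : Equiv.Perm G.Dart
  /-- the successor leaves the same vertex -/
  fst_next : ∀ d, (next d).fst = d.fst
  /-- all darts leaving one vertex form a single cycle -/
  sameCycle : ∀ d d' : G.Dart, d.fst = d'.fst → next.SameCycle d d'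

open scoped Classical in
/-- The boundary map `∂₁ : C₁ → C₀` over `𝔽₂`, sending an edge to the sum of its ends. -/
noncomputable def edgeBoundary {V : Type*} [Fintype V] (G : SimpleGraph V) :
    (G.edgeSet → ZMod 2) →ₗ[ZMod 2] (V → ZMod 2) :=
  LinearMap.pi fun v => ∑ e : G.edgeSet, if v ∈ (e : Sym2 V) then LinearMap.proj e else 0

namespace RotationSystem

/-- Face tracing: after walking along `d` to its end `v`, leave `v` along the dart that follows
the reverse of `d` in the rotation at `v`. -/
def facePerm {V : Type*} {G : SimpleGraph V} (R : G.RotationSystem) : Equiv.Perm G.Dart :=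
  (Function.Involutive.toPerm Dart.symm Dart.symm_involutive).trans R.next

/-- The boundary in `C₁`, over `𝔽₂`, of the face to the side of the dart `d`: every edge is
counted as often as the facial walk through `d` runs along it, in either direction. -/
noncomputable def faceBoundary {V : Type*} {G : SimpleGraph V} (R : G.RotationSystem)
    (d : G.Dart) : G.edgeSet → ZMod 2 :=
  fun e => ({d' : G.Dart | R.facePerm.SameCycle d d' ∧ d'.edge = e}.ncard : ZMod 2)

/-- The image `B₁` of `∂₂ : C₂ → C₁`, spanned by the boundaries of the faces. -/
noncomputable def boundaries {V : Type*} {G : SimpleGraph V} (R : G.RotationSystem) :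
    Submodule (ZMod 2) (G.edgeSet → ZMod 2) :=
  Submodule.span (ZMod 2) (Set.range R.faceBoundary)

open scoped Classical in
/-- `∂₁ ∘ ∂₂ = 0`, so that the homology in the definition of `firstBetti` is the homology of a complex. -/
theorem boundaries_le_ker {V : Type*} [Fintype V] {G : SimpleGraph V}
    (R : G.RotationSystem) : R.boundaries ≤ LinearMap.ker G.edgeBoundary := by
  have key : ∀ (P : G.Dart → Prop) (v : V),
      (∑ e : G.edgeSet, if v ∈ (e : Sym2 V) then
        (({d : G.Dart | P d ∧ d.edge = e}.ncard : ℕ) : ZMod 2) else 0)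
      = (∑ d : G.Dart, if P d ∧ d.fst = v then 1 else 0)
        + ∑ d : G.Dart, if P d ∧ d.snd = v then 1 else 0 := by
    intro P v
    have h1 : ∀ e : G.edgeSet, (if v ∈ (e : Sym2 V) then
        (({d : G.Dart | P d ∧ d.edge = e}.ncard : ℕ) : ZMod 2) else 0)
        = ∑ d : G.Dart, if (⟨d.edge, d.edge_mem⟩ : G.edgeSet) = e then
            (if P d ∧ v ∈ d.edge then 1 else 0) else 0 := by
      intro e
      rw [Set.ncard_eq_toFinset_card', Finset.card_eq_sum_ones, Nat.cast_sum]
      simp only [Set.toFinset_ofPred, Finset.sum_filter, Nat.cast_one]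
      split_ifs with hv
      · apply Finset.sum_congr rfl
        intro d _
        by_cases hd : d.edge = e
        · have : (⟨d.edge, d.edge_mem⟩ : G.edgeSet) = e := Subtype.ext hd
          simp [hd, hv]
        · have : ¬ (⟨d.edge, d.edge_mem⟩ : G.edgeSet) = e := fun h => hd (congrArg Subtype.val h)
          simp [hd, this]
      · symm
        apply Finset.sum_eq_zero
        intro d _
        split_ifs with h h'
        · subst h
          exact absurd h'.2 hv
        · rfl
        · rfl
    rw [Finset.sum_congr rfl fun e _ => h1 e, Finset.sum_comm, ← Finset.sum_add_distrib]
    apply Finset.sum_congr rfl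
    intro d _
    rw [Finset.sum_ite_eq]
    have hne : d.fst ≠ d.snd := d.adj.ne
    have hm : v ∈ d.edge ↔ d.fst = v ∨ d.snd = v := by
      rw [show d.edge = s(d.fst, d.snd) from rfl, Sym2.mem_iff]
      tauto
    by_cases hP : P d <;> by_cases h1 : d.fst = v <;> by_cases h2 : d.snd = v <;>
      simp_all
  refine Submodule.span_le.2 ?_
  rintro _ ⟨d, rfl⟩
  rw [SetLike.mem_coe, LinearMap.mem_ker]
  funext v
  have h := key (fun d' => R.facePerm.SameCycle d d') v
  have hs : ∀ P : G.Dart → Prop, (∀ d', P (R.facePerm d') ↔ P d') →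
      (∑ d' : G.Dart, if P d' ∧ d'.snd = v then (1 : ZMod 2) else 0)
      = ∑ d' : G.Dart, if P d' ∧ d'.fst = v then (1 : ZMod 2) else 0 := by
    intro P hP
    refine Fintype.sum_equiv R.facePerm _ _ fun d' => ?_
    have hf : (R.facePerm d').fst = d'.snd := R.fst_next d'.symm
    simp only [hf, hP]
  rw [hs _ fun d' => Equiv.Perm.sameCycle_apply_right, CharTwo.add_self_eq_zero] at h
  have e1 : G.edgeBoundary (R.faceBoundary d) v = ∑ e : G.edgeSet, if v ∈ (e : Sym2 V) then
      R.faceBoundary d e else 0 := by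
    simp only [edgeBoundary, LinearMap.pi_apply, LinearMap.sum_apply]
    apply Finset.sum_congr rfl
    intro e _
    split_ifs <;> simp
  rw [e1]
  exact h

/-- The first Betti number `dim H₁(S; 𝔽₂) = dim (ker ∂₁ / im ∂₂)` of the closed oriented
surface `S` in which the rotation system embeds `G`. It is twice the genus of `S` (the sum of the
genera of the components of `S`). -/
noncomputable def firstBetti {V : Type*} [Fintype V] {G : SimpleGraph V}
    (R : G.RotationSystem) : ℕ :=
  Module.finrank (ZMod 2)
    (LinearMap.ker G.edgeBoundary ⧸ R.boundaries.submoduleOf (LinearMap.ker G.edgeBoundary))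

/-- The genus of the surface in which the rotation system embeds `G`: half of the first Betti
number. -/
noncomputable def genus {V : Type*} [Fintype V] {G : SimpleGraph V}
    (R : G.RotationSystem) : ℚ :=
  (R.firstBetti : ℚ) / 2

end RotationSystem

/-- `G` is *toroidal*, that is, it can be embedded in the torus: some rotation system embeds it in
a closed orientable surface of genus at most one. (All components of that surface are then spheres,
except for at most one torus; the planar case is included since a planar graph embeds in the torus.
Conversely the rotation system read off from a drawing on the torus, whether or not its faces are
discs, has genus at most one.) -/
def IsToroidal {V : Type*} [Fintype V] (G : SimpleGraph V) : Prop :=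
  ∃ R : G.RotationSystem, R.genus ≤ 1

end SimpleGraph

/-! The proof takes a counterexample with fewest edges, for a statement that survives reductions. It
concerns pairs (H, F): H is toroidal, oddness is not required at the free vertices F, and every edge
of H with an end outside F is an edge of G. Oddness can fail only at needy vertices, since a vertex
of odd degree sees some color an odd number of times. A nonfree vertex of degree two is replaced by
an edge between its neighbors, which become free: the edge gives them different colors, and the
vertex itself, colored last, has at most four colors to avoid (`Suppressed.good`).

Reducible configurations come from recoloring. The edges at a small set X are removed, the rest is
colored by minimality, and X is colored greedily with eight colors (`PartialOdd.step`). A vertex x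
avoids the colors of its colored neighbors and, for each needy neighbor with x as its last uncolored
neighbor, at most one further color, here called its kill. The outcome is that needy vertices of
degree four are pairwise nonadjacent (`Irred.not_adj_of_four`) and that a vertex that is not needy
has many needy neighbors, counted in refined ways (`Irred.eight_le`, `Irred.nine_le`,
`Irred.eight_le_of_poor`).

These are played off against Euler's inequality on the torus (`sum_corners_le`): the charges 4
deg(v) + 2 (number of nontriangular corners at v) - 24 have sum at most zero. Only vertices of
degree at most five can start negative. Charge moves within faces: kind A (needy, degree four)
receives in triangles, and kind B (the other needy vertices, of degree at least six) gives to kind N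
(not needy). Finally N pays poor neighbors. For A and B nonnegativity is a short count, the latter
because a needy vertex cannot lie on the common edge of two triangles at a B vertex. For N the
neighborhood is encoded as a cyclic word and a finite search settles degrees four to eight.

Hence all final charges vanish. The equality cases remove kind A, poor vertices and edges between B
vertices. What remains is an N vertex of degree at most six whose needy neighbors can all be colored
last, contrary to `Irred.eight_le`.

Toroidality of the reduced graphs and Euler's inequality are derived from homology over 𝔽₂: a
2-chain is a function on darts that is constant on facial walks. -/

namespace OddToroidal

open SimpleGraph Finset
open scoped Classical

noncomputable section

/-! ### Partial odd colorings -/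

/-- The neighbors of `v`, as a finset. -/
def nbr {V : Type*} [Fintype V] (H : SimpleGraph V) (v : V) : Finset V := {w | H.Adj v w}

/-- The degree of `v`. -/
def deg {V : Type*} [Fintype V] (H : SimpleGraph V) (v : V) : ℕ := #(nbr H v)

/-- A vertex is needy if it is not free and has positive even degree; these are the vertices
at which oddness is not automatic. -/
def Needy {V : Type*} [Fintype V] (H : SimpleGraph V) (F : Set V) (z : V) : Prop :=
  z ∉ F ∧ 0 < deg H z ∧ Even (deg H z)

/-- The colors that appear an odd number of times among the neighbors of `z` outside `U`. -/
def oddAt {V : Type*} [Fintype V] (H : SimpleGraph V) (c : V → Fin 8) (U : Finset V) (z : V) :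
    Finset (Fin 8) := {a | Odd #{w ∈ nbr H z \ U | c w = a}}

/-- `c` is an odd coloring of `H`, with respect to the free vertices `F`, in which the vertices in
`U` are still uncolored. -/
structure PartialOdd {V : Type*} [Fintype V] (H : SimpleGraph V) (F : Set V) (c : V → Fin 8)
    (U : Finset V) : Prop where
  proper : ∀ a b, a ∉ U → b ∉ U → H.Adj a b → c a ≠ c b
  odd : ∀ z, Needy H F z → Disjoint (nbr H z) U → (oddAt H c U z).Nonempty

/-- `H` has a coloring with eight colors that is odd at all needy vertices. -/
def Good {V : Type*} [Fintype V] (H : SimpleGraph V) (F : Set V) : Prop :=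
  ∃ c, PartialOdd H F c ∅

/-- The color that the last neighbor of `z` has to avoid. -/
def kill {V : Type*} [Fintype V] (H : SimpleGraph V) (c : V → Fin 8) (U : Finset V) (z : V) :
    Fin 8 := if h : (oddAt H c U z).Nonempty then h.choose else 0

/-- Removal of all edges at vertices of `X`. -/
def del {V : Type*} (H : SimpleGraph V) (X : Finset V) : SimpleGraph V where
  Adj a b := H.Adj a b ∧ a ∉ X ∧ b ∉ X
  symm := ⟨fun _ _ h => ⟨h.1.symm, h.2.2, h.2.1⟩⟩
  loopless := ⟨fun _ h => H.irrefl h.1⟩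

theorem del_le {V : Type*} {H : SimpleGraph V} {X : Finset V} : del H X ≤ H := fun _ _ h => h.1

section

variable {V : Type*} [Fintype V] {H : SimpleGraph V} {F : Set V} {c : V → Fin 8} {U : Finset V}

@[simp] theorem mem_nbr {v w : V} : w ∈ nbr H v ↔ H.Adj v w := by simp [nbr]

theorem mem_nbr_comm {v w : V} : w ∈ nbr H v ↔ v ∈ nbr H w := by simp [H.adj_comm]

theorem kill_eq {z : V} {o : Fin 8} (h : oddAt H c U z = {o}) : kill H c U z = o := by
  have h1 : (oddAt H c U z).Nonempty := by rw [h]; exact singleton_nonempty o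
  rw [kill, dif_pos h1]
  exact mem_singleton.1 (h.le h1.choose_spec)

theorem mem_oddAt {z : V} {a : Fin 8} :
    a ∈ oddAt H c U z ↔ Odd #{w ∈ nbr H z \ U | c w = a} := by simp [oddAt]

/-- Coloring a further vertex `x` with `a` toggles `a` in the set of odd colors. -/
theorem mem_oddAt_update {x z : V} {a b : Fin 8} (hx : x ∈ U) (hz : x ∈ nbr H z) :
    b ∈ oddAt H (Function.update c x a) (U.erase x) z ↔ (b ∈ oddAt H c U z ↔ b ≠ a) := by
  rw [mem_oddAt, mem_oddAt]
  have h1 : nbr H z \ U.erase x = insert x (nbr H z \ U) := by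
    ext w
    by_cases hw : w = x
    · subst hw; simp_all
    · simp [hw]
  have hxn : x ∉ nbr H z \ U := by simp [hx]
  have h2 : ({w ∈ nbr H z \ U | Function.update c x a w = b} : Finset V)
      = {w ∈ nbr H z \ U | c w = b} := by
    apply filter_congr
    intro w hw
    have : w ≠ x := by rintro rfl; exact hxn hw
    rw [Function.update_of_ne this]
  rw [h1, filter_insert, h2, Function.update_self]
  split_ifs with hab
  · subst hab
    rw [card_insert_of_notMem (by simp [hx])]
    simp [Nat.odd_add_one]
  · simp [Ne.symm hab]

theorem oddAt_update_of_notMem {x z : V} {a : Fin 8} (hz : x ∉ nbr H z) :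
    oddAt H (Function.update c x a) (U.erase x) z = oddAt H c U z := by
  ext b
  rw [mem_oddAt, mem_oddAt]
  have h1 : nbr H z \ U.erase x = nbr H z \ U := by
    ext w
    by_cases hw : w = x
    · subst hw; simp_all
    · simp [hw]
  rw [h1]
  have h2 : ({w ∈ nbr H z \ U | Function.update c x a w = b} : Finset V)
      = {w ∈ nbr H z \ U | c w = b} := by
    apply filter_congr
    intro w hw
    have : w ≠ x := by rintro rfl; exact hz (mem_sdiff.1 hw).1
    rw [Function.update_of_ne this]
  rw [h2]

/-- The greedy step. -/
theorem PartialOdd.step (h : PartialOdd H F c U) {x : V} (hx : x ∈ U) (B : Finset (Fin 8))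
    (hB : #B ≤ 7) (hcol : ∀ w ∈ nbr H x, w ∉ U → c w ∈ B)
    (hkill : ∀ z ∈ nbr H x, Needy H F z → nbr H z ∩ U = {x} →
      ∀ o, oddAt H c U z = {o} → o ∈ B) :
    ∃ a ∉ B, PartialOdd H F (Function.update c x a) (U.erase x) := by
  obtain ⟨a, ha⟩ : ∃ a, a ∉ B := by
    by_contra! hc
    have : B = univ := eq_univ_iff_forall.2 hc
    simp [this] at hB
  refine ⟨a, ha, ?_, ?_⟩
  · intro p q hp hq hpq
    by_cases h1 : p = x
    · subst h1
      have hqp : q ≠ p := hpq.ne'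
      rw [Function.update_self, Function.update_of_ne hqp]
      rintro rfl
      exact ha (hcol q (by simpa) (by simpa [hqp] using hq))
    · by_cases h2 : q = x
      · subst h2
        rw [Function.update_self, Function.update_of_ne h1]
        rintro rfl
        exact ha (hcol p (by simpa using hpq.symm) (by simpa [h1] using hp))
      · rw [Function.update_of_ne h1, Function.update_of_ne h2]
        exact h.proper p q (by simpa [h1] using hp) (by simpa [h2] using hq) hpq
  · intro z hz hd
    by_cases hxz : x ∈ nbr H z
    · have hzU : nbr H z ∩ U = {x} := by
        ext w
        rw [mem_inter, mem_singleton]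
        constructor
        · rintro ⟨h1, h2⟩
          by_contra hw
          exact disjoint_left.1 hd h1 (by simp [hw, h2])
        · rintro rfl; exact ⟨hxz, hx⟩
      -- Coloring `x` with `a` toggles `a` in the odd set of `z`, so the result is empty only if the
      -- odd set was `{a}`; but then `a ∈ B`.
      by_contra hne
      rw [not_nonempty_iff_eq_empty] at hne
      refine ha (hkill z (mem_nbr_comm.1 hxz) hz hzU a ?_)
      ext b
      have := mem_oddAt_update (c := c) (a := a) (b := b) hx hxz
      rw [hne] at this
      simp only [notMem_empty, false_iff] at this
      rw [mem_singleton]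
      tauto
    · rw [oddAt_update_of_notMem hxz]
      refine h.odd z hz (disjoint_left.2 fun w hw hwU => disjoint_left.1 hd hw ?_)
      have : w ≠ x := by rintro rfl; exact hxz hw
      simp [this, hwU]

/-- Vertices with `deg + (number of needy neighbors) ≤ 7` can be colored last. -/
theorem PartialOdd.finish (h : PartialOdd H F c U)
    (hU : ∀ v ∈ U, deg H v + #{z ∈ nbr H v | Needy H F z} ≤ 7) : Good H F := by
  induction hn : #U generalizing U c with
  | zero => rw [card_eq_zero] at hn; subst hn; exact ⟨c, h⟩
  | succ n ih =>
    obtain ⟨x, hx⟩ : U.Nonempty := card_pos.1 (by omega)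
    obtain ⟨a, -, ha⟩ := h.step hx
      ((nbr H x).image c ∪ ({z ∈ nbr H x | Needy H F z} : Finset V).image (kill H c U))
      (by
        refine (card_union_le _ _).trans (le_trans ?_ (hU x hx))
        exact Nat.add_le_add card_image_le card_image_le)
      (fun w hw _ => mem_union_left _ (mem_image_of_mem _ hw))
      (fun z hz hzn _ o ho => mem_union_right _
        (mem_image.2 ⟨z, by simpa [hzn] using hz, kill_eq ho⟩))
    exact ih ha (fun v hv => hU v (mem_of_mem_erase hv)) (by rw [card_erase_of_mem hx, hn]; rfl)

/-- The colors on `X` are forgotten. A vertex outside `X` without neighbors in `X` has the same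
neighborhood in both graphs and stays odd. All other needy vertices have an uncolored neighbor,
which for those in `X` is what `hX` says, and so carry no condition yet. -/
theorem Good.start {X : Finset V} (h : Good (del H X) F)
    (hX : ∀ z ∈ X, Needy H F z → ∃ w ∈ X, H.Adj z w) : ∃ c, PartialOdd H F c X := by
  obtain ⟨c, hc⟩ := h
  refine ⟨c, fun a b ha hb hab => hc.proper a b (by simp) (by simp) ⟨hab, ha, hb⟩, ?_⟩
  intro z hz hd
  have hzX : z ∉ X := by
    intro hzX
    obtain ⟨w, hw, hzw⟩ := hX z hzX hz
    exact disjoint_left.1 hd (by simpa) hw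
  have hn : nbr (del H X) z = nbr H z := by
    ext w
    simp only [mem_nbr]
    exact ⟨fun h => h.1, fun h => ⟨h, hzX, fun hw => disjoint_left.1 hd (by simpa) hw⟩⟩
  have := hc.odd z (by simpa [Needy, deg, hn] using hz) (by simp)
  have h2 : nbr H z \ X = nbr H z := sdiff_eq_self_of_disjoint hd
  simpa only [oddAt, hn, sdiff_empty, h2] using this

end

/-! ### Reducible configurations -/

/-- The number of edges. -/
def esize {V : Type*} (H : SimpleGraph V) : ℕ := H.edgeSet.ncard

/-- A minimal pair `(H, F)` without a good coloring; the edges of `H` that are not edges of `G`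
join free vertices. -/
structure Irred {V : Type*} [Fintype V] (G H : SimpleGraph V) (F : Set V) : Prop where
  tor : H.IsToroidal
  noAdj : G.NoAdjacentTriangles
  real : ∀ u w, u ∉ F → H.Adj u w → G.Adj u w
  bad : ¬ Good H F
  del_good : ∀ X : Finset V, (∃ x ∈ X, 0 < deg H x) → Good (del H X) F
  two : ∀ v ∉ F, deg H v ≠ 2

section

variable {V : Type*} [Fintype V] {G H : SimpleGraph V} {F : Set V}

theorem Irred.exists_partial (h : Irred G H F) (X : Finset V) (hX : ∃ x ∈ X, 0 < deg H x)
    (hX' : ∀ z ∈ X, Needy H F z → ∃ w ∈ X, H.Adj z w) : ∃ c, PartialOdd H F c X :=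
  (h.del_good X hX).start hX'

/-- No late coloring of the flexible neighbors `Y` of `w` is possible. -/
theorem Irred.false_of_bound (h : Irred G H F) {w : V} (hw : 0 < deg H w) (hwn : ¬ Needy H F w)
    {Y : Finset V} (hY : Y ⊆ nbr H w)
    (hflex : ∀ v ∈ Y, deg H v + #{z ∈ nbr H v | Needy H F z} ≤ 7)
    (hB : ∀ c : V → Fin 8, ∃ B : Finset (Fin 8), #B ≤ 7 ∧ (∀ z ∈ nbr H w \ Y, c z ∈ B) ∧
      ∀ z ∈ nbr H w, (z ∈ Y ∨ z ∈ nbr H w \ Y ∧ Needy H F z ∧ Disjoint (nbr H z) Y) →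
        nbr H z ∩ insert w Y = {w} → ∀ o, oddAt H c (insert w Y) z = {o} → o ∈ B) : False := by
  have hwY : w ∉ Y := fun h => by simpa using hY h
  obtain ⟨c, hc⟩ := h.exists_partial (insert w Y) ⟨w, mem_insert_self _ _, hw⟩ (by
    intro z hz hzn
    rcases mem_insert.1 hz with rfl | hz
    · exact absurd hzn hwn
    · exact ⟨w, mem_insert_self _ _, (mem_nbr.1 (hY hz)).symm⟩)
  obtain ⟨B, hB7, hBc, hBk⟩ := hB c
  obtain ⟨a, -, ha⟩ := hc.step (mem_insert_self _ _) B hB7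
    (by
      intro z hz hzU
      rw [mem_insert, not_or] at hzU
      exact hBc z (mem_sdiff.2 ⟨hz, hzU.2⟩))
    (by
      intro z hz hzn hzU o ho
      -- As `w` is the last uncolored neighbor of `z`, no neighbor of `z` lies in `Y`. Needy
      -- neighbors adjacent to `Y` therefore cost `w` only their color.
      refine hBk z hz ?_ hzU o ho
      by_cases hzY : z ∈ Y
      · exact Or.inl hzY
      · refine Or.inr ⟨mem_sdiff.2 ⟨hz, hzY⟩, hzn, disjoint_left.2 fun u hu huY => ?_⟩
        have : u ∈ nbr H z ∩ insert w Y := mem_inter.2 ⟨hu, mem_insert_of_mem huY⟩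
        rw [hzU, mem_singleton] at this
        exact hwY (this ▸ huY))
  rw [erase_insert hwY] at ha
  exact h.bad (ha.finish hflex)

/-- A flexible neighbor is cheap, and so is a needy neighbor of a flexible neighbor. -/
theorem Irred.eight_le (h : Irred G H F) {w : V} (hw : 0 < deg H w) (hwn : ¬ Needy H F w)
    {Y : Finset V} (hY : Y ⊆ nbr H w)
    (hflex : ∀ v ∈ Y, deg H v + #{z ∈ nbr H v | Needy H F z} ≤ 7) :
    8 ≤ deg H w + #{z ∈ nbr H w \ Y | Needy H F z ∧ Disjoint (nbr H z) Y} := by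
  by_contra! hlt
  refine h.false_of_bound hw hwn hY hflex fun c => ?_
  set K := kill H c (insert w Y)
  set Z : Finset V := {z ∈ nbr H w \ Y | Needy H F z ∧ Disjoint (nbr H z) Y}
  -- A vertex of `Y` is uncolored and contributes only a kill, a vertex of `Z` a color and a kill,
  -- and any other neighbor only a color: `deg H w + #Z` in all.
  refine ⟨(nbr H w \ Y).image c ∪ Y.image K ∪ Z.image K, ?_, ?_, ?_⟩
  · have h1 : #(nbr H w \ Y) + #Y = deg H w := card_sdiff_add_card_eq_card hY
    have h2 := card_image_le (s := nbr H w \ Y) (f := c)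
    have h3 := card_image_le (s := Y) (f := K)
    have h4 := card_image_le (s := Z) (f := K)
    refine (card_union_le _ _).trans ?_
    have := card_union_le ((nbr H w \ Y).image c) (Y.image K)
    omega
  · intro z hz
    exact mem_union_left _ (mem_union_left _ (mem_image_of_mem _ hz))
  · rintro z hz (hzY | hzY) - o ho
    · exact mem_union_left _ (mem_union_right _ (mem_image.2 ⟨z, hzY, kill_eq ho⟩))
    · exact mem_union_right _ (mem_image.2 ⟨z, mem_filter.2 hzY, kill_eq ho⟩)

/-- If three neighbors of `v` are colored, then the color to avoid for the sake of `v` is among the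
colors of two of them unless these two have the same color. -/
theorem oddAt_three {c : V → Fin 8} {U : Finset V} {v n₁ n₂ n₃ : V} (h12 : n₁ ≠ n₂) (h13 : n₁ ≠ n₃)
    (h23 : n₂ ≠ n₃) (hn : nbr H v \ U = {n₁, n₂, n₃}) {o : Fin 8} (ho : oddAt H c U v = {o})
    (hc : c n₁ ≠ c n₂) : o = c n₁ ∨ o = c n₂ := by
  have key : ∀ a, a ∈ oddAt H c U v ↔ a = o := by simp [ho]
  simp only [mem_oddAt, hn] at key
  by_contra! hcon
  have e : ∀ a, #{w ∈ ({n₁, n₂, n₃} : Finset V) | c w = a}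
      = (if c n₁ = a then 1 else 0) + (if c n₂ = a then 1 else 0) + (if c n₃ = a then 1 else 0) := by
    intro a
    rw [card_filter, sum_insert (by simp [h12, h13]), sum_insert (by simp [h23]), sum_singleton,
      add_assoc]
  simp only [e] at key
  -- Unless `n₃` repeats the color of `n₁`, that color occurs exactly once and must be `o`; the same
  -- holds for `n₂`. But `n₃` cannot repeat two different colors.
  have k1 := key (c n₁)
  have k2 := key (c n₂)
  have e1 : c n₃ = c n₁ := by
    by_contra h3
    simp [hc.symm, h3] at k1
    exact hcon.1 k1.symm
  have e2 : c n₃ = c n₂ := by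
    by_contra h3
    simp [hc, h3] at k2
    exact hcon.2 k2.symm
  exact hc (e1.symm.trans e2)

/-- A flexible neighbor of degree four is even cheaper if it has two further neighbors in common
with `w`. -/
theorem Irred.nine_le (h : Irred G H F) {w : V} (hw : 0 < deg H w) (hwn : ¬ Needy H F w)
    {Y : Finset V} (hY : Y ⊆ nbr H w)
    (hflex : ∀ v ∈ Y, deg H v + #{z ∈ nbr H v | Needy H F z} ≤ 7) {v n₁ n₂ : V} (hv : v ∈ Y)
    (hv4 : deg H v = 4) (h12 : n₁ ≠ n₂) (hn₁ : n₁ ∈ nbr H w \ Y) (hn₂ : n₂ ∈ nbr H w \ Y)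
    (hvn₁ : n₁ ∈ nbr H v) (hvn₂ : n₂ ∈ nbr H v) :
    9 ≤ deg H w + #{z ∈ nbr H w \ Y | Needy H F z ∧ Disjoint (nbr H z) Y} := by
  by_contra! hlt
  refine h.false_of_bound hw hwn hY hflex fun c => ?_
  set K := kill H c (insert w Y)
  set Z : Finset V := {z ∈ nbr H w \ Y | Needy H F z ∧ Disjoint (nbr H z) Y}
  have h1 : #(nbr H w \ Y) + #Y = deg H w := card_sdiff_add_card_eq_card hY
  have h4 := card_image_le (s := Z) (f := K)
  -- One color is saved either way: equal colors count once, and different colors force the kill of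
  -- `v` to be one of them, hence to be avoided already.
  by_cases hc : c n₁ = c n₂
  · refine ⟨((nbr H w \ Y).erase n₁).image c ∪ Y.image K ∪ Z.image K, ?_, ?_, ?_⟩
    · have h2 := card_image_le (s := (nbr H w \ Y).erase n₁) (f := c)
      have h3 := card_image_le (s := Y) (f := K)
      have h5 := card_erase_add_one hn₁
      refine (card_union_le _ _).trans ?_
      have := card_union_le (((nbr H w \ Y).erase n₁).image c) (Y.image K)
      omega
    · intro z hz
      refine mem_union_left _ (mem_union_left _ ?_)
      by_cases hz1 : z = n₁
      · subst hz1
        exact mem_image.2 ⟨n₂, mem_erase.2 ⟨h12.symm, hn₂⟩, hc.symm⟩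
      · exact mem_image_of_mem _ (mem_erase.2 ⟨hz1, hz⟩)
    · rintro z hz (hzY | hzY) - o ho
      · exact mem_union_left _ (mem_union_right _ (mem_image.2 ⟨z, hzY, kill_eq ho⟩))
      · exact mem_union_right _ (mem_image.2 ⟨z, mem_filter.2 hzY, kill_eq ho⟩)
  · refine ⟨(nbr H w \ Y).image c ∪ (Y.erase v).image K ∪ Z.image K, ?_, ?_, ?_⟩
    · have h2 := card_image_le (s := nbr H w \ Y) (f := c)
      have h3 := card_image_le (s := Y.erase v) (f := K)
      have h5 := card_erase_add_one hv
      refine (card_union_le _ _).trans ?_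
      have := card_union_le ((nbr H w \ Y).image c) ((Y.erase v).image K)
      omega
    · intro z hz
      exact mem_union_left _ (mem_union_left _ (mem_image_of_mem _ hz))
    · rintro z hz (hzY | hzY) hzU o ho
      · by_cases hzv : z = v
        · subst hzv
          have hs : nbr H z \ insert w Y = (nbr H z).erase w := by
            rw [← sdiff_inter_self_left, hzU, sdiff_singleton_eq_erase]
          have hw1 : n₁ ≠ w := by rintro rfl; simp at hn₁
          have hw2 : n₂ ≠ w := by rintro rfl; simp at hn₂
          have hwz : w ∈ nbr H z := mem_nbr_comm.1 hz
          have hcard : #(((nbr H z).erase w).erase n₁ |>.erase n₂) = 1 := by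
            rw [card_erase_of_mem (by simp [h12.symm, hw2, hvn₂]),
              card_erase_of_mem (by simp [hw1, mem_nbr.1 hvn₁]), card_erase_of_mem hwz]
            simp only [deg] at hv4
            omega
          obtain ⟨n₃, hn₃⟩ := card_eq_one.1 hcard
          have hm : n₃ ∈ (((nbr H z).erase w).erase n₁).erase n₂ := by rw [hn₃]; simp
          simp only [mem_erase] at hm
          have hset : nbr H z \ insert w Y = {n₁, n₂, n₃} := by
            rw [hs, ← insert_erase (s := (nbr H z).erase w) (a := n₁)
              (mem_erase.2 ⟨hw1, hvn₁⟩), ← insert_erase (s := ((nbr H z).erase w).erase n₁)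
              (a := n₂) (mem_erase.2 ⟨h12.symm, mem_erase.2 ⟨hw2, hvn₂⟩⟩), hn₃]
          refine mem_union_left _ (mem_union_left _ ?_)
          rcases oddAt_three h12 (Ne.symm hm.2.1) (Ne.symm hm.1) hset ho hc with rfl | rfl
          · exact mem_image_of_mem _ hn₁
          · exact mem_image_of_mem _ hn₂
        · exact mem_union_left _ (mem_union_right _
            (mem_image.2 ⟨z, mem_erase.2 ⟨hzv, hzY⟩, kill_eq ho⟩))
      · exact mem_union_right _ (mem_image.2 ⟨z, mem_filter.2 hzY, kill_eq ho⟩)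

/-- If the colored neighbors of `v` are three vertices with distinct colors, then no color has to
be avoided for the sake of `v`. -/
theorem oddAt_ne_singleton {c : V → Fin 8} {U : Finset V} {v : V} (h3 : #(nbr H v \ U) = 3)
    (hi : 3 ≤ #((nbr H v \ U).image c)) {o : Fin 8} : oddAt H c U v ≠ {o} := by
  intro ho
  have hinj : Set.InjOn c (nbr H v \ U : Finset V) := by
    rw [← card_image_iff]
    exact le_antisymm card_image_le (h3 ▸ hi)
  have : (nbr H v \ U).image c ⊆ {o} := by
    intro a ha
    rw [← ho, mem_oddAt]
    obtain ⟨w, hw, rfl⟩ := mem_image.1 ha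
    have : ({u ∈ nbr H v \ U | c u = c w} : Finset V) = {w} := by
      ext u
      rw [mem_filter, mem_singleton]
      exact ⟨fun hu => hinj hu.1 hw hu.2, fun hu => by rw [hu]; exact ⟨hw, rfl⟩⟩
    rw [this]; simp
  have := card_le_card this
  simp at this
  omega

/-- Needy vertices of degree four are pairwise nonadjacent. -/
theorem Irred.not_adj_of_four (h : Irred G H F) {v w : V} (hv : Needy H F v) (hw : Needy H F w)
    (hv4 : deg H v = 4) (hw4 : deg H w = 4) : ¬ H.Adj v w := by
  intro hvw
  have hne := hvw.ne
  obtain ⟨c, hc⟩ := h.exists_partial {v, w} ⟨v, by simp, hv.2.1⟩ (by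
    intro z hz _
    rcases mem_insert.1 hz with rfl | hz
    · exact ⟨w, by simp, hvw⟩
    · rw [mem_singleton] at hz; subst hz
      exact ⟨v, by simp, hvw.symm⟩)
  -- `v` is colored before `w`. For `v` there are three colors and at most four kills to avoid. For
  -- `w` there are either at most 2 + 1 colors and four kills, or at most 3 + 1 colors and three
  -- kills, since `v` kills nothing when its three colored neighbors have distinct colors.
  have key : ∀ v w : V, Needy H F v → Needy H F w → deg H v = 4 → deg H w = 4 → H.Adj v w →
      PartialOdd H F c {v, w} →
      #((nbr H w \ {v, w}).image c) ≤ 2 ∨ 3 ≤ #((nbr H v \ {v, w}).image c) → False := by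
    clear hv hw hv4 hw4 hvw hne hc
    intro v w hv hw hv4 hw4 hvw hc hcase
    have hne := hvw.ne
    have hsv : nbr H v \ {v, w} = (nbr H v).erase w := by
      ext u; simp only [mem_sdiff, mem_insert, mem_singleton, mem_erase, mem_nbr]
      constructor
      · tauto
      · rintro ⟨h1, h2⟩; exact ⟨h2, by rintro (rfl | rfl) <;> simp_all⟩
    have hsw : nbr H w \ {v, w} = (nbr H w).erase v := by
      ext u; simp only [mem_sdiff, mem_insert, mem_singleton, mem_erase, mem_nbr]
      constructor
      · tauto
      · rintro ⟨h1, h2⟩; exact ⟨h2, by rintro (rfl | rfl) <;> simp_all⟩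
    have c3 : #(nbr H v \ {v, w}) = 3 := by
      rw [hsv, card_erase_of_mem (by simpa)]; simp only [deg] at hv4; omega
    have d3 : #(nbr H w \ {v, w}) = 3 := by
      rw [hsw, card_erase_of_mem (by simpa using hvw.symm)]; simp only [deg] at hw4; omega
    set K := kill H c {v, w}
    obtain ⟨a, -, ha⟩ := hc.step (x := v) (by simp)
      ((nbr H v \ {v, w}).image c ∪ (nbr H v).image K)
      (by
        have h1 := card_image_le (s := nbr H v \ {v, w}) (f := c)
        have h2 := card_image_le (s := nbr H v) (f := K)
        have := card_union_le ((nbr H v \ {v, w}).image c) ((nbr H v).image K)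
        simp only [deg] at hv4
        omega)
      (fun z hz hzU => mem_union_left _ (mem_image_of_mem _ (mem_sdiff.2 ⟨hz, hzU⟩)))
      (fun z hz _ _ o ho => mem_union_right _ (mem_image.2 ⟨z, hz, kill_eq ho⟩))
    have hU : ({v, w} : Finset V).erase v = {w} := by
      rw [erase_insert (by simpa using hne)]
    rw [hU] at ha
    set c' := Function.update c v a with hc'
    have e1 : nbr H v \ {w} = nbr H v \ {v, w} := by
      ext u; simp only [mem_sdiff, mem_insert, mem_singleton, mem_nbr]
      constructor
      · rintro ⟨h1, h2⟩; exact ⟨h1, by rintro (rfl | rfl) <;> simp_all⟩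
      · tauto
    have e2 : (nbr H v \ {w}).image c' = (nbr H v \ {v, w}).image c := by
      rw [e1]
      refine image_congr fun u hu => ?_
      have : u ≠ v := by rintro rfl; simp at hu
      rw [hc', Function.update_of_ne this]
    have e3 : (nbr H w).image c' = insert a ((nbr H w \ {v, w}).image c) := by
      rw [hsw, ← insert_erase (s := nbr H w) (a := v) (by simpa using hvw.symm), image_insert,
        hc', Function.update_self, erase_insert (by simp)]
      congr 1
      refine image_congr fun u hu => ?_
      have : u ≠ v := by rintro rfl; simp at hu
      rw [Function.update_of_ne this]
    set K' := kill H c' {w}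
    have i3 := card_insert_le a ((nbr H w \ {v, w}).image c)
    rcases hcase with hcase | hcase
    · obtain ⟨b, -, hb⟩ := ha.step (x := w) (by simp)
        ((nbr H w).image c' ∪ (nbr H w).image K')
        (by
          have h2 := card_image_le (s := nbr H w) (f := K')
          have := card_union_le ((nbr H w).image c') ((nbr H w).image K')
          rw [e3] at this ⊢
          simp only [deg] at hw4
          omega)
        (fun z hz _ => mem_union_left _ (mem_image_of_mem _ hz))
        (fun z hz _ _ o ho => mem_union_right _ (mem_image.2 ⟨z, hz, kill_eq ho⟩))
      exact h.bad ⟨_, by simpa using hb⟩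
    · obtain ⟨b, -, hb⟩ := ha.step (x := w) (by simp)
        ((nbr H w).image c' ∪ ((nbr H w).erase v).image K')
        (by
          have h2 := card_image_le (s := (nbr H w).erase v) (f := K')
          have h3 := card_image_le (s := nbr H w \ {v, w}) (f := c)
          have := card_union_le ((nbr H w).image c') (((nbr H w).erase v).image K')
          rw [e3] at this ⊢
          rw [← hsw] at h2
          rw [← hsw] at this ⊢
          omega)
        (fun z hz _ => mem_union_left _ (mem_image_of_mem _ hz))
        (fun z hz _ _ o ho => by
          by_cases hzv : z = v
          · subst hzv
            refine absurd ho (oddAt_ne_singleton ?_ ?_)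
            · rw [e1, c3]
            · rw [e2]; exact hcase
          · exact mem_union_right _ (mem_image.2 ⟨z, mem_erase.2 ⟨hzv, hz⟩, kill_eq ho⟩))
      exact h.bad ⟨_, by simpa using hb⟩
  -- Whichever of the two alternatives holds at `w`, some order of `v` and `w` works: three colors
  -- around `w` put `w` first.
  rcases Nat.lt_or_ge 2 #((nbr H w \ {v, w}).image c) with h3 | h3
  · refine key w v hw hv hw4 hv4 hvw.symm (by rwa [pair_comm]) (Or.inr ?_)
    rw [pair_comm]; exact h3
  · exact key v w hv hw hv4 hw4 hvw hc (Or.inl h3)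

end

/-! ### Recoloring with a neighbor of degree five -/

section

variable {V : Type*} [Fintype V] {G H : SimpleGraph V} {F : Set V}

/-- The color that `w` has to avoid for the sake of a neighbor `x` of degree five that is colored
after `w` and shares the needy neighbors `u` and `u'` with `w`. -/
def pairKill (H : SimpleGraph V) (c : V → Fin 8) (U : Finset V) (u u' : V) : Fin 8 :=
  if h : (oddAt H c U u ∩ oddAt H c U u').Nonempty then h.choose else 0

theorem pairKill_eq {c : V → Fin 8} {U : Finset V} {u u' : V} {a k k' : Fin 8} (hkk : k ≠ k')
    (h : ∀ b, b ∈ oddAt H c U u ↔ b = a ∨ b = k) (h' : ∀ b, b ∈ oddAt H c U u' ↔ b = a ∨ b = k') :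
    pairKill H c U u u' = a := by
  have h1 : (oddAt H c U u ∩ oddAt H c U u').Nonempty := ⟨a, by simp [h, h']⟩
  rw [pairKill, dif_pos h1]
  have := h1.choose_spec
  rw [mem_inter, h, h'] at this
  rcases this with ⟨h2 | h2, h3 | h3⟩
  · exact h2
  · exact h2
  · exact h3
  · exact absurd (h2.symm.trans h3) hkk

/-- The order is `w`, then `x`, then `Y`. At `x`, five neighbor colors and three kills might exhaust
the palette, unless `u` or `u'` kills nothing new. Otherwise their kills `k` and `k'` are distinct
and differ from the color `a` of `w`, so before `w` was colored the odd sets were `{a, k}` and `{a,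
k'}`. Then `a` is their only common element, which is known beforehand, and `w` avoids it as
`pairKill`. So `x` costs `w` a single color, and needy common neighbors of `w` and `x` kill nothing
at `w`, because `x` is still uncolored. -/
theorem Irred.eight_le_of_poor (h : Irred G H F) {w x u u' : V} (hwn : ¬ Needy H F w)
    (hxn : ¬ Needy H F x) (hwx : H.Adj w x) (hx5 : deg H x = 5)
    (hx3 : #{z ∈ nbr H x | Needy H F z} ≤ 3) {Y : Finset V} (hY : Y ⊆ nbr H w)
    (hflex : ∀ v ∈ Y, deg H v + #{z ∈ nbr H v | Needy H F z} ≤ 7) (hxY : x ∉ Y)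
    (hYx : ∀ v ∈ Y, ¬ H.Adj x v) (hu : Needy H F u) (hu' : Needy H F u') (huu : u ≠ u')
    (hwu : H.Adj w u) (hwu' : H.Adj w u') (hxu : H.Adj x u) (hxu' : H.Adj x u') :
    8 ≤ deg H w + #{z ∈ nbr H w \ insert x Y | Needy H F z ∧ Disjoint (nbr H z) (insert x Y)} := by
  by_contra! hlt
  have hwY : w ∉ Y := fun h => by simpa using hY h
  have hwxY : w ∉ insert x Y := by simp [hwY, hwx.ne]
  have hYw : insert x Y ⊆ nbr H w := by
    intro z hz
    rcases mem_insert.1 hz with rfl | hz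
    · simpa
    · exact hY hz
  set X := insert w (insert x Y) with hX
  obtain ⟨c, hc⟩ := h.exists_partial X ⟨w, mem_insert_self _ _, card_pos.2 ⟨x, by simpa⟩⟩ (by
    intro z hz hzn
    rcases mem_insert.1 hz with rfl | hz
    · exact absurd hzn hwn
    · exact ⟨w, mem_insert_self _ _, (mem_nbr.1 (hYw hz)).symm⟩)
  set K := kill H c X
  set Z : Finset V :=
    {z ∈ nbr H w \ insert x Y | Needy H F z ∧ Disjoint (nbr H z) (insert x Y)}
  set j := pairKill H c X u u'
  obtain ⟨a, ha, hca⟩ := hc.step (mem_insert_self _ _)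
    (insert j ((nbr H w \ insert x Y).image c ∪ Y.image K ∪ Z.image K))
    (by
      have h1 : #(nbr H w \ insert x Y) + #(insert x Y) = deg H w :=
        card_sdiff_add_card_eq_card hYw
      rw [card_insert_of_notMem hxY] at h1
      have h2 := card_image_le (s := nbr H w \ insert x Y) (f := c)
      have h3 := card_image_le (s := Y) (f := K)
      have h4 := card_image_le (s := Z) (f := K)
      refine (card_insert_le _ _).trans ?_
      have := card_union_le ((nbr H w \ insert x Y).image c) (Y.image K)
      have := card_union_le ((nbr H w \ insert x Y).image c ∪ Y.image K) (Z.image K)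
      omega)
    (by
      intro z hz hzU
      rw [mem_insert, not_or] at hzU
      exact mem_insert_of_mem (mem_union_left _ (mem_union_left _
        (mem_image_of_mem _ (mem_sdiff.2 ⟨hz, hzU.2⟩)))))
    (by
      intro z hz hzn hzU o ho
      refine mem_insert_of_mem ?_
      by_cases hzY : z ∈ Y
      · exact mem_union_left _ (mem_union_right _ (mem_image.2 ⟨z, hzY, kill_eq ho⟩))
      · have hzx : z ≠ x := by rintro rfl; exact hxn hzn
        refine mem_union_right _ (mem_image.2 ⟨z, mem_filter.2 ⟨mem_sdiff.2 ⟨hz, ?_⟩, hzn, ?_⟩,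
          kill_eq ho⟩)
        · simp [hzY, hzx]
        · refine disjoint_left.2 fun v hv hvY => ?_
          have : v ∈ nbr H z ∩ X := mem_inter.2 ⟨hv, mem_insert_of_mem hvY⟩
          rw [hzU, mem_singleton] at this
          exact hwxY (this ▸ hvY))
  rw [hX, erase_insert hwxY] at hca
  set c' := Function.update c w a with hc'
  have hca' : c' w = a := by simp [hc']
  have haw : a ∈ (nbr H x).image c' := mem_image.2 ⟨w, by simpa using hwx.symm, hca'⟩
  set N : Finset V := {z ∈ nbr H x | Needy H F z}
  set K' := kill H c' (insert x Y)
  have finish : ∀ B : Finset (Fin 8), #B ≤ 7 → (∀ z ∈ nbr H x, c' z ∈ B) →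
      (∀ z ∈ N, ∀ o, oddAt H c' (insert x Y) z = {o} → o ∈ B) → False := by
    intro B hB7 hBc hBk
    obtain ⟨b, -, hb⟩ := hca.step (mem_insert_self _ _) B hB7 (fun z hz _ => hBc z hz)
      (fun z hz hzn _ => hBk z (mem_filter.2 ⟨hz, hzn⟩))
    rw [erase_insert hxY] at hb
    exact h.bad (hb.finish hflex)
  have hi5 : #((nbr H x).image c') ≤ 5 := hx5 ▸ card_image_le
  -- a needy neighbor of `x` that does not forbid a new color
  have save : ∀ v ∈ N, (∀ o, oddAt H c' (insert x Y) v = {o} →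
      o ∈ (nbr H x).image c' ∪ (N.erase v).image K') → False := by
    intro v hv hvo
    refine finish ((nbr H x).image c' ∪ (N.erase v).image K') ?_
      (fun z hz => mem_union_left _ (mem_image_of_mem _ hz)) ?_
    · have h2 := card_image_le (s := N.erase v) (f := K')
      have h3 := card_erase_add_one hv
      have := card_union_le ((nbr H x).image c') ((N.erase v).image K')
      omega
    · intro z hz o ho
      by_cases hzv : z = v
      · subst hzv; exact hvo o ho
      · exact mem_union_right _ (mem_image.2 ⟨z, mem_erase.2 ⟨hzv, hz⟩, kill_eq ho⟩)
  have huN : u ∈ N := by simp [N, hxu, hu]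
  have huN' : u' ∈ N := by simp [N, hxu', hu']
  -- Undoing the toggle by the color of `w` recovers the odd set from before.
  have tog : ∀ v, H.Adj w v → ∀ k, oddAt H c' (insert x Y) v = {k} → k ≠ a →
      ∀ b, b ∈ oddAt H c X v ↔ b = a ∨ b = k := by
    intro v hv k hk hka b
    have := mem_oddAt_update (H := H) (c := c) (a := a) (b := b) (U := X) (x := w) (z := v)
      (mem_insert_self _ _) (by simpa using hv.symm)
    rw [hX, erase_insert hwxY, ← hc', hk, mem_singleton] at this
    rw [hX]
    by_cases hb : b = a
    · subst hb; simp only [Ne.symm hka, ne_eq, not_true, iff_false, not_not, false_iff] at this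
      simp [this]
    · simp only [hb, ne_eq, not_false_iff, iff_true, false_or] at this ⊢
      exact this.symm
  refine save u huN fun k hk => ?_
  by_contra hk1
  rw [mem_union, not_or] at hk1
  refine save u' huN' fun k' hk' => ?_
  by_contra hk1'
  rw [mem_union, not_or] at hk1'
  have hka : k ≠ a := by rintro rfl; exact hk1.1 haw
  have hka' : k' ≠ a := by rintro rfl; exact hk1'.1 haw
  have hkk : k ≠ k' := by
    rintro rfl
    exact hk1.2 (mem_image.2 ⟨u', mem_erase.2 ⟨huu.symm, huN'⟩, kill_eq hk'⟩)
  exact ha (mem_insert.2 (Or.inl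
    (pairKill_eq hkk (tog u hwu k hk hka) (tog u' hwu' k' hk' hka')).symm))

end

/-! ### First returns of a permutation -/

section FirstReturn

variable {α β : Type*} [Finite β] (σ : Equiv.Perm β) (j : α → β)

theorem exists_pow_mem_range (a : α) : ∃ k, 0 < k ∧ (σ ^ k) (j a) ∈ Set.range j :=
  ⟨orderOf σ, orderOf_pos σ, by rw [pow_orderOf_eq_one]; exact ⟨a, rfl⟩⟩

/-- The first time at which the orbit of `j a` returns to the range of `j`. -/
def returnTime (a : α) : ℕ := Nat.find (exists_pow_mem_range σ j a)

/-- The point at which the orbit of `j a` returns to the range of `j`. -/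
def returnFun (a : α) : α := (Nat.find_spec (exists_pow_mem_range σ j a)).2.choose

theorem returnTime_pos (a : α) : 0 < returnTime σ j a :=
  (Nat.find_spec (exists_pow_mem_range σ j a)).1

theorem map_returnFun (a : α) : j (returnFun σ j a) = (σ ^ returnTime σ j a) (j a) :=
  (Nat.find_spec (exists_pow_mem_range σ j a)).2.choose_spec

theorem notMem_range_of_lt {a : α} {i : ℕ} (h0 : 0 < i) (hi : i < returnTime σ j a) :
    (σ ^ i) (j a) ∉ Set.range j := fun h =>
  Nat.find_min (exists_pow_mem_range σ j a) hi ⟨h0, h⟩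

theorem returnTime_le {a : α} {i : ℕ} (h0 : 0 < i) (hi : (σ ^ i) (j a) ∈ Set.range j) :
    returnTime σ j a ≤ i := Nat.find_min' _ ⟨h0, hi⟩

variable {j}

/-- If two starting points return to the same point, cancelling the shorter return time puts one of
them on the orbit of the other before its first return, unless they agree. -/
theorem returnFun_injective (hj : Function.Injective j) :
    Function.Injective (returnFun σ j) := by
  have key : ∀ a b, returnTime σ j a ≤ returnTime σ j b →
      returnFun σ j a = returnFun σ j b → a = b := by
    intro a b hle hab
    have h1 := map_returnFun σ j a
    have h2 := map_returnFun σ j b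
    rw [hab, h2] at h1
    obtain ⟨m, hm⟩ := Nat.exists_eq_add_of_le hle
    rw [hm, pow_add, Equiv.Perm.mul_apply] at h1
    have h3 := (σ ^ returnTime σ j a).injective h1
    rcases Nat.eq_zero_or_pos m with rfl | hm0
    · exact hj (by simpa using h3.symm)
    · have := returnTime_pos σ j a
      exact absurd ⟨a, h3.symm⟩ (notMem_range_of_lt σ j hm0 (by omega))
  intro a b hab
  rcases le_total (returnTime σ j a) (returnTime σ j b) with h | h
  · exact key a b h hab
  · exact (key b a h hab.symm).symm

/-- The permutation induced by `σ` on a subset by skipping all other elements. -/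
def firstReturn (hj : Function.Injective j) : Equiv.Perm α :=
  haveI : Finite α := Finite.of_injective j hj
  Equiv.ofBijective (returnFun σ j)
    (Finite.injective_iff_bijective.1 (returnFun_injective σ hj))

theorem firstReturn_apply (hj : Function.Injective j) (a : α) :
    firstReturn σ hj a = returnFun σ j a := rfl

theorem sameCycle_firstReturn (hj : Function.Injective j) {a b : α}
    (h : σ.SameCycle (j a) (j b)) : (firstReturn σ hj).SameCycle a b := by
  obtain ⟨n, hn⟩ := h.exists_nat_pow_eq
  induction n using Nat.strong_induction_on generalizing a with
  | _ n ih =>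
    rcases Nat.eq_zero_or_pos n with rfl | hn0
    · have : a = b := hj (by simpa using hn)
      rw [this]
    · have hle : returnTime σ j a ≤ n := returnTime_le σ j hn0 ⟨b, hn.symm⟩
      have hpos := returnTime_pos σ j a
      have h1 : (σ ^ (n - returnTime σ j a)) (j (returnFun σ j a)) = j b := by
        rw [map_returnFun σ j, ← Equiv.Perm.mul_apply, ← pow_add, Nat.sub_add_cancel hle, hn]
      have h2 := ih (n - returnTime σ j a) (by omega) (a := returnFun σ j a)
        ⟨(n - returnTime σ j a : ℕ), by rw [zpow_natCast]; exact h1⟩ h1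
      exact (Equiv.Perm.sameCycle_apply_left (f := firstReturn σ hj)).1 h2

/-- A function that does not change along the skipped elements. -/
theorem apply_returnFun {γ : Type*} (S : β → γ) (a : α)
    (hS : ∀ i, 0 < i → (σ ^ i) (j a) ∉ Set.range j →
      S (σ ((σ ^ i) (j a))) = S ((σ ^ i) (j a))) :
    S (j (returnFun σ j a)) = S (σ (j a)) := by
  rw [map_returnFun σ j]
  have key : ∀ i, i < returnTime σ j a → S ((σ ^ (i + 1)) (j a)) = S (σ (j a)) := by
    intro i
    induction i with
    | zero => simp
    | succ i ih =>
      intro hi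
      rw [← ih (by omega), pow_succ' σ (i + 1), Equiv.Perm.mul_apply]
      exact hS (i + 1) (by omega) (notMem_range_of_lt σ j (by omega) hi)
  have := key (returnTime σ j a - 1) (by have := returnTime_pos σ j a; omega)
  rwa [Nat.sub_add_cancel (returnTime_pos σ j a)] at this

end FirstReturn

/-! ### Chains -/

section Chains

variable {V : Type*} {G H : SimpleGraph V}

/-- Extension of a `1`-chain by zero. -/
def ext0 (z : H.edgeSet → ZMod 2) (e : Sym2 V) : ZMod 2 :=
  if h : e ∈ H.edgeSet then z ⟨e, h⟩ else 0

theorem ext0_of_mem (z : H.edgeSet → ZMod 2) (e : H.edgeSet) : ext0 z e = z e := by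
  simp [ext0]

theorem ext0_of_notMem (z : H.edgeSet → ZMod 2) {e : Sym2 V} (he : e ∉ H.edgeSet) :
    ext0 z e = 0 := by simp [ext0, he]

/-- Summing over all vertices, with value zero off the edges, gives a form in which graphs with
different edge sets can be compared. -/
theorem edgeBoundary_apply [Fintype V] (z : H.edgeSet → ZMod 2) (v : V) :
    H.edgeBoundary z v = ∑ w, ext0 z s(v, w) := by
  have e1 : H.edgeBoundary z v = ∑ e : H.edgeSet, if v ∈ (e : Sym2 V) then z e else 0 := by
    simp only [edgeBoundary, LinearMap.pi_apply, LinearMap.sum_apply]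
    apply Finset.sum_congr rfl
    intro e _
    split_ifs <;> simp
  have e2 : ∑ e : H.edgeSet, (if v ∈ (e : Sym2 V) then z e else 0)
      = ∑ e ∈ univ.filter (fun e : Sym2 V => e ∈ H.edgeSet),
        if v ∈ e then ext0 z e else 0 := by
    rw [Finset.sum_subtype (p := fun e => e ∈ H.edgeSet) _ (by simp)]
    refine Finset.sum_congr rfl fun e _ => ?_
    rw [ext0_of_mem]
  have e3 : ∑ w, ext0 z s(v, w) = ∑ e ∈ univ.image (fun w => s(v, w)), ext0 z e := by
    rw [Finset.sum_image]
    intro a _ b _ hab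
    exact Sym2.congr_right.1 hab
  have e4 : univ.image (fun w => s(v, w)) = univ.filter (fun e : Sym2 V => v ∈ e) := by
    ext e
    simp only [mem_image, mem_univ, true_and, mem_filter, Sym2.mem_iff_exists]
    exact exists_congr fun w => eq_comm
  rw [e1, e2, e3, e4, ← Finset.sum_filter, Finset.filter_filter]
  refine Finset.sum_subset (fun e he => by simp_all) fun e he he' => ext0_of_notMem _ ?_
  simp_all

/-- The boundary of a `2`-chain, given as a function on the darts. -/
def dartBoundary [Fintype V] : (H.Dart → ZMod 2) →ₗ[ZMod 2] (H.edgeSet → ZMod 2) :=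
  LinearMap.pi fun e => ∑ d ∈ univ.filter (fun d : H.Dart => d.edge = e), LinearMap.proj d

theorem dartBoundary_apply [Fintype V] (S : H.Dart → ZMod 2) (d : H.Dart) :
    dartBoundary S ⟨d.edge, d.edge_mem⟩ = S d + S d.symm := by
  simp only [dartBoundary, LinearMap.pi_apply, LinearMap.sum_apply, LinearMap.proj_apply]
  have : univ.filter (fun d' : H.Dart => d'.edge = d.edge) = {d, d.symm} := by
    ext d'
    simp [dart_edge_eq_iff]
  rw [this, Finset.sum_pair d.symm_ne.symm]

theorem faceBoundary_eq [Fintype V] (R : H.RotationSystem) (d : H.Dart) :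
    R.faceBoundary d = dartBoundary fun d' => if R.facePerm.SameCycle d d' then 1 else 0 := by
  funext e
  simp only [RotationSystem.faceBoundary, dartBoundary, LinearMap.pi_apply, LinearMap.sum_apply,
    LinearMap.proj_apply]
  rw [Finset.sum_boole, Finset.filter_filter]
  congr 1
  rw [← Set.ncard_coe_finset]
  congr 1
  ext d'
  simp [and_comm]

/-- Two-chains: functions on the darts that are constant on the faces. -/
def faceChains (R : H.RotationSystem) : Submodule (ZMod 2) (H.Dart → ZMod 2) where
  carrier := {S | ∀ d, S (R.facePerm d) = S d}
  add_mem' := fun ha hb d => by simp [ha d, hb d]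
  zero_mem' := fun d => rfl
  smul_mem' := fun a S hS d => by simp [hS d]

theorem faceChains_sameCycle {R : H.RotationSystem} {S : H.Dart → ZMod 2} (hS : S ∈ faceChains R)
    [Fintype V] {d d' : H.Dart} (h : R.facePerm.SameCycle d d') : S d = S d' := by
  obtain ⟨n, rfl⟩ := h.exists_nat_pow_eq
  clear h
  induction n with
  | zero => simp
  | succ n ih => rw [ih, pow_succ', Equiv.Perm.mul_apply, hS]

/-- Functions on darts that are constant on faces, unlike the span of face boundaries, can be pulled
back along maps of darts. -/
theorem boundaries_eq [Fintype V] (R : H.RotationSystem) :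
    R.boundaries = (faceChains R).map dartBoundary := by
  apply le_antisymm
  · refine Submodule.span_le.2 ?_
    rintro _ ⟨d, rfl⟩
    refine ⟨_, ?_, (faceBoundary_eq R d).symm⟩
    intro d'
    simp only [Equiv.Perm.sameCycle_apply_right]
  · rintro _ ⟨S, hS, rfl⟩
    -- `S` is the combination of the indicators of the faces, with its value at a representative as
    -- coefficient.
    have h1 : S = ∑ q : Quotient (Equiv.Perm.SameCycle.setoid R.facePerm),
        S q.out • fun d' => if R.facePerm.SameCycle q.out d' then (1 : ZMod 2) else 0 := by
      funext d
      rw [Finset.sum_apply, Finset.sum_eq_single (Quotient.mk _ d)]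
      · have : R.facePerm.SameCycle (Quotient.mk (Equiv.Perm.SameCycle.setoid R.facePerm) d).out d :=
          Quotient.mk_out (s := Equiv.Perm.SameCycle.setoid R.facePerm) d
        simp [this, faceChains_sameCycle hS this]
      · intro q _ hq
        have : ¬ R.facePerm.SameCycle q.out d := by
          intro hc
          refine hq ?_
          rw [← Quotient.out_eq q]
          exact Quotient.sound (s := Equiv.Perm.SameCycle.setoid R.facePerm) hc
        simp [this]
      · simp
    rw [h1, map_sum]
    refine Submodule.sum_mem _ fun q _ => ?_
    rw [map_smul]
    refine Submodule.smul_mem _ _ ?_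
    rw [← faceBoundary_eq]
    exact Submodule.subset_span ⟨_, rfl⟩

/-- Comparison of first Betti numbers. -/
theorem firstBetti_le [Fintype V] (R : G.RotationSystem) (R' : H.RotationSystem)
    (f : (H.edgeSet → ZMod 2) →ₗ[ZMod 2] (G.edgeSet → ZMod 2))
    (hf : ∀ z, H.edgeBoundary z = 0 → G.edgeBoundary (f z) = 0)
    (hf' : ∀ z, f z ∈ R.boundaries → z ∈ R'.boundaries) : R'.firstBetti ≤ R.firstBetti := by
  let Z := LinearMap.ker H.edgeBoundary
  let g : Z →ₗ[ZMod 2] LinearMap.ker G.edgeBoundary :=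
    (f.comp Z.subtype).codRestrict _ (fun z => hf z z.2)
  let B := R.boundaries.submoduleOf (LinearMap.ker G.edgeBoundary)
  let B' := R'.boundaries.submoduleOf Z
  let k := B.mkQ.comp g
  have hk : LinearMap.ker k ≤ B' := by
    intro z hz
    have : g z ∈ B := by
      rw [LinearMap.mem_ker] at hz
      exact (Submodule.Quotient.mk_eq_zero B).1 hz
    exact hf' z this
  -- Since the kernel of `k` lies in `B'`, the rank of `k` bounds the dimension of `Z ⧸ B'` from
  -- above.
  have h1 := LinearMap.finrank_range_add_finrank_ker k
  have h2 := Submodule.finrank_quotient_add_finrank B'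
  have h3 := Submodule.finrank_mono hk
  have h4 := Submodule.finrank_le (LinearMap.range k)
  change Module.finrank (ZMod 2) (Z ⧸ B') ≤ Module.finrank (ZMod 2) (_ ⧸ B)
  omega

end Chains

/-! ### Operations that preserve toroidality -/

section

variable {V : Type*} {G H : SimpleGraph V}

theorem fst_pow_next (R : G.RotationSystem) (d : G.Dart) (i : ℕ) :
    ((R.next ^ i) d).fst = d.fst := by
  induction i with
  | zero => rfl
  | succ i ih => rw [pow_succ', Equiv.Perm.mul_apply, R.fst_next, ih]

/-- The rotation system on `H` obtained from one on `G` by replacing the darts of `H` by darts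
of `G` and skipping all other darts of `G`. -/
def pullback [Fintype V] (R : G.RotationSystem) (j : H.Dart → G.Dart) (hj : Function.Injective j)
    (hfst : ∀ d, (j d).fst = d.fst) : H.RotationSystem where
  next := firstReturn R.next hj
  fst_next d := by
    rw [← hfst, firstReturn_apply, map_returnFun R.next j, fst_pow_next, hfst]
  sameCycle d d' h := sameCycle_firstReturn R.next hj (R.sameCycle _ _ (by rw [hfst, hfst, h]))

/-- `h2` is constancy along one step of a facial walk, before any skipping; `h1` says that the darts
passed over by the first return do not change the value. -/
theorem comp_mem_faceChains [Fintype V] (R : G.RotationSystem) (j : H.Dart → G.Dart)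
    (hj : Function.Injective j) (hfst : ∀ d, (j d).fst = d.fst) {S : G.Dart → ZMod 2}
    (h1 : ∀ d e, e ∉ Set.range j → e.fst = (j d).fst → S (R.next e) = S e)
    (h2 : ∀ d : H.Dart, S (R.next (j d.symm)) = S (j d)) :
    (fun d => S (j d)) ∈ faceChains (pullback R j hj hfst) := by
  intro d
  change S (j (returnFun R.next j d.symm)) = S (j d)
  rw [apply_returnFun R.next S, h2]
  intro i _ hi
  exact h1 d.symm _ hi (fst_pow_next R _ i)

theorem toroidal_of_pullback [Fintype V] {R : G.RotationSystem} (hR : R.genus ≤ 1)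
    {R' : H.RotationSystem} (h : R'.firstBetti ≤ R.firstBetti) : H.IsToroidal := by
  refine ⟨R', ?_⟩
  have : (R'.firstBetti : ℚ) ≤ R.firstBetti := by exact_mod_cast h
  simp only [RotationSystem.genus] at hR ⊢
  linarith

/-- Subgraphs of toroidal graphs are toroidal. -/
theorem IsToroidal.mono [Fintype V] (hG : G.IsToroidal) (hle : H ≤ G) : H.IsToroidal := by
  obtain ⟨R, hR⟩ := hG
  let j : H.Dart → G.Dart := fun d => ⟨d.toProd, hle d.adj⟩
  have hj : Function.Injective j := fun d d' h =>
    Dart.ext _ _ (congrArg (fun e : G.Dart => e.toProd) h)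
  have hfst : ∀ d, (j d).fst = d.fst := fun d => rfl
  let f : (H.edgeSet → ZMod 2) →ₗ[ZMod 2] (G.edgeSet → ZMod 2) :=
    { toFun := fun z e => ext0 z e
      map_add' := by intro z z'; funext e; simp only [ext0, Pi.add_apply]; split_ifs <;> simp
      map_smul' := by intro a z; funext e; simp only [ext0, Pi.smul_apply]; split_ifs <;> simp }
  have hext : ∀ z e, ext0 (f z) e = ext0 z e := by
    intro z e
    by_cases he : e ∈ G.edgeSet
    · exact ext0_of_mem _ ⟨e, he⟩
    · rw [ext0_of_notMem _ he, ext0_of_notMem _ fun h => he (edgeSet_mono hle h)]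
  refine toroidal_of_pullback hR (firstBetti_le R (pullback R j hj hfst) f ?_ ?_)
  · intro z hz
    funext v
    have := congrFun hz v
    rw [edgeBoundary_apply] at this ⊢
    simpa only [hext] using this
  · intro z hz
    rw [boundaries_eq] at hz ⊢
    obtain ⟨S, hS, hSz⟩ := hz
    refine ⟨fun d => S (j d), comp_mem_faceChains R j hj hfst ?_ ?_, ?_⟩
    · intro d e he _
      have h1 : S e + S e.symm = 0 := by
        rw [← dartBoundary_apply, hSz]
        change ext0 z e.edge = 0
        refine ext0_of_notMem _ fun h => he ⟨⟨e.toProd, h⟩, rfl⟩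
      have h2 : S (R.next e) = S e.symm := by
        have := hS e.symm
        simpa [RotationSystem.facePerm] using this
      rw [h2]
      exact (CharTwo.add_eq_zero.1 h1).symm
    · intro d
      have := hS (j d)
      exact this
    · funext ⟨e, he⟩
      induction e with | _ a b
      have h1 := dartBoundary_apply (fun d => S (j d)) (⟨(a, b), he⟩ : H.Dart)
      have h2 := dartBoundary_apply S (j ⟨(a, b), he⟩)
      rw [hSz] at h2
      change ext0 z s(a, b) = _ at h2
      rw [ext0, dif_pos he] at h2
      exact h1.trans h2.symm

/-- `H` after the replacement of the vertex `v` by an edge between `u` and `w`. -/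
def suppress (H : SimpleGraph V) (v u w : V) : SimpleGraph V where
  Adj a b := (H.Adj a b ∧ a ≠ v ∧ b ≠ v) ∨ (u ≠ w ∧ (a = u ∧ b = w ∨ a = w ∧ b = u))
  symm := ⟨fun a b h => by
    rcases h with ⟨h1, h2, h3⟩ | ⟨h0, h1 | h1⟩
    · exact Or.inl ⟨h1.symm, h3, h2⟩
    · exact Or.inr ⟨h0, Or.inr h1.symm⟩
    · exact Or.inr ⟨h0, Or.inl h1.symm⟩⟩
  loopless := ⟨fun a h => by
    rcases h with h | ⟨h0, ⟨rfl, rfl⟩ | ⟨rfl, rfl⟩⟩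
    · exact H.irrefl h.1
    · exact h0 rfl
    · exact h0 rfl⟩

/-- The path from `u` through `v` to `w` becomes a single edge and the surface is unchanged. The new
darts at `u` and `w` take the places of the darts towards `v`, so that only darts leaving `v` are
skipped. On chains, both edges at `v` receive the coefficient of the new edge. -/
theorem IsToroidal.suppress [Fintype V] (hG : G.IsToroidal) {v u w : V} (huw : u ≠ w)
    (hv : ∀ x, G.Adj v x ↔ x = u ∨ x = w) (hn : ¬ G.Adj u w) :
    (OddToroidal.suppress G v u w).IsToroidal := by
  obtain ⟨R, hR⟩ := hG
  set H := OddToroidal.suppress G v u w with hH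
  have hvu : G.Adj v u := (hv u).2 (Or.inl rfl)
  have hvw : G.Adj v w := (hv w).2 (Or.inr rfl)
  have hadj : ∀ a b, H.Adj a b ↔ (G.Adj a b ∧ a ≠ v ∧ b ≠ v) ∨ (a = u ∧ b = w ∨ a = w ∧ b = u) := by
    intro a b; simp [hH, OddToroidal.suppress, huw]
  let t : V → V → V := fun a b => if a = u ∧ b = w ∨ a = w ∧ b = u then v else b
  have ht : ∀ a b, H.Adj a b → G.Adj a (t a b) := by
    intro a b h
    simp only [t]
    split_ifs with hc
    · rcases hc with ⟨rfl, rfl⟩ | ⟨rfl, rfl⟩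
      · exact hvu.symm
      · exact hvw.symm
    · exact (((hadj a b).1 h).resolve_right hc).1
  let j : H.Dart → G.Dart := fun d => ⟨(d.fst, t d.fst d.snd), ht _ _ d.adj⟩
  have hfst : ∀ d, (j d).fst = d.fst := fun d => rfl
  have hHv : ∀ a b, H.Adj a b → a ≠ v := by
    rintro a b h rfl
    rcases (hadj a b).1 h with h | ⟨rfl, -⟩ | ⟨rfl, -⟩
    · exact h.2.1 rfl
    · exact G.irrefl hvu
    · exact G.irrefl hvw
  have hj : Function.Injective j := by
    intro d d' h
    have e1 : d.fst = d'.fst := congrArg (fun x : G.Dart => x.fst) h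
    have e2 : t d.fst d.snd = t d'.fst d'.snd := congrArg (fun x : G.Dart => x.snd) h
    refine Dart.ext _ _ (Prod.ext e1 ?_)
    have n1 : d.snd ≠ v := hHv _ _ d.adj.symm
    have n2 : d'.snd ≠ v := hHv _ _ d'.adj.symm
    rw [← e1] at e2
    simp only [t] at e2
    split_ifs at e2 with h1 h2 h2
    · rcases h1 with ⟨a1, a2⟩ | ⟨a1, a2⟩ <;> rcases h2 with ⟨b1, b2⟩ | ⟨b1, b2⟩
      · exact a2.trans b2.symm
      · exact absurd (a1.symm.trans b1) huw
      · exact absurd (b1.symm.trans a1) huw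
      · exact a2.trans b2.symm
    · exact absurd e2.symm n2
    · exact absurd e2 n1
    · exact e2
  have hrange : ∀ e : G.Dart, e.fst ≠ v → e ∈ Set.range j := by
    intro e he
    by_cases hs : e.snd = v
    · have hadjv : G.Adj v e.fst := by have := e.adj.symm; rwa [hs] at this
      rcases (hv _).1 hadjv with h1 | h1
      · refine ⟨⟨(u, w), (hadj _ _).2 (Or.inr (Or.inl ⟨rfl, rfl⟩))⟩, Dart.ext _ _ (Prod.ext h1.symm ?_)⟩
        simp [j, t, hs]
      · refine ⟨⟨(w, u), (hadj _ _).2 (Or.inr (Or.inr ⟨rfl, rfl⟩))⟩, Dart.ext _ _ (Prod.ext h1.symm ?_)⟩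
        simp [j, t, hs]
    · refine ⟨⟨(e.fst, e.snd), (hadj _ _).2 (Or.inl ⟨e.adj, he, hs⟩)⟩,
        Dart.ext _ _ (Prod.ext rfl ?_)⟩
      have : ¬ (e.fst = u ∧ e.snd = w ∨ e.fst = w ∧ e.snd = u) := by
        rintro (⟨h1, h2⟩ | ⟨h1, h2⟩)
        · exact hn (h1 ▸ h2 ▸ e.adj)
        · exact hn (h1 ▸ h2 ▸ e.adj.symm)
      simp [j, t, this]
  have hEuw : s(u, w) ∈ H.edgeSet := (hadj _ _).2 (Or.inr (Or.inl ⟨rfl, rfl⟩))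
  -- an edge at `v` is sent to the new edge
  let r : Sym2 V → Sym2 V := fun e => if v ∈ e then s(u, w) else e
  let f : (H.edgeSet → ZMod 2) →ₗ[ZMod 2] (G.edgeSet → ZMod 2) :=
    { toFun := fun z e => ext0 z (r e)
      map_add' := by intro z z'; funext e; simp only [ext0, Pi.add_apply]; split_ifs <;> simp
      map_smul' := by intro a z; funext e; simp only [ext0, Pi.smul_apply]; split_ifs <;> simp }
  have hf : ∀ z a b, ext0 (f z) s(a, b) = if G.Adj a b then ext0 z (r s(a, b)) else 0 := by
    intro z a b
    by_cases he : G.Adj a b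
    · rw [if_pos he]; exact ext0_of_mem _ (⟨s(a, b), he⟩ : G.edgeSet)
    · rw [if_neg he]; exact ext0_of_notMem _ he
  have hvnu : v ≠ u := hvu.ne
  have hvnw : v ≠ w := hvw.ne
  refine toroidal_of_pullback hR (firstBetti_le R (pullback R j hj hfst) f ?_ ?_)
  · intro z hz
    funext x
    have := congrFun hz x
    rw [edgeBoundary_apply] at this ⊢
    by_cases hxv : x = v
    · subst hxv
      simp only [hf, hv, r, Sym2.mem_iff, true_or, if_true]
      rw [← Finset.sum_filter]
      have : (univ.filter fun y : V => y = u ∨ y = w) = {u, w} := by ext; simp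
      rw [this, Finset.sum_pair huw]
      exact CharTwo.add_self_eq_zero _
    · rw [← this]
      by_cases hx : x = u ∨ x = w
      · -- the neighbors `v` and the other end trade places
        obtain ⟨y, hy, hyv, hxy, hGxv, hGxy⟩ : ∃ y, s(x, y) = s(u, w) ∧ y ≠ v ∧ x ≠ y ∧ G.Adj x v ∧
            ¬ G.Adj x y := by
          rcases hx with rfl | rfl
          · exact ⟨w, rfl, hvnw.symm, huw, hvu.symm, hn⟩
          · exact ⟨u, Sym2.eq_swap, hvnu.symm, huw.symm, hvw.symm, fun h => hn h.symm⟩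
        refine Fintype.sum_equiv (Equiv.swap v y) _ _ fun b => ?_
        rw [hf]
        by_cases hbv : b = v
        · subst hbv
          rw [Equiv.swap_apply_left, if_pos hGxv, hy]
          simp [r]
        · by_cases hby : b = y
          · subst hby
            rw [Equiv.swap_apply_right, if_neg hGxy, ext0_of_notMem]
            exact fun h => hHv v x (SimpleGraph.adj_symm _ h) rfl
          · rw [Equiv.swap_apply_of_ne_of_ne hbv hby]
            have hr : r s(x, b) = s(x, b) := by
              simp [r, Ne.symm hxv, Ne.symm hbv]
            rw [hr]
            split_ifs with hG
            · rfl
            · rw [ext0_of_notMem]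
              intro h
              have hne : s(x, b) ≠ s(u, w) := by
                rw [← hy]; intro hc; exact hby (Sym2.congr_right.1 hc)
              rcases (hadj x b).1 h with h | ⟨rfl, rfl⟩ | ⟨rfl, rfl⟩
              · exact hG h.1
              · exact hne rfl
              · exact hne Sym2.eq_swap
      · refine Finset.sum_congr rfl fun b _ => ?_
        rw [hf]
        push Not at hx
        by_cases hbv : b = v
        · subst hbv
          have h1 : ¬ G.Adj x b := fun h => by
            rcases (hv x).1 h.symm with h | h
            · exact hx.1 h
            · exact hx.2 h
          rw [if_neg h1, ext0_of_notMem]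
          exact fun h => hHv b x (SimpleGraph.adj_symm _ h) rfl
        · have hr : r s(x, b) = s(x, b) := by
            simp [r, Ne.symm hxv, Ne.symm hbv]
          rw [hr]
          split_ifs with hG
          · rfl
          · rw [ext0_of_notMem]
            intro h
            rcases (hadj x b).1 h with h | ⟨rfl, rfl⟩ | ⟨rfl, rfl⟩
            · exact hG h.1
            · exact hx.1 rfl
            · exact hx.2 rfl
  · intro z hz
    rw [boundaries_eq] at hz ⊢
    obtain ⟨S, hS, hSz⟩ := hz
    have hφ : ∀ d : G.Dart, S (R.next d.symm) = S d := hS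
    -- the rotation at `v` exchanges the two darts
    have hrot : ∀ a b (ha : G.Adj v a) (hb : G.Adj v b), a ≠ b →
        R.next ⟨(v, a), ha⟩ = ⟨(v, b), hb⟩ := by
      intro a b ha hb hab
      have h1 : (R.next ⟨(v, a), ha⟩).fst = v := R.fst_next _
      have h2 : R.next ⟨(v, a), ha⟩ ≠ ⟨(v, a), ha⟩ := by
        intro hfix
        have h3 := R.sameCycle ⟨(v, a), ha⟩ ⟨(v, b), hb⟩ rfl
        have h4 := h3.eq_of_left hfix
        exact hab (congrArg (fun d : G.Dart => d.snd) h4)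
      have h5 : G.Adj v (R.next ⟨(v, a), ha⟩).snd := by
        have := (R.next ⟨(v, a), ha⟩).adj
        rwa [h1] at this
      have h6 : (R.next ⟨(v, a), ha⟩).snd ≠ a := fun h => h2 (Dart.ext _ _ (Prod.ext h1 h))
      refine Dart.ext _ _ (Prod.ext h1 ?_)
      change (R.next ⟨(v, a), ha⟩).snd = b
      rcases (hv _).1 h5 with h | h <;> rcases (hv a).1 ha with h' | h' <;>
        rcases (hv b).1 hb with h'' | h'' <;> simp_all
    -- A facial walk that enters `v` from one neighbor leaves towards the other.
    have hpass : ∀ a b (ha : G.Adj v a) (hb : G.Adj v b), a ≠ b →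
        S ⟨(a, v), ha.symm⟩ = S ⟨(v, b), hb⟩ := by
      intro a b ha hb hab
      rw [← hrot a b ha hb hab]
      exact (hφ ⟨(a, v), ha.symm⟩).symm
    have hjsymm : ∀ d : H.Dart, S (R.next (j d.symm)) = S (j d) := by
      intro d
      by_cases hc : d.fst = u ∧ d.snd = w ∨ d.fst = w ∧ d.snd = u
      · obtain ⟨ha, hb, hab⟩ : G.Adj v d.fst ∧ G.Adj v d.snd ∧ d.fst ≠ d.snd := by
          rcases hc with ⟨h1, h2⟩ | ⟨h1, h2⟩ <;> rw [h1, h2]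
          · exact ⟨hvu, hvw, huw⟩
          · exact ⟨hvw, hvu, huw.symm⟩
        have e1 : j d = ⟨(d.fst, v), ha.symm⟩ := Dart.ext _ _ (Prod.ext rfl (by simp [j, t, hc]))
        have hc' : d.snd = u ∧ d.fst = w ∨ d.snd = w ∧ d.fst = u := by tauto
        have e2 : j d.symm = (⟨(v, d.snd), hb⟩ : G.Dart).symm :=
          Dart.ext _ _ (Prod.ext rfl (by simp [j, t, hc']))
        rw [e1, e2, hφ, hpass _ _ ha hb hab]
      · have hc' : ¬ (d.snd = u ∧ d.fst = w ∨ d.snd = w ∧ d.fst = u) := by tauto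
        have e2 : j d.symm = (j d).symm :=
          Dart.ext _ _ (Prod.ext (by simp [j, t, hc]) (by simp [j, t, hc']))
        rw [e2, hφ]
    refine ⟨fun d => S (j d), comp_mem_faceChains R j hj hfst ?_ hjsymm, ?_⟩
    · intro d e he hed
      exact absurd (hrange e (by rw [hed, hfst]; exact hHv _ _ d.adj)) he
    · funext ⟨e, he⟩
      induction e with | _ a b
      have h1 := dartBoundary_apply (fun d => S (j d)) (⟨(a, b), he⟩ : H.Dart)
      refine h1.trans ?_
      by_cases hc : a = u ∧ b = w ∨ a = w ∧ b = u
      · obtain ⟨ha, hb, hab⟩ : G.Adj v a ∧ G.Adj v b ∧ a ≠ b := by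
          rcases hc with ⟨h1, h2⟩ | ⟨h1, h2⟩ <;> rw [h1, h2]
          · exact ⟨hvu, hvw, huw⟩
          · exact ⟨hvw, hvu, huw.symm⟩
        have hc' : b = u ∧ a = w ∨ b = w ∧ a = u := by tauto
        have e1 : j ⟨(a, b), he⟩ = ⟨(a, v), ha.symm⟩ :=
          Dart.ext _ _ (Prod.ext rfl (by simp [j, t, hc]))
        have e2 : j (⟨(a, b), he⟩ : H.Dart).symm = ⟨(b, v), hb.symm⟩ :=
          Dart.ext _ _ (Prod.ext rfl (by simp [j, t, hc']))
        have h2 := dartBoundary_apply S ⟨(a, v), ha.symm⟩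
        rw [hSz] at h2
        change ext0 z (r s(a, v)) = _ at h2
        have hab' : s(a, b) = s(u, w) := by
          rcases hc with ⟨rfl, rfl⟩ | ⟨rfl, rfl⟩
          · rfl
          · exact Sym2.eq_swap
        simp only [r, Sym2.mem_iff, or_true, if_true] at h2
        rw [← hab', ext0, dif_pos he] at h2
        rw [e1, e2, h2]
        congr 1
        exact hpass b a hb ha hab.symm
      · have hc' : ¬ (b = u ∧ a = w ∨ b = w ∧ a = u) := by tauto
        obtain ⟨hGab, hav, hbv⟩ := ((hadj a b).1 he).resolve_right hc
        have e1 : j ⟨(a, b), he⟩ = ⟨(a, b), hGab⟩ :=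
          Dart.ext _ _ (Prod.ext rfl (by simp [j, t, hc]))
        have e2 : j (⟨(a, b), he⟩ : H.Dart).symm = (⟨(a, b), hGab⟩ : G.Dart).symm :=
          Dart.ext _ _ (Prod.ext rfl (by simp [j, t, hc']))
        have h2 := dartBoundary_apply S ⟨(a, b), hGab⟩
        rw [hSz] at h2
        change ext0 z (r s(a, b)) = _ at h2
        have hr : r s(a, b) = s(a, b) := by simp [r, Ne.symm hav, Ne.symm hbv]
        rw [hr, ext0, dif_pos he] at h2
        rw [e1, e2, h2]

end

/-! ### Euler's inequality -/

/-- The corner of the same face that follows the corner between `b` and `R.next b`; it lies at the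
end of `R.next b`. -/
def turn {V : Type*} {H : SimpleGraph V} (R : H.RotationSystem) : Equiv.Perm H.Dart :=
  R.next.trans (Function.Involutive.toPerm Dart.symm Dart.symm_involutive)

theorem turn_apply {V : Type*} {H : SimpleGraph V} (R : H.RotationSystem) (b : H.Dart) : turn R b = (R.next b).symm := rfl

/-- The corner between `b` and the next dart is a corner of a triangular face. -/
def Tri {V : Type*} {H : SimpleGraph V} (R : H.RotationSystem) (b : H.Dart) : Prop := turn R (turn R (turn R b)) = b

theorem facePerm_next {V : Type*} {H : SimpleGraph V} (R : H.RotationSystem) (b : H.Dart) :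
    R.facePerm (R.next b) = R.next (turn R b) := rfl

theorem tri_turn {V : Type*} {H : SimpleGraph V} {R : H.RotationSystem} {b : H.Dart} : Tri R (turn R b) ↔ Tri R b :=
  (turn R).injective.eq_iff

section

variable {V : Type*} [Fintype V] {H : SimpleGraph V}

theorem sum_edgeBoundary (z : H.edgeSet → ZMod 2) : ∑ v, H.edgeBoundary z v = 0 := by
  simp only [edgeBoundary_apply]
  rw [← Finset.sum_product' (univ : Finset V) (univ : Finset V) fun v w => ext0 z s(v, w)]
  refine Finset.sum_involution (fun p _ => p.swap) ?_ ?_ ?_ ?_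
  · intro p _
    rw [Prod.fst_swap, Prod.snd_swap, Sym2.eq_swap]
    exact CharTwo.add_self_eq_zero _
  · rintro ⟨v, w⟩ _ hne hvw
    refine hne (ext0_of_notMem _ fun h => ?_)
    have : w = v := congrArg Prod.fst hvw
    subst this
    exact H.irrefl h
  · simp
  · simp

/-- The image of the boundary map is supported on non-isolated vertices and has coordinate sum zero.
Since `v₀` is not isolated, the sum is a nonzero functional there and lowers the bound on the rank
by one. -/
theorem finrank_ker_edgeBoundary {v₀ w₀ : V} (h₀ : H.Adj v₀ w₀) :
    Fintype.card H.edgeSet + 1 ≤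
      Module.finrank (ZMod 2) (LinearMap.ker H.edgeBoundary) + #{v | 0 < deg H v} := by
  let P := {v : V // 0 < deg H v}
  let π : (V → ZMod 2) →ₗ[ZMod 2] (P → ZMod 2) := LinearMap.funLeft _ _ Subtype.val
  let L := π.comp H.edgeBoundary
  let s : (P → ZMod 2) →ₗ[ZMod 2] ZMod 2 := ∑ v, LinearMap.proj v
  have hiso : ∀ z v, ¬ 0 < deg H v → H.edgeBoundary z v = 0 := by
    intro z v hv
    rw [edgeBoundary_apply]
    refine Finset.sum_eq_zero fun w _ => ext0_of_notMem _ fun h => hv ?_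
    exact card_pos.2 ⟨w, mem_nbr.2 h⟩
  have hker : LinearMap.ker L = LinearMap.ker H.edgeBoundary := by
    ext z
    rw [LinearMap.mem_ker, LinearMap.mem_ker]
    constructor
    · intro h
      funext v
      by_cases hv : 0 < deg H v
      · exact congrFun h ⟨v, hv⟩
      · exact hiso z v hv
    · intro h
      simp [L, h]
  have hrange : LinearMap.range L ≤ LinearMap.ker s := by
    rintro _ ⟨z, rfl⟩
    rw [LinearMap.mem_ker]
    simp only [s, LinearMap.sum_apply, LinearMap.proj_apply]
    rw [← sum_edgeBoundary z]
    symm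
    rw [← Finset.sum_subset (Finset.subset_univ (univ.filter fun v => 0 < deg H v))]
    · exact Finset.sum_subtype _ (by simp) _
    · intro v _ hv
      exact hiso z v (by simpa using hv)
  have hs : LinearMap.range s = ⊤ := by
    rw [LinearMap.range_eq_top]
    intro a
    refine ⟨Pi.single ⟨v₀, card_pos.2 ⟨w₀, mem_nbr.2 h₀⟩⟩ a, ?_⟩
    simp [s, LinearMap.sum_apply]
  have h1 := LinearMap.finrank_range_add_finrank_ker s
  have h2 := LinearMap.finrank_range_add_finrank_ker L
  have h3 := Submodule.finrank_mono hrange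
  rw [hs, finrank_top, Module.finrank_self, Module.finrank_pi] at h1
  rw [hker, Module.finrank_pi] at h2
  have h4 : Fintype.card P = #{v | 0 < deg H v} := Fintype.card_subtype _
  omega

/-- The faces. -/
abbrev Face (R : H.RotationSystem) := Quotient (Equiv.Perm.SameCycle.setoid R.facePerm)

/-- Every edge has two sides, so the sum of all faces has boundary zero; the dart `d₀` ensures that
this relation is nontrivial. -/
theorem finrank_boundaries (R : H.RotationSystem) (d₀ : H.Dart) :
    Module.finrank (ZMod 2) R.boundaries + 1 ≤ Fintype.card (Face R) := by
  let m : (Face R → ZMod 2) →ₗ[ZMod 2] (H.Dart → ZMod 2) :=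
    LinearMap.funLeft _ _ fun d => (Quotient.mk _ d : Face R)
  let g := dartBoundary.comp m
  have hle : R.boundaries ≤ LinearMap.range g := by
    rw [boundaries_eq]
    rintro _ ⟨S, hS, rfl⟩
    refine ⟨fun q => S q.out, ?_⟩
    simp only [g, LinearMap.comp_apply]
    congr 1
    funext d
    exact faceChains_sameCycle hS
      (Quotient.mk_out (s := Equiv.Perm.SameCycle.setoid R.facePerm) d)
  have hk : LinearMap.ker g ≠ ⊥ := by
    intro hbot
    have : (fun _ => 1 : Face R → ZMod 2) ∈ LinearMap.ker g := by
      rw [LinearMap.mem_ker]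
      funext ⟨e, he⟩
      induction e with | _ a b
      have := dartBoundary_apply (m fun _ => 1) (⟨(a, b), he⟩ : H.Dart)
      refine this.trans ?_
      exact CharTwo.add_self_eq_zero _
    rw [hbot, Submodule.mem_bot] at this
    have := congrFun this (Quotient.mk _ d₀)
    simp at this
  have h1 := LinearMap.finrank_range_add_finrank_ker g
  have h2 := Submodule.finrank_mono hle
  have h3 : 0 < Module.finrank (ZMod 2) (LinearMap.ker g) := by
    rw [Nat.pos_iff_ne_zero]
    exact fun h => hk (Submodule.finrank_eq_zero.1 h)
  rw [Module.finrank_pi] at h1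
  omega

/-- With E edges, n non-isolated vertices and f faces, E - n + 1 is at most the dimension of the
cycle space, which is the Betti number plus the dimension of the boundaries, hence at most 2 + (f -
1). No connectedness is needed for these inequalities. -/
theorem card_edgeSet_le (R : H.RotationSystem) (hR : R.genus ≤ 1) (d₀ : H.Dart) :
    Fintype.card H.edgeSet ≤ #{v | 0 < deg H v} + Fintype.card (Face R) := by
  have h1 := finrank_ker_edgeBoundary d₀.adj
  have h2 := finrank_boundaries R d₀
  have h3 : R.firstBetti ≤ 2 := by
    have : (R.firstBetti : ℚ) ≤ 2 := by
      simp only [RotationSystem.genus] at hR; linarith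
    exact_mod_cast this
  have h4 := Submodule.finrank_quotient_add_finrank
    (R.boundaries.submoduleOf (LinearMap.ker H.edgeBoundary))
  have h5 : Module.finrank (ZMod 2) (R.boundaries.submoduleOf (LinearMap.ker H.edgeBoundary))
      = Module.finrank (ZMod 2) R.boundaries :=
    (Submodule.submoduleOfEquivOfLe R.boundaries_le_ker).finrank_eq
  have h6 : R.firstBetti = Module.finrank (ZMod 2) (LinearMap.ker H.edgeBoundary ⧸
    R.boundaries.submoduleOf (LinearMap.ker H.edgeBoundary)) := rfl
  omega

/-- A triangular face has three corners of weight four. Any other face has at least four distinct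
corners of weight three, because `turn` has no cycle of length one (no loops) or two (`hR`). -/
theorem twelve_le (R : H.RotationSystem) (hR : ∀ b, R.next b ≠ b) (q : Face R) :
    12 ≤ ∑ b : H.Dart with (Quotient.mk _ (R.next b) : Face R) = q, if Tri R b then 4 else 3 := by
  set b := R.next.symm q.out with hb
  have h0 : R.next b = q.out := by simp [hb]
  have hfib : ∀ c, (Quotient.mk _ (R.next c) : Face R) = q →
      (Quotient.mk _ (R.next (turn R c)) : Face R) = q := by
    intro c hc
    rw [← hc]
    refine Quotient.sound (s := Equiv.Perm.SameCycle.setoid R.facePerm) ?_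
    change R.facePerm.SameCycle _ _
    rw [← facePerm_next]
    exact Equiv.Perm.sameCycle_apply_left.2 (Equiv.Perm.SameCycle.refl _ _)
  have f0 : (Quotient.mk _ (R.next b) : Face R) = q := by rw [h0]; exact Quotient.out_eq q
  have f1 := hfib _ f0
  have f2 := hfib _ f1
  have f3 := hfib _ f2
  have n1 : ∀ c, turn R c ≠ c := by
    intro c hc
    have h1 : (R.next c).snd = c.fst := congrArg (fun d : H.Dart => d.fst) hc
    have h2 := (R.next c).adj
    rw [R.fst_next c] at h2
    change H.Adj c.fst (R.next c).snd at h2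
    rw [h1] at h2
    exact H.irrefl h2
  have n2 : ∀ c, turn R (turn R c) ≠ c := by
    intro c hc
    have h1 : c.snd = (R.next c).snd := by
      have : (turn R (turn R c)).snd = (R.next c).snd := R.fst_next (turn R c)
      rw [← this, hc]
    exact hR c (Dart.ext _ _ (Prod.ext (R.fst_next c) h1.symm))
  by_cases ht : Tri R b
  · have hsub : ({b, turn R b, turn R (turn R b)} : Finset H.Dart) ⊆
        univ.filter fun b => (Quotient.mk _ (R.next b) : Face R) = q := by
      intro c hc
      simp only [mem_insert, mem_singleton] at hc
      rw [mem_filter]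
      rcases hc with rfl | rfl | rfl <;> simp only [mem_univ, true_and] <;> assumption
    refine le_trans ?_ (Finset.sum_le_sum_of_subset hsub)
    rw [sum_insert (by simp [(n1 b).symm, (n2 b).symm]),
      sum_insert (by simp [(n1 (turn R b)).symm]), sum_singleton,
      if_pos ht, if_pos (tri_turn.2 ht), if_pos (tri_turn.2 (tri_turn.2 ht))]
    norm_num
  · have hsub : ({b, turn R b, turn R (turn R b), turn R (turn R (turn R b))} : Finset H.Dart) ⊆
        univ.filter fun b => (Quotient.mk _ (R.next b) : Face R) = q := by
      intro c hc
      simp only [mem_insert, mem_singleton] at hc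
      rw [mem_filter]
      rcases hc with rfl | rfl | rfl | rfl <;> simp only [mem_univ, true_and] <;> assumption
    refine le_trans ?_ (Finset.sum_le_sum_of_subset hsub)
    rw [sum_insert (by simp [(n1 b).symm, (n2 b).symm, Ne.symm ht]),
      sum_insert (by simp [(n1 (turn R b)).symm, (n2 (turn R b)).symm]),
      sum_insert (by simp [(n1 (turn R (turn R b))).symm]), sum_singleton]
    have : ∀ c, 3 ≤ if Tri R c then 4 else 3 := by intro c; split_ifs <;> simp
    have a1 := this b
    have a2 := this (turn R b)
    have a3 := this (turn R (turn R b))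
    have a4 := this (turn R (turn R (turn R b)))
    omega

/-- Euler's inequality, summed over the corners. -/
theorem sum_corners_le (R : H.RotationSystem) (hg : R.genus ≤ 1) (hR : ∀ b, R.next b ≠ b)
    (d₀ : H.Dart) :
    ∑ b : H.Dart, (4 + if Tri R b then 0 else 2 : ℤ) ≤ 24 * #{v | 0 < deg H v} := by
  have h1 := card_edgeSet_le R hg d₀
  have h2 : 12 * Fintype.card (Face R) ≤ ∑ b : H.Dart, if Tri R b then 4 else 3 := by
    rw [← Finset.sum_fiberwise (univ : Finset H.Dart)
      (fun b => (Quotient.mk _ (R.next b) : Face R))]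
    calc 12 * Fintype.card (Face R) = ∑ _q : Face R, 12 := by simp [mul_comm]
      _ ≤ _ := Finset.sum_le_sum fun q _ => twelve_le R hR q
  have h3 : Fintype.card H.Dart = 2 * Fintype.card H.edgeSet := by
    have := H.dart_card_eq_twice_card_edges
    rwa [← edgeSet_univ_card] at this
  -- The weights satisfy 12 - 2 · 4 = 4 and 12 - 2 · 3 = 6.
  have h4 : ∑ b : H.Dart, (4 + if Tri R b then 0 else 2 : ℤ)
      = 12 * Fintype.card H.Dart - 2 * ((∑ b : H.Dart, if Tri R b then 4 else 3 : ℕ) : ℤ) := by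
    push_cast
    rw [Finset.mul_sum, eq_sub_iff_add_eq, ← Finset.sum_add_distrib]
    rw [Finset.sum_congr rfl (g := fun _ => (12 : ℤ))]
    · simp [mul_comm]
    · intro b _
      split_ifs <;> norm_num
  rw [h4]
  omega

end

end

end OddToroidal

namespace OddToroidal

/-! ### Cyclic words -/

/-- The kinds of neighbors of a vertex that is not needy: needy of degree four, other needy ones,
poor ones and the remaining ones. -/
inductive Kind
  | a | b | n | p

namespace Kind

/-- The kind `a`. -/
def isA : Kind → Bool
  | a => true
  | _ => false

/-- The kind `b`. -/
def isB : Kind → Bool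
  | b => true
  | _ => false

/-- The kind `n`. -/
def isN : Kind → Bool
  | n => true
  | _ => false

/-- The kind `p`. -/
def isP : Kind → Bool
  | p => true
  | _ => false

/-- The kinds of needy vertices. -/
def isNeedy : Kind → Bool
  | a => true
  | b => true
  | _ => false

end Kind

/-- A neighbor, together with the information whether the corner that follows it is a corner of a
triangular face. -/
abbrev Letter := Kind × Bool

/-- Twice the charge of the corner between consecutive neighbors, plus four. -/
def cornerValue (x y : Letter) : ℕ :=
  (bif x.2 then 4 + (bif x.1.isB && y.1.isB then 4 else 0)
    else 8 + (bif x.1.isB then 2 else 0) + (bif y.1.isB then 2 else 0)) -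
  ((bif x.2 && x.1.isA then 2 else 0) + (bif x.2 && y.1.isA then 2 else 0) +
    (bif x.1.isP then 1 else 0) + (bif y.1.isP then 1 else 0))

/-- The restrictions on two consecutive neighbors. -/
def okPair (x y : Letter) : Bool :=
  !(x.2 && x.1.isA && y.1.isA) && (!x.1.isP || (x.2 && y.1.isB)) &&
    (!y.1.isP || (x.2 && x.1.isB))

/-- The restriction on three consecutive neighbors. -/
def okTriple (x y z : Letter) : Bool :=
  !(x.2 && y.2 && x.1.isNeedy && y.1.isNeedy && z.1.isNeedy)

/-- The neighbor `y` is of kind `b` and in no triangle with a neighbor of kind `a`. -/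
def uncovered (x y z : Letter) : Bool :=
  y.1.isB && !(x.2 && x.1.isA) && !(y.2 && z.1.isA)

/-- Bounded sums. -/
def sumUpTo (f : ℕ → ℕ) : ℕ → ℕ
  | 0 => 0
  | n + 1 => sumUpTo f n + f n

/-- Bounded universal quantification. -/
def allUpTo (f : ℕ → Bool) : ℕ → Bool
  | 0 => true
  | n + 1 => f n && allUpTo f n

theorem allUpTo_iff {f : ℕ → Bool} {n : ℕ} : allUpTo f n = true ↔ ∀ i < n, f i = true := by
  induction n with
  | zero => simp [allUpTo]
  | succ n ih =>
    rw [allUpTo, Bool.and_eq_true, ih]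
    constructor
    · rintro ⟨h1, h2⟩ i hi
      rcases Nat.lt_succ_iff_lt_or_eq.1 hi with h | rfl
      · exact h2 i h
      · exact h1
    · exact fun h => ⟨h n (by omega), fun i hi => h i (by omega)⟩

theorem sumUpTo_eq (f : ℕ → ℕ) (n : ℕ) : sumUpTo f n = ∑ i ∈ Finset.range n, f i := by
  induction n with
  | zero => rfl
  | succ n ih => rw [sumUpTo, ih, Finset.sum_range_succ]

/-- The number of uncovered neighbors. -/
def numUncovered (d : ℕ) (w : ℕ → Letter) : ℕ :=
  sumUpTo (fun i => (uncovered (w i) (w (i + 1)) (w (i + 2))).toNat) d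

/-- The restrictions that follow from the local geometry. -/
def okWord (d : ℕ) (w : ℕ → Letter) : Bool :=
  allUpTo (fun i => okPair (w i) (w (i + 1)) && okTriple (w i) (w (i + 1)) (w (i + 2))) d

/-- The restrictions that follow from irreducibility. -/
def irredWord (d : ℕ) (w : ℕ → Letter) : Bool :=
  Nat.ble 8 (d + sumUpTo (fun i => (w (i + 1)).1.isB.toNat) d) &&
  Nat.ble 8 (d + numUncovered d w) &&
  (Nat.ble 9 (d + numUncovered d w) ||
    allUpTo (fun i => !((w i).2 && (w (i + 1)).1.isA && (w (i + 1)).2)) d) &&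
  allUpTo (fun i => !(w (i + 2)).1.isP ||
    Nat.ble (8 + (uncovered (w i) (w (i + 1)) (w (i + 2))).toNat +
      (uncovered (w (i + 2)) (w (i + 3)) (w (i + 4))).toNat) (d + numUncovered d w)) d

/-- The sum of all corner values. -/
def total (d : ℕ) (w : ℕ → Letter) : ℕ := sumUpTo (fun i => cornerValue (w i) (w (i + 1))) d

/-- There is no neighbor of kind `a` or `p`. -/
def noAP (d : ℕ) (w : ℕ → Letter) : Bool := allUpTo (fun i => !(w i).1.isA && !(w i).1.isP) d

/-- No two consecutive neighbors of kind `b` are in a triangle. -/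
def noBB (d : ℕ) (w : ℕ → Letter) : Bool :=
  allUpTo (fun i => !((w i).2 && (w i).1.isB && (w (i + 1)).1.isB)) d

/-- The neighborhood of a poor vertex, read from the position `i`. -/
def poorAt (w : ℕ → Letter) (i : ℕ) : Bool :=
  (w i).1.isB && (w (i + 1)).1.isN && (w (i + 2)).1.isB && (w (i + 3)).1.isN && (w (i + 4)).1.isB

/-- The neighborhood of a poor vertex. -/
def poorWord (d : ℕ) (w : ℕ → Letter) : Bool :=
  Nat.beq d 5 && allUpTo (fun i => (w i).2) d && !allUpTo (fun i => !poorAt w i) d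

/-- The possible outcomes at a vertex that is not needy. -/
def fineWord (d : ℕ) (w : ℕ → Letter) : Bool :=
  Nat.blt (48 - 4 * d) (total d w) ||
  (Nat.beq (48 - 4 * d) (total d w) && noAP d w && noBB d w) ||
  (Nat.beq (48 - 4 * d) (total d w + 4) && noAP d w && poorWord d w)

/-- Quantification over all letters. -/
def allLetters (f : Letter → Bool) : Bool :=
  f (.a, true) && f (.a, false) && f (.b, true) && f (.b, false) && f (.n, true) &&
    f (.n, false) && f (.p, true) && f (.p, false)

theorem allLetters_iff {f : Letter → Bool} : allLetters f = true ↔ ∀ x, f x = true := by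
  constructor
  · intro h
    simp only [allLetters, Bool.and_eq_true] at h
    rintro ⟨_ | _ | _ | _, _ | _⟩ <;> tauto
  · intro h
    simp [allLetters, h]

/-! ### Exhaustive search over cyclic words -/

/-- The word that is given, in reverse order, by a list. -/
def ofList (d : ℕ) (l : List Letter) (i : ℕ) : Letter := l.getD (d - 1 - i % d) (.n, false)

/-- Search for a word that is not fine, with `n` letters left to choose. -/
def search (d : ℕ) : ℕ → ℕ → List Letter → Bool
  | 0, _, l => !irredWord d (ofList d l) || fineWord d (ofList d l) || !okWord d (ofList d l)
  | n + 1, _, [] => allLetters fun y => search d n 0 [y]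
  | n + 1, s, [x] => allLetters fun y => !okPair x y ||
      Nat.blt (48 - 4 * d) (s + cornerValue x y + 2 * (n + 1)) ||
      search d n (s + cornerValue x y) [y, x]
  | n + 1, s, x :: x' :: l => allLetters fun y => !okPair x y || !okTriple x' x y ||
      Nat.blt (48 - 4 * d) (s + cornerValue x y + 2 * (n + 1)) ||
      search d n (s + cornerValue x y) (y :: x :: x' :: l)

/-- Only the lengths four to eight need a search: shorter words have too few neighbors to be
irreducible, and longer ones have enough charge from `two_le_cornerValue` alone. -/
theorem search_four : search 4 4 0 [] = true := by decide +kernel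
theorem search_five : search 5 5 0 [] = true := by decide +kernel
theorem search_six : search 6 6 0 [] = true := by decide +kernel
theorem search_seven : search 7 7 0 [] = true := by decide +kernel
theorem search_eight : search 8 8 0 [] = true := by decide +kernel

/-- The first `k` letters, in reverse order. -/
def prefixList (w : ℕ → Letter) : ℕ → List Letter
  | 0 => []
  | k + 1 => w k :: prefixList w k

theorem getD_prefixList (w : ℕ → Letter) (x : Letter) {k j : ℕ} (hj : j < k) :
    (prefixList w k).getD j x = w (k - 1 - j) := by
  induction k generalizing j with
  | zero => omega
  | succ k ih =>
    cases j with
    | zero => simp [prefixList]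
    | succ j =>
      rw [prefixList, List.getD_cons_succ, ih (by omega)]
      congr 1
      omega

theorem ofList_prefixList {w : ℕ → Letter} {d : ℕ} (hd : 0 < d) (hw : ∀ i, w (i + d) = w i) :
    ofList d (prefixList w d) = w := by
  funext i
  have h1 : i % d < d := Nat.mod_lt _ hd
  rw [ofList, getD_prefixList _ _ (by omega)]
  have h2 : d - 1 - (d - 1 - i % d) = i % d := by omega
  rw [h2]
  exact Function.Periodic.map_mod_nat hw i

/-- The value two occurs at a triangular corner with one end of kind `a`. This is the bound by which
the search is pruned: each corner still unknown adds at least two. -/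
theorem two_le_cornerValue {x y : Letter} (h : okPair x y = true) : 2 ≤ cornerValue x y := by
  revert h
  rcases x with ⟨_ | _ | _ | _, _ | _⟩ <;> rcases y with ⟨_ | _ | _ | _, _ | _⟩ <;> decide

theorem okPair_of_okWord {d : ℕ} {w : ℕ → Letter} (h : okWord d w = true) {i : ℕ} (hi : i < d) :
    okPair (w i) (w (i + 1)) = true := by
  have := allUpTo_iff.1 h i hi
  simp only [Bool.and_eq_true] at this
  exact this.1

theorem okTriple_of_okWord {d : ℕ} {w : ℕ → Letter} (h : okWord d w = true) {i : ℕ} (hi : i < d) :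
    okTriple (w i) (w (i + 1)) (w (i + 2)) = true := by
  have := allUpTo_iff.1 h i hi
  simp only [Bool.and_eq_true] at this
  exact this.2

theorem add_le_total {d : ℕ} {w : ℕ → Letter} (h : okWord d w = true) {k n : ℕ} (hk : k + n = d) :
    sumUpTo (fun i => cornerValue (w i) (w (i + 1))) k + 2 * n ≤ total d w := by
  rw [total, sumUpTo_eq, sumUpTo_eq, ← hk, Finset.sum_range_add]
  refine Nat.add_le_add_left ?_ _
  calc 2 * n = ∑ _i ∈ Finset.range n, 2 := by simp [mul_comm]
    _ ≤ _ := Finset.sum_le_sum fun i hi => two_le_cornerValue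
      (okPair_of_okWord h (by have := Finset.mem_range.1 hi; omega))

/-- The invariant of the search: after `k` letters the first `k - 1` corners are known, and none for
`k = 0`. When a further letter is chosen with `n` letters then left, `n + 1` corners remain, since
the word closes up; hence the term `2 * (n + 1)` in the pruning. -/
theorem fineWord_of_search_aux {d : ℕ} (hd : 0 < d) {w : ℕ → Letter} (hw : ∀ i, w (i + d) = w i)
    (hok : okWord d w = true) (hirr : irredWord d w = true) (n : ℕ) :
    ∀ k, k + n = d →
      search d n (sumUpTo (fun i => cornerValue (w i) (w (i + 1))) (k - 1)) (prefixList w k) = true →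
      fineWord d w = true := by
  induction n with
  | zero =>
    intro k hk hs
    obtain rfl : k = d := by omega
    rw [search, ofList_prefixList hd hw] at hs
    simpa [hok, hirr] using hs
  | succ n ih =>
    intro k hk hs
    have hfine : ∀ s, s + 2 * (n + 1) ≤ total d w → Nat.blt (48 - 4 * d) (s + 2 * (n + 1)) = true →
        fineWord d w = true := by
      intro s h1 h2
      have : Nat.blt (48 - 4 * d) (total d w) = true := by
        simp only [Nat.blt, Nat.ble_eq] at h2 ⊢
        omega
      simp [fineWord, this]
    rcases k with _ | _ | k
    · exact ih 1 (by omega) (allLetters_iff.1 hs (w 0))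
    · have hs := allLetters_iff.1 hs (w 1)
      simp only [okPair_of_okWord hok (show 0 < d by omega), Bool.not_true, Bool.false_or,
        Bool.or_eq_true] at hs
      rcases hs with hs | hs
      · exact hfine _ (add_le_total hok hk) hs
      · exact ih 2 (by omega) hs
    · have hs := allLetters_iff.1 hs (w (k + 2))
      simp only [okPair_of_okWord hok (show k + 1 < d by omega),
        okTriple_of_okWord hok (show k < d by omega), Bool.not_true, Bool.false_or,
        Bool.or_eq_true] at hs
      rcases hs with hs | hs
      · exact hfine _ (add_le_total hok hk) hs
      · exact ih (k + 3) (by omega) hs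

theorem fineWord_of_search {d : ℕ} (hd : 0 < d) {w : ℕ → Letter} (hw : ∀ i, w (i + d) = w i)
    (hok : okWord d w = true) (hirr : irredWord d w = true) (h : search d d 0 [] = true) :
    fineWord d w = true :=
  fineWord_of_search_aux hd hw hok hirr d 0 (by omega) h

/-- The local analysis at a vertex that is not needy. -/
theorem fineWord_of_okWord {d : ℕ} {w : ℕ → Letter} (hw : ∀ i, w (i + d) = w i)
    (hok : okWord d w = true) (hirr : irredWord d w = true) : fineWord d w = true := by
  rcases Nat.lt_or_ge 8 d with h8 | h8
  · have h1 := add_le_total hok (zero_add d)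
    have : Nat.blt (48 - 4 * d) (total d w) = true := by
      simp only [sumUpTo, zero_add] at h1
      simp only [Nat.blt, Nat.ble_eq]
      omega
    simp [fineWord, this]
  rcases Nat.lt_or_ge d 4 with h4 | h4
  · exfalso
    simp only [irredWord, Bool.and_eq_true, Nat.ble_eq] at hirr
    have h1 := hirr.1.1.1
    have : sumUpTo (fun i => (w (i + 1)).1.isB.toNat) d ≤ d := by
      rw [sumUpTo_eq]
      calc _ ≤ ∑ _i ∈ Finset.range d, 1 := Finset.sum_le_sum fun i _ => Bool.toNat_le _
        _ = d := by simp
    omega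
  interval_cases d
  · exact fineWord_of_search (by omega) hw hok hirr search_four
  · exact fineWord_of_search (by omega) hw hok hirr search_five
  · exact fineWord_of_search (by omega) hw hok hirr search_six
  · exact fineWord_of_search (by omega) hw hok hirr search_seven
  · exact fineWord_of_search (by omega) hw hok hirr search_eight

end OddToroidal

namespace OddToroidal

open SimpleGraph Finset
open scoped Classical

noncomputable section

/-! ### Darts at a vertex -/

section

variable {V : Type*} [Fintype V] {H : SimpleGraph V}

/-- The darts that leave `v`. -/
def dartsAt (H : SimpleGraph V) (v : V) : Finset H.Dart := {b | b.fst = v}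

@[simp] theorem mem_dartsAt {v : V} {b : H.Dart} : b ∈ dartsAt H v ↔ b.fst = v := by
  simp [dartsAt]

theorem sum_dartsAt_snd {M : Type*} [AddCommMonoid M] (f : V → M) (v : V) :
    ∑ b ∈ dartsAt H v, f b.snd = ∑ z ∈ nbr H v, f z := by
  refine Finset.sum_bij (fun b _ => b.snd) ?_ ?_ (fun z hz => ?_) (fun _ _ => rfl)
  · intro b hb
    rw [mem_dartsAt] at hb
    rw [mem_nbr, ← hb]
    exact b.adj
  · intro b hb c hc h
    rw [mem_dartsAt] at hb hc
    exact Dart.ext _ _ (Prod.ext (hb.trans hc.symm) h)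
  · exact ⟨⟨(v, z), mem_nbr.1 hz⟩, by simp, rfl⟩

theorem card_dartsAt (v : V) : #(dartsAt H v) = deg H v := by
  rw [card_eq_sum_ones, sum_dartsAt_snd (fun _ => 1), deg, card_eq_sum_ones]

theorem sum_dartsAt_next {M : Type*} [AddCommMonoid M] (R : H.RotationSystem) (f : H.Dart → M)
    (v : V) : ∑ b ∈ dartsAt H v, f (R.next b) = ∑ b ∈ dartsAt H v, f b := by
  refine Finset.sum_equiv R.next (fun b => ?_) (fun _ _ => rfl)
  rw [mem_dartsAt, mem_dartsAt, R.fst_next]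

theorem isCycleOn_dartsAt (R : H.RotationSystem) (v : V) :
    R.next.IsCycleOn (dartsAt H v : Set H.Dart) := by
  refine ⟨⟨?_, R.next.injective.injOn, ?_⟩, ?_⟩
  · intro b hb
    simpa [R.fst_next] using hb
  · intro b hb
    refine ⟨R.next.symm b, ?_, by simp⟩
    have := R.fst_next (R.next.symm b)
    rw [Equiv.apply_symm_apply] at this
    simpa [← this] using hb
  · intro b hb c hc
    refine R.sameCycle b c ?_
    simp only [mem_coe, mem_dartsAt] at hb hc
    rw [hb, hc]

theorem pow_deg_next (R : H.RotationSystem) (b : H.Dart) :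
    (R.next ^ deg H b.fst) b = b := by
  have := (isCycleOn_dartsAt R b.fst).pow_card_apply (a := b) (by simp)
  rwa [card_dartsAt] at this

theorem sum_dartsAt_pow {M : Type*} [AddCommMonoid M] (R : H.RotationSystem) (f : H.Dart → M)
    (b : H.Dart) :
    ∑ c ∈ dartsAt H b.fst, f c = ∑ i ∈ range (deg H b.fst), f ((R.next ^ i) b) := by
  have hc := isCycleOn_dartsAt R b.fst
  have hb : b ∈ dartsAt H b.fst := by simp
  symm
  refine Finset.sum_bij (fun i _ => (R.next ^ i) b) ?_ ?_ (fun c hcm => ?_) (fun _ _ => rfl)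
  · intro i _
    rw [mem_dartsAt, fst_pow_next]
  · intro i hi j hj h
    have := (hc.pow_apply_eq_pow_apply hb).1 h
    rw [card_dartsAt] at this
    exact Nat.ModEq.eq_of_lt_of_lt this (mem_range.1 hi) (mem_range.1 hj)
  · obtain ⟨n, hn, h⟩ := hc.exists_pow_eq hb hcm
    rw [card_dartsAt] at hn
    exact ⟨n, mem_range.2 hn, h⟩

theorem pow_next_ne (R : H.RotationSystem) (b : H.Dart) {i : ℕ} (h0 : 0 < i)
    (hi : i < deg H b.fst) : (R.next ^ i) b ≠ b := by
  intro h
  have := ((isCycleOn_dartsAt R b.fst).pow_apply_eq (a := b) (by simp)).1 h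
  rw [card_dartsAt] at this
  exact absurd (Nat.le_of_dvd h0 this) (by omega)

theorem snd_pow_next_ne (R : H.RotationSystem) (b : H.Dart) {i : ℕ} (h0 : 0 < i)
    (hi : i < deg H b.fst) : ((R.next ^ i) b).snd ≠ b.snd := fun h =>
  pow_next_ne R b h0 hi (Dart.ext _ _ (Prod.ext (fst_pow_next R b i) h))

theorem sum_dartsAt_univ {M : Type*} [AddCommMonoid M] (f : H.Dart → M) :
    ∑ v with 0 < deg H v, ∑ b ∈ dartsAt H v, f b = ∑ b, f b := by
  rw [← Finset.sum_fiberwise (univ : Finset H.Dart) (fun b => b.fst) f]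
  refine Finset.sum_subset (filter_subset _ _) fun v _ hv => ?_
  refine Finset.sum_eq_zero fun b hb => ?_
  have hb' : b.fst = v := by simpa using hb
  refine absurd (card_pos.2 ⟨b.snd, mem_nbr.2 ?_⟩) (by simpa using hv : ¬ 0 < deg H v)
  rw [← hb']
  exact b.adj

end

/-! ### Triangular corners -/

section

variable {V : Type*} {H : SimpleGraph V} {R : H.RotationSystem}

theorem fst_turn (b : H.Dart) : (turn R b).fst = (R.next b).snd := rfl

theorem fst_turn_symm (b : H.Dart) : ((turn R).symm b).fst = b.snd := by
  have h : turn R ((turn R).symm b) = b := Equiv.apply_symm_apply _ _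
  rw [turn_apply] at h
  have h2 : (R.next ((turn R).symm b)).fst = b.snd := congrArg (fun d : H.Dart => d.snd) h
  rw [← h2, R.fst_next]

theorem Tri.turn_turn {b : H.Dart} (h : Tri R b) : turn R (turn R b) = (turn R).symm b := by
  rw [Equiv.eq_symm_apply]; exact h

theorem Tri.fst_turn_turn {b : H.Dart} (h : Tri R b) : (turn R (turn R b)).fst = b.snd := by
  rw [h.turn_turn, fst_turn_symm]

theorem Tri.adj {b : H.Dart} (h : Tri R b) : H.Adj b.snd (R.next b).snd := by
  have h1 := (R.next (turn R b)).adj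
  rw [R.fst_next, fst_turn] at h1
  have h2 : (R.next (turn R b)).snd = b.snd := h.fst_turn_turn
  rw [h2] at h1
  exact h1.symm

end

section

variable {V : Type*}

/-- The indicator of a predicate. -/
def ind (P : V → Prop) (v : V) : ℤ := if P v then 1 else 0

theorem ind_of {P : V → Prop} {v : V} (h : P v) : ind P v = 1 := if_pos h
theorem ind_of_not {P : V → Prop} {v : V} (h : ¬ P v) : ind P v = 0 := if_neg h
theorem ind_nonneg (P : V → Prop) (v : V) : 0 ≤ ind P v := by rw [ind]; split_ifs <;> simp

end

/-! ### Kinds of vertices -/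

section

variable {V : Type*} [Fintype V] {G H : SimpleGraph V} {F : Set V} {R : H.RotationSystem}

/-- Needy vertices of degree four. -/
def KindA (H : SimpleGraph V) (F : Set V) (v : V) : Prop := Needy H F v ∧ deg H v = 4

/-- Needy vertices of other degrees. -/
def KindB (H : SimpleGraph V) (F : Set V) (v : V) : Prop := Needy H F v ∧ deg H v ≠ 4

/-- Vertices that are not isolated and not needy. -/
def KindN (H : SimpleGraph V) (F : Set V) (v : V) : Prop := 0 < deg H v ∧ ¬ Needy H F v

/-- Poor vertices: vertices of degree five in five triangles, of a special kind. -/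
def Poor (F : Set V) (R : H.RotationSystem) (x : V) : Prop :=
  KindN H F x ∧ deg H x = 5 ∧ (∀ b : H.Dart, b.fst = x → Tri R b) ∧
    ∃ b : H.Dart, b.fst = x ∧ KindB H F b.snd ∧ KindN H F (R.next b).snd ∧
      KindB H F (R.next (R.next b)).snd ∧ KindN H F (R.next (R.next (R.next b))).snd ∧
      KindB H F (R.next (R.next (R.next (R.next b)))).snd

theorem deg_pos_of_adj {u v : V} (h : H.Adj u v) : 0 < deg H u := card_pos.2 ⟨v, mem_nbr.2 h⟩

theorem Needy.kind {v : V} (h : Needy H F v) : KindA H F v ∨ KindB H F v := by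
  by_cases h4 : deg H v = 4
  · exact Or.inl ⟨h, h4⟩
  · exact Or.inr ⟨h, h4⟩

theorem KindA.not_kindB {v : V} (h : KindA H F v) : ¬ KindB H F v := fun h' => h'.2 h.2
theorem KindA.not_kindN {v : V} (h : KindA H F v) : ¬ KindN H F v := fun h' => h'.2 h.1
theorem KindB.not_kindN {v : V} (h : KindB H F v) : ¬ KindN H F v := fun h' => h'.2 h.1

theorem kind_of_pos {v : V} (h : 0 < deg H v) : KindA H F v ∨ KindB H F v ∨ KindN H F v := by
  by_cases hn : Needy H F v
  · rcases hn.kind with h | h <;> tauto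
  · exact Or.inr (Or.inr ⟨h, hn⟩)

/-- The five darts at a poor vertex. -/
theorem Poor.exists_dart {x : V} (h : Poor F R x) : ∃ b : H.Dart, b.fst = x ∧
    KindB H F b.snd ∧ KindN H F (R.next b).snd ∧
      KindB H F (R.next (R.next b)).snd ∧ KindN H F (R.next (R.next (R.next b))).snd ∧
      KindB H F (R.next (R.next (R.next (R.next b)))).snd ∧
      R.next (R.next (R.next (R.next (R.next b)))) = b ∧
      ∀ c : H.Dart, c.fst = x → c = b ∨ c = R.next b ∨ c = R.next (R.next b) ∨
        c = R.next (R.next (R.next b)) ∨ c = R.next (R.next (R.next (R.next b))) := by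
  obtain ⟨-, h5, -, b, hb, h0, h1, h2, h3, h4⟩ := h
  subst hb
  refine ⟨b, rfl, h0, h1, h2, h3, h4, ?_, ?_⟩
  · have := pow_deg_next R b
    rw [h5] at this
    simpa [pow_succ'] using this
  · intro c hc
    obtain ⟨n, hn, rfl⟩ := (isCycleOn_dartsAt R b.fst).exists_pow_eq (a := b) (b := c)
      (by simp) (by simpa using hc)
    rw [card_dartsAt, h5] at hn
    interval_cases n <;> simp [pow_succ']

theorem Poor.tri {x : V} (h : Poor F R x) {b : H.Dart} (hb : b.fst = x) : Tri R b := h.2.2.1 b hb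

/-- At a poor vertex, both neighbors next to a neighbor of kind `N` are of kind `B`. -/
theorem Poor.next_kindB {b : H.Dart} (h : Poor F R b.fst) (hb : KindN H F b.snd) :
    KindB H F (R.next b).snd ∧ KindB H F (R.next.symm b).snd := by
  obtain ⟨c, hc, h0, h1, h2, h3, h4, h5, hall⟩ := h.exists_dart
  rcases hall b rfl with rfl | rfl | rfl | rfl | rfl
  · exact absurd hb h0.not_kindN
  · exact ⟨h2, by simpa using h0⟩
  · exact absurd hb h2.not_kindN
  · exact ⟨h4, by simpa using h2⟩
  · exact absurd hb h4.not_kindN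

theorem Poor.not_kindA {b : H.Dart} (h : Poor F R b.fst) : ¬ KindA H F b.snd := by
  obtain ⟨c, hc, h0, h1, h2, h3, h4, h5, hall⟩ := h.exists_dart
  intro ha
  rcases hall b rfl with rfl | rfl | rfl | rfl | rfl
  · exact ha.not_kindB h0
  · exact ha.not_kindN h1
  · exact ha.not_kindB h2
  · exact ha.not_kindN h3
  · exact ha.not_kindB h4

theorem Poor.sum_eq {M : Type*} [AddCommMonoid M] {x : V} (h : Poor F R x) (f : V → M) :
    ∃ u₁ u₂ u₃ y₁ y₂, KindB H F u₁ ∧ KindB H F u₂ ∧ KindB H F u₃ ∧ KindN H F y₁ ∧ KindN H F y₂ ∧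
      ∑ b ∈ dartsAt H x, f b.snd = f u₁ + f y₁ + f u₂ + f y₂ + f u₃ := by
  obtain ⟨c, hc, h0, h1, h2, h3, h4, h5, hall⟩ := h.exists_dart
  subst hc
  refine ⟨_, _, _, _, _, h0, h2, h4, h1, h3, ?_⟩
  rw [sum_dartsAt_pow R (fun b => f b.snd) c, h.2.1]
  simp [Finset.sum_range_succ, pow_succ']

theorem Poor.card_needy {x : V} (h : Poor F R x) : #{z ∈ nbr H x | Needy H F z} = 3 := by
  rw [card_filter, ← sum_dartsAt_snd (fun z => if Needy H F z then 1 else 0)]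
  obtain ⟨u₁, u₂, u₃, y₁, y₂, h1, h2, h3, h4, h5, h6⟩ :=
    h.sum_eq (fun z => if Needy H F z then 1 else 0)
  rw [h6, if_pos h1.1, if_pos h2.1, if_pos h3.1, if_neg h4.2, if_neg h5.2]

theorem Irred.not_adj_kindA (h : Irred G H F) {v w : V} (hv : KindA H F v) (hw : KindA H F w) :
    ¬ H.Adj v w := h.not_adj_of_four hv.1 hw.1 hv.2 hw.2

theorem Irred.six_le (h : Irred G H F) {v : V} (hv : KindB H F v) : 6 ≤ deg H v := by
  obtain ⟨⟨h1, h2, h3⟩, h4⟩ := hv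
  have h5 := h.two v h1
  obtain ⟨k, hk⟩ := h3
  omega

/-- For a vertex that is not needy, at most `deg H v` neighbors are needy, so `Irred.eight_le` with
empty `Y` gives 8 ≤ 2 deg. -/
theorem Irred.four_le (h : Irred G H F) {v : V} (hv : 0 < deg H v) : 4 ≤ deg H v := by
  rcases kind_of_pos (F := F) hv with h1 | h1 | h1
  · exact h1.2.ge
  · exact le_trans (by norm_num) (h.six_le h1)
  · have h2 := h.eight_le hv h1.2 (Y := ∅) (by simp) (by simp)
    have h3 : #{z ∈ nbr H v \ ∅ | Needy H F z ∧ Disjoint (nbr H z) ∅} ≤ deg H v := by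
      refine (card_filter_le _ _).trans ?_
      simp [deg]
    omega

theorem Irred.four_le_deg_fst (h : Irred G H F) (b : H.Dart) : 4 ≤ deg H b.fst :=
  h.four_le (deg_pos_of_adj b.adj)

theorem Irred.next_ne (h : Irred G H F) (R : H.RotationSystem) (b : H.Dart) : R.next b ≠ b := by
  have := pow_next_ne R b (i := 1) (by norm_num) (by have := h.four_le_deg_fst b; omega)
  simpa using this

/-- Two consecutive corners are not both triangular if all their edges are edges of `G`. -/
theorem Irred.not_tri (h : Irred G H F) {b : H.Dart} (h1 : Tri R b) (h2 : Tri R (R.next b))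
    (h3 : (R.next b).snd ∉ F) (h4 : b.fst ∉ F ∨ b.snd ∉ F ∧ (R.next (R.next b)).snd ∉ F) :
    False := by
  have e1 : H.Adj b.fst (R.next b).snd := by
    have := (R.next b).adj; rwa [R.fst_next] at this
  have e2 : H.Adj b.fst (R.next (R.next b)).snd := by
    have := (R.next (R.next b)).adj; rwa [R.fst_next, R.fst_next] at this
  have g1 : G.Adj (R.next b).snd b.fst := h.real _ _ h3 e1.symm
  have g2 : G.Adj (R.next b).snd b.snd := h.real _ _ h3 h1.adj.symm
  have g3 : G.Adj (R.next b).snd (R.next (R.next b)).snd := h.real _ _ h3 h2.adj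
  have g4 : G.Adj b.fst b.snd := by
    rcases h4 with h4 | h4
    · exact h.real _ _ h4 b.adj
    · exact (h.real _ _ h4.1 b.adj.symm).symm
  have g5 : G.Adj b.fst (R.next (R.next b)).snd := by
    rcases h4 with h4 | h4
    · exact h.real _ _ h4 e2
    · exact (h.real _ _ h4.2 e2.symm).symm
  -- The edge between the two corners lies in both triangles, so the third vertices agree; but darts
  -- two steps apart in the rotation have different ends when the degree is at least four.
  have := h.noAdj _ _ _ _ g1.symm g4 g2 g5 g3
  have hne := snd_pow_next_ne R b (i := 2) (by norm_num)
    (by have := h.four_le_deg_fst b; omega)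
  simp only [pow_succ, pow_zero, one_mul, Equiv.Perm.mul_apply] at hne
  exact hne this.symm

/-! ### Charges -/

/-- The charge of a corner, after the transfers within the faces. -/
def corner (F : Set V) (R : H.RotationSystem) (b : H.Dart) : ℤ :=
  let α := ind (KindA H F)
  let β := ind (KindB H F)
  let ν := ind (KindN H F)
  if Tri R b then
    2 * α b.fst - α b.snd - α (R.next b).snd + 2 * (ν b.fst * β b.snd * β (R.next b).snd) -
      β b.fst * (ν b.snd * β (R.next b).snd + β b.snd * ν (R.next b).snd)
  else
    2 + ν b.fst * (β b.snd + β (R.next b).snd) - β b.fst * (ν b.snd + ν (R.next b).snd)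

theorem sum_turn (R : H.RotationSystem) (f : H.Dart → ℤ) : ∑ b, f (turn R b) = ∑ b, f b :=
  Equiv.sum_comp (turn R) f

/-- Every transfer stays within a face, and `turn` permutes the corners of each face. So a
reindexing by `turn` matches each amount received at one corner with the amounts paid at others. -/
theorem sum_corner (F : Set V) (R : H.RotationSystem) :
    ∑ b, corner F R b = ∑ b, if Tri R b then 0 else 2 := by
  set α := ind (KindA H F) with hα
  set β := ind (KindB H F) with hβ
  set ν := ind (KindN H F) with hν
  set τ : H.Dart → ℤ := fun b => if Tri R b then 1 else 0 with hτ
  have hτt : ∀ b, τ (turn R b) = τ b := by intro b; simp only [hτ, tri_turn]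
  have hτ0 : ∀ b (x y : ℤ), (Tri R b → x = y) → τ b * x = τ b * y := by
    intro b x y hxy
    simp only [hτ]
    split_ifs with h
    · rw [hxy h]
    · simp
  let c : H.Dart → H.Dart := turn R
  -- transfers to vertices of kind `A`
  have a1 : ∑ b, τ b * α (R.next b).snd = ∑ b, τ b * α b.fst := by
    rw [← sum_turn R fun b => τ b * α b.fst]
    simp only [hτt, fst_turn]
  have a2 : ∑ b, τ b * α b.snd = ∑ b, τ b * α b.fst := by
    rw [← sum_turn R fun b => τ b * α b.fst, ← sum_turn R fun b => τ (turn R b) * α (turn R b).fst]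
    refine Finset.sum_congr rfl fun b _ => ?_
    rw [hτt, hτt]
    exact hτ0 b _ _ fun h => by rw [h.fst_turn_turn]
  -- transfers from `B` to the opposite vertex of a triangle
  have b1 : ∑ b, τ b * (β b.fst * (ν b.snd * β (R.next b).snd))
      = ∑ b, τ b * (ν b.fst * β b.snd * β (R.next b).snd) := by
    rw [← sum_turn R fun b => τ b * (β b.fst * (ν b.snd * β (R.next b).snd))]
    refine Finset.sum_congr rfl fun b _ => ?_
    rw [hτt]
    refine hτ0 b _ _ fun h => ?_
    have e1 : (R.next (turn R b)).snd = b.snd := h.fst_turn_turn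
    have e2 : (turn R b).snd = b.fst := R.fst_next b
    rw [e1, e2, fst_turn]; ring
  have b2 : ∑ b, τ b * (β b.fst * (β b.snd * ν (R.next b).snd))
      = ∑ b, τ b * (ν b.fst * β b.snd * β (R.next b).snd) := by
    rw [← sum_turn R fun b => τ b * (ν b.fst * β b.snd * β (R.next b).snd)]
    refine Finset.sum_congr rfl fun b _ => ?_
    rw [hτt]
    refine hτ0 b _ _ fun h => ?_
    have e1 : (R.next (turn R b)).snd = b.snd := h.fst_turn_turn
    have e2 : (turn R b).snd = b.fst := R.fst_next b
    rw [e1, e2, fst_turn]; ring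
  -- transfers along other faces
  have c1 : ∑ b, (1 - τ b) * (ν b.fst * β b.snd) = ∑ b, (1 - τ b) * (β b.fst * ν (R.next b).snd) := by
    rw [← sum_turn R fun b => (1 - τ b) * (ν b.fst * β b.snd)]
    refine Finset.sum_congr rfl fun b _ => ?_
    have e2 : (turn R b).snd = b.fst := R.fst_next b
    rw [hτt, e2, fst_turn]; ring
  have c2 : ∑ b, (1 - τ b) * (β b.fst * ν b.snd) = ∑ b, (1 - τ b) * (ν b.fst * β (R.next b).snd) := by
    rw [← sum_turn R fun b => (1 - τ b) * (β b.fst * ν b.snd)]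
    refine Finset.sum_congr rfl fun b _ => ?_
    have e2 : (turn R b).snd = b.fst := R.fst_next b
    rw [hτt, e2, fst_turn]; ring
  have hc : ∀ b, corner F R b = (if Tri R b then 0 else 2) + (2 * (τ b * α b.fst) - τ b * α b.snd
      - τ b * α (R.next b).snd) + (2 * (τ b * (ν b.fst * β b.snd * β (R.next b).snd))
      - τ b * (β b.fst * (ν b.snd * β (R.next b).snd))
      - τ b * (β b.fst * (β b.snd * ν (R.next b).snd)))
      + ((1 - τ b) * (ν b.fst * β b.snd) - (1 - τ b) * (β b.fst * ν (R.next b).snd))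
      + ((1 - τ b) * (ν b.fst * β (R.next b).snd) - (1 - τ b) * (β b.fst * ν b.snd)) := by
    intro b
    simp only [corner, hτ]
    split_ifs <;> ring
  simp only [hc, Finset.sum_add_distrib, Finset.sum_sub_distrib, ← Finset.mul_sum]
  rw [a1, a2, b1, b2, c1, c2]
  ring

/-- The final charge of a vertex: every vertex of kind `N` pays one unit to each poor neighbor. -/
def final (F : Set V) (R : H.RotationSystem) (v : V) : ℤ :=
  ∑ b ∈ dartsAt H v, (4 + corner F R b - ind (KindN H F) v * ind (Poor F R) b.snd +
    ind (Poor F R) v * ind (KindN H F) b.snd) - 24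

/-- Payments to poor vertices cancel under reversal of darts, and the other transfers cancel by
`sum_corner`. What is left is `sum_corners_le`. -/
theorem sum_final_le (F : Set V) (R : H.RotationSystem) (hg : R.genus ≤ 1)
    (hR : ∀ b, R.next b ≠ b) (d₀ : H.Dart) : ∑ v with 0 < deg H v, final F R v ≤ 0 := by
  have h1 := sum_corners_le R hg hR d₀
  simp only [final, Finset.sum_sub_distrib]
  have h2 : ∀ v, ∑ b ∈ dartsAt H v, (4 + corner F R b - ind (KindN H F) v * ind (Poor F R) b.snd +
      ind (Poor F R) v * ind (KindN H F) b.snd) = ∑ b ∈ dartsAt H v,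
      (4 + corner F R b - ind (KindN H F) b.fst * ind (Poor F R) b.snd +
      ind (Poor F R) b.fst * ind (KindN H F) b.snd) := by
    intro v
    refine Finset.sum_congr rfl fun b hb => ?_
    rw [mem_dartsAt.1 hb]
  simp only [h2]
  rw [sum_dartsAt_univ]
  have h3 : ∑ b : H.Dart, ind (Poor F R) b.fst * ind (KindN H F) b.snd
      = ∑ b : H.Dart, ind (KindN H F) b.fst * ind (Poor F R) b.snd := by
    rw [← Equiv.sum_comp (Function.Involutive.toPerm Dart.symm Dart.symm_involutive)]
    refine Finset.sum_congr rfl fun b _ => ?_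
    change ind (Poor F R) b.snd * ind (KindN H F) b.fst = _
    ring
  have h4 : ∑ _v : V with 0 < deg H _v, (24 : ℤ) = 24 * #{v | 0 < deg H v} := by
    simp [mul_comm]
  simp only [Finset.sum_add_distrib, Finset.sum_sub_distrib] at h1 ⊢
  rw [h3, h4, sum_corner]
  linarith

end

/-! ### Final charges of needy vertices -/

section

variable {V : Type*} [Fintype V] {G H : SimpleGraph V} {F : Set V} {R : H.RotationSystem}

theorem deg_snd_pos (b : H.Dart) : 0 < deg H b.snd := deg_pos_of_adj b.adj.symm

/-- Each of the four corners is worth six: a triangular one receives two, as neither of the other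
vertices is of kind A, and any other has its own two. -/
theorem Irred.final_kindA (h : Irred G H F) {v : V} (hv : KindA H F v) : 0 ≤ final F R v := by
  have h1 : ∀ b ∈ dartsAt H v, (4 + corner F R b - ind (KindN H F) v * ind (Poor F R) b.snd +
      ind (Poor F R) v * ind (KindN H F) b.snd) = 6 := by
    intro b hb
    rw [mem_dartsAt] at hb
    have hp : ¬ Poor F R v := fun hp => hv.not_kindN hp.1
    have hA : ∀ c : H.Dart, c.fst = v → ind (KindA H F) c.snd = 0 := fun c hc =>
      ind_of_not fun hc' => h.not_adj_kindA hv hc' (hc ▸ c.adj)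
    have e1 := hA b hb
    have e2 := hA (R.next b) (by rw [R.fst_next, hb])
    simp only [corner, hb, ind_of hv, ind_of_not hv.not_kindB, ind_of_not hv.not_kindN,
      ind_of_not hp, e1, e2]
    simp
  rw [final, Finset.sum_congr rfl h1, Finset.sum_const, card_dartsAt, hv.2]
  norm_num

/-- A corner is worth at least +1 per needy neighbor at it if it is not triangular, and at least -1
per needy neighbor if it is. Regrouped by neighbors, the two corners at a needy neighbor contribute
at least zero, because they are not both triangular. Thus the final charge is at least 4 deg - 24 ≥
0. Equality forces degree six and exactly one triangular corner at each needy neighbor, and the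
third vertex of that triangle is not needy, because a triangular corner with two needy neighbors
exceeds its bound. -/
theorem Irred.final_kindB (h : Irred G H F) {v : V} (hv : KindB H F v) : 0 ≤ final F R v ∧
    (final F R v = 0 → deg H v ≤ 6 ∧ ∀ b : H.Dart, b.fst = v → Needy H F b.snd →
      ∃ c : H.Dart, c.fst = v ∧ Tri R c ∧ (Needy H F c.snd ∧ KindN H F (R.next c).snd ∨
        KindN H F c.snd ∧ Needy H F (R.next c).snd)) := by
  set σ : H.Dart → ℤ := fun b => if Tri R b then -1 else 1 with hσ
  set η : V → ℤ := ind (Needy H F) with hη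
  have hp : ¬ Poor F R v := fun hp => hv.not_kindN hp.1
  -- lower bounds for the corners
  have key : ∀ b ∈ dartsAt H v, 0 ≤ corner F R b - σ b * (η b.snd + η (R.next b).snd) ∧
      (Tri R b → Needy H F b.snd → Needy H F (R.next b).snd →
        0 < corner F R b - σ b * (η b.snd + η (R.next b).snd)) := by
    intro b hb
    rw [mem_dartsAt] at hb
    have hv0 : ind (KindA H F) v = 0 := ind_of_not fun hx' => hx'.not_kindB hv
    have hk : ∀ x : V, 0 < deg H x →
        (KindA H F x ∧ ind (KindA H F) x = 1 ∧ ind (KindB H F) x = 0 ∧ ind (KindN H F) x = 0 ∧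
          η x = 1) ∨
        (KindB H F x ∧ ind (KindA H F) x = 0 ∧ ind (KindB H F) x = 1 ∧ ind (KindN H F) x = 0 ∧
          η x = 1) ∨
        (KindN H F x ∧ ind (KindA H F) x = 0 ∧ ind (KindB H F) x = 0 ∧ ind (KindN H F) x = 1 ∧
          η x = 0) := by
      intro x hx
      rcases kind_of_pos (F := F) hx with hx | hx | hx
      · exact Or.inl ⟨hx, ind_of hx, ind_of_not hx.not_kindB, ind_of_not hx.not_kindN, ind_of hx.1⟩
      · exact Or.inr (Or.inl ⟨hx, ind_of_not fun hx' => hx'.not_kindB hx, ind_of hx,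
          ind_of_not hx.not_kindN, ind_of hx.1⟩)
      · exact Or.inr (Or.inr ⟨hx, ind_of_not fun hx' => hx'.not_kindN hx,
          ind_of_not fun hx' => hx'.not_kindN hx, ind_of hx, ind_of_not hx.2⟩)
    simp only [corner, hb, hv0, ind_of hv, ind_of_not hv.not_kindN, hσ]
    rcases hk _ (deg_snd_pos b) with ⟨k1, a1, a2, a3, a4⟩ | ⟨k1, a1, a2, a3, a4⟩ | ⟨k1, a1, a2, a3, a4⟩ <;>
    rcases hk _ (deg_snd_pos (R.next b)) with ⟨k2, b1, b2, b3, b4⟩ | ⟨k2, b1, b2, b3, b4⟩ |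
      ⟨k2, b1, b2, b3, b4⟩ <;>
    simp only [a1, a2, a3, a4, b1, b2, b3, b4] <;>
    by_cases ht : Tri R b <;> simp only [ht, if_true, if_false] <;>
    first
      | exact absurd ht.adj (h.not_adj_kindA k1 k2)
      | exact ⟨by norm_num, fun hf => hf.elim⟩
      | exact ⟨by norm_num, fun _ hf => absurd hf k1.2⟩
      | exact ⟨by norm_num, fun _ _ hf => absurd hf k2.2⟩
      | exact ⟨by norm_num, fun _ _ _ => by norm_num⟩
  have key2 : ∀ b ∈ dartsAt H v, 0 ≤ η (R.next b).snd * (σ b + σ (R.next b)) := by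
    intro b hb
    rw [mem_dartsAt] at hb
    by_cases hn : Needy H F (R.next b).snd
    · rw [hη, ind_of hn, one_mul]
      simp only [hσ]
      have hnt : ¬ (Tri R b ∧ Tri R (R.next b)) := fun ⟨t1, t2⟩ =>
        h.not_tri t1 t2 hn.1 (Or.inl (hb ▸ hv.1.1))
      split_ifs <;> first | exact absurd ⟨‹_›, ‹_›⟩ hnt | norm_num
    · rw [hη, ind_of_not hn, zero_mul]
  -- The shift along the rotation collects the terms of two consecutive corners at their common
  -- neighbor.
  have hfin : final F R v = (4 * deg H v - 24) +
      ∑ b ∈ dartsAt H v, (corner F R b - σ b * (η b.snd + η (R.next b).snd)) +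
      ∑ b ∈ dartsAt H v, η (R.next b).snd * (σ b + σ (R.next b)) := by
    have e := sum_dartsAt_next R (fun b => η b.snd * σ b) v
    simp only [final, ind_of_not hp, ind_of_not hv.not_kindN, mul_add, Finset.sum_add_distrib,
      Finset.sum_sub_distrib, Finset.sum_const, card_dartsAt] at e ⊢
    simp only [mul_comm (σ _)] at e ⊢
    rw [e]
    simp
    ring
  have h6 : (6 : ℤ) ≤ deg H v := by exact_mod_cast h.six_le hv
  have s1 := Finset.sum_nonneg fun b hb => (key b hb).1
  have s2 := Finset.sum_nonneg key2
  refine ⟨by linarith, fun h0 => ⟨?_, fun b hb hbn => ?_⟩⟩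
  · have : (deg H v : ℤ) ≤ 6 := by linarith
    exact_mod_cast this
  have z1 := (Finset.sum_eq_zero_iff_of_nonneg fun b hb => (key b hb).1).1 (by linarith)
  have z2 := (Finset.sum_eq_zero_iff_of_nonneg key2).1 (by linarith)
  have tri_imp : ∀ c : H.Dart, c.fst = v → Tri R c →
      Needy H F c.snd ∨ Needy H F (R.next c).snd → ∃ c : H.Dart, c.fst = v ∧ Tri R c ∧
        (Needy H F c.snd ∧ KindN H F (R.next c).snd ∨
        KindN H F c.snd ∧ Needy H F (R.next c).snd) := by
    intro c hc ht hn
    have hcm : c ∈ dartsAt H v := by simpa using hc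
    have h3 : ¬ (Needy H F c.snd ∧ Needy H F (R.next c).snd) := fun ⟨n1, n2⟩ =>
      ((key c hcm).2 ht n1 n2).ne' (z1 c hcm)
    refine ⟨c, hc, ht, ?_⟩
    rcases hn with hn | hn
    · exact Or.inl ⟨hn, deg_snd_pos _, fun hn' => h3 ⟨hn, hn'⟩⟩
    · exact Or.inr ⟨⟨deg_snd_pos _, fun hn' => h3 ⟨hn', hn⟩⟩, hn⟩
  have hb' : R.next (R.next.symm b) = b := Equiv.apply_symm_apply _ _
  have hbf : (R.next.symm b).fst = v := by rw [← R.fst_next, hb', hb]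
  have z3 := z2 (R.next.symm b) (by simpa using hbf)
  rw [hb', hη, ind_of hbn, one_mul] at z3
  simp only [hσ] at z3
  by_cases t1 : Tri R b
  · exact tri_imp b hb t1 (Or.inl hbn)
  · by_cases t2 : Tri R (R.next.symm b)
    · exact tri_imp _ hbf t2 (Or.inr (by rwa [hb']))
    · simp [t1, t2] at z3

end

/-! ### Final charges of the other vertices -/

section

variable {V : Type*} {H : SimpleGraph V} {R : H.RotationSystem}

theorem snd_turn (b : H.Dart) : (turn R b).snd = b.fst := R.fst_next b

theorem Tri.snd_next_turn {b : H.Dart} (h : Tri R b) : (R.next (turn R b)).snd = b.snd :=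
  h.fst_turn_turn

theorem adj_snd_next (b : H.Dart) : H.Adj b.fst (R.next b).snd := by
  have := (R.next b).adj; rwa [R.fst_next] at this

end

section

variable {V : Type*} [Fintype V] {G H : SimpleGraph V} {F : Set V} {R : H.RotationSystem}

/-- The kind of a neighbor of a vertex that is not needy. -/
def kindOf (F : Set V) (R : H.RotationSystem) (x : V) : Kind :=
  if KindA H F x then .a else if KindB H F x then .b else if Poor F R x then .p else .n

/-- The letter of a dart. -/
def letter (F : Set V) (R : H.RotationSystem) (b : H.Dart) : Letter :=
  (kindOf F R b.snd, decide (Tri R b))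

theorem Poor.not_kindA_self {x : V} (h : Poor F R x) : ¬ KindA H F x := fun h' => h'.not_kindN h.1
theorem Poor.not_kindB_self {x : V} (h : Poor F R x) : ¬ KindB H F x := fun h' => h'.not_kindN h.1

theorem kindOf_cases (F : Set V) (R : H.RotationSystem) {x : V} (hx : 0 < deg H x) :
    (kindOf F R x = .a ∧ KindA H F x ∧ ¬ KindB H F x ∧ ¬ KindN H F x ∧ ¬ Poor F R x) ∨
    (kindOf F R x = .b ∧ ¬ KindA H F x ∧ KindB H F x ∧ ¬ KindN H F x ∧ ¬ Poor F R x) ∨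
    (kindOf F R x = .n ∧ ¬ KindA H F x ∧ ¬ KindB H F x ∧ KindN H F x ∧ ¬ Poor F R x) ∨
    (kindOf F R x = .p ∧ ¬ KindA H F x ∧ ¬ KindB H F x ∧ KindN H F x ∧ Poor F R x) := by
  rcases kind_of_pos (F := F) hx with h | h | h
  · exact Or.inl ⟨if_pos h, h, h.not_kindB, h.not_kindN, fun hp => hp.not_kindA_self h⟩
  · have ha : ¬ KindA H F x := fun h' => h'.not_kindB h
    exact Or.inr (Or.inl ⟨by rw [kindOf, if_neg ha, if_pos h], ha, h, h.not_kindN,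
      fun hp => hp.not_kindB_self h⟩)
  · have ha : ¬ KindA H F x := fun h' => h'.not_kindN h
    have hb : ¬ KindB H F x := fun h' => h'.not_kindN h
    by_cases hp : Poor F R x
    · exact Or.inr (Or.inr (Or.inr ⟨by rw [kindOf, if_neg ha, if_neg hb, if_pos hp], ha, hb, h, hp⟩))
    · exact Or.inr (Or.inr (Or.inl ⟨by rw [kindOf, if_neg ha, if_neg hb, if_neg hp], ha, hb, h, hp⟩))

theorem letter_isA {b : H.Dart} : (letter F R b).1.isA = true ↔ KindA H F b.snd := by
  rcases kindOf_cases F R (deg_snd_pos b) with ⟨h, h'⟩ | ⟨h, h'⟩ | ⟨h, h'⟩ | ⟨h, h'⟩ <;>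
    simp [letter, h, h', Kind.isA]

theorem letter_isB {b : H.Dart} : (letter F R b).1.isB = true ↔ KindB H F b.snd := by
  rcases kindOf_cases F R (deg_snd_pos b) with ⟨h, h'⟩ | ⟨h, h'⟩ | ⟨h, h'⟩ | ⟨h, h'⟩ <;>
    simp [letter, h, h', Kind.isB]

theorem letter_isP {b : H.Dart} : (letter F R b).1.isP = true ↔ Poor F R b.snd := by
  rcases kindOf_cases F R (deg_snd_pos b) with ⟨h, h'⟩ | ⟨h, h'⟩ | ⟨h, h'⟩ | ⟨h, h'⟩ <;>
    simp [letter, h, h', Kind.isP]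

theorem kindN_of_letter {b : H.Dart} (hb : (letter F R b).1.isN = true) : KindN H F b.snd := by
  rcases kindOf_cases F R (deg_snd_pos b) with ⟨h, h'⟩ | ⟨h, h'⟩ | ⟨h, h'⟩ | ⟨h, h'⟩ <;>
    simp_all [letter, Kind.isN]

theorem needy_of_letter {b : H.Dart} (hb : (letter F R b).1.isNeedy = true) :
    Needy H F b.snd := by
  rcases kindOf_cases F R (deg_snd_pos b) with ⟨h, h'⟩ | ⟨h, h'⟩ | ⟨h, h'⟩ | ⟨h, h'⟩
  · exact h'.1.1
  · exact h'.2.1.1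
  · simp [letter, h, Kind.isNeedy] at hb
  · simp [letter, h, Kind.isNeedy] at hb

theorem letter_snd {b : H.Dart} : (letter F R b).2 = true ↔ Tri R b := by simp [letter]

/-- Next to a poor neighbor, the corners are triangular and the neighbors are of kind `B`. -/
theorem Poor.next_of_snd {b : H.Dart} (hv : KindN H F b.fst) (hp : Poor F R b.snd) :
    Tri R b ∧ KindB H F (R.next b).snd := by
  have e : turn R (R.next.symm b.symm) = b := by
    rw [turn_apply, Equiv.apply_symm_apply, Dart.symm_symm]
  have hf : (R.next.symm b.symm).fst = b.snd := by
    rw [← R.fst_next, Equiv.apply_symm_apply]; rfl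
  have ht : Tri R b := by
    have := hp.tri hf
    rw [← tri_turn, e] at this
    exact this
  refine ⟨ht, ?_⟩
  have h1 := (Poor.next_kindB (b := b.symm) hp hv).2
  have h2 : R.next.symm b.symm = turn R (turn R b) := by
    rw [ht.turn_turn, Equiv.eq_symm_apply, e]
  rw [h2, snd_turn, fst_turn] at h1
  exact h1

theorem Poor.of_snd_next {b : H.Dart} (hv : KindN H F b.fst) (hp : Poor F R (R.next b).snd) :
    Tri R b ∧ KindB H F b.snd := by
  have ht : Tri R b := tri_turn.1 (hp.tri (fst_turn b))
  refine ⟨ht, ?_⟩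
  have h1 := (Poor.next_kindB (b := turn R b) hp (by rwa [snd_turn])).1
  rwa [ht.snd_next_turn] at h1

theorem Irred.okPair_letter (h : Irred G H F) {b : H.Dart} (hv : KindN H F b.fst) :
    okPair (letter F R b) (letter F R (R.next b)) = true := by
  have h1 : ¬ (Tri R b ∧ KindA H F b.snd ∧ KindA H F (R.next b).snd) := fun ⟨t, a, a'⟩ =>
    h.not_adj_kindA a a' t.adj
  have h2 : Poor F R b.snd → Tri R b ∧ KindB H F (R.next b).snd := Poor.next_of_snd hv
  have h3 : Poor F R (R.next b).snd → Tri R b ∧ KindB H F b.snd := Poor.of_snd_next hv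
  rw [← letter_isA (R := R), ← letter_isA (R := R), ← letter_snd (F := F)] at h1
  rw [← letter_isP, ← letter_isB (R := R), ← letter_snd (F := F)] at h2 h3
  rw [okPair]
  generalize (letter F R b).1.isA = x1 at *
  generalize (letter F R b).1.isB = x2 at *
  generalize (letter F R b).1.isP = x3 at *
  generalize (letter F R b).2 = x4 at *
  generalize (letter F R (R.next b)).1.isA = y1 at *
  generalize (letter F R (R.next b)).1.isB = y2 at *
  generalize (letter F R (R.next b)).1.isP = y3 at *
  cases x4 <;> cases x1 <;> cases x2 <;> cases x3 <;> cases y1 <;> cases y3 <;> simp_all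

/-- The center may be free, but all five edges of the two triangles have a needy end and so belong
to `G`. -/
theorem Irred.okTriple_letter (h : Irred G H F) (b : H.Dart) :
    okTriple (letter F R b) (letter F R (R.next b)) (letter F R (R.next (R.next b))) = true := by
  rw [okTriple, Bool.not_eq_true']
  by_contra hc
  simp only [Bool.not_eq_false, Bool.and_eq_true, letter_snd] at hc
  obtain ⟨⟨⟨⟨t1, t2⟩, n1⟩, n2⟩, n3⟩ := hc
  exact h.not_tri t1 t2 (needy_of_letter n2).1
    (Or.inr ⟨(needy_of_letter n1).1, (needy_of_letter n3).1⟩)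

/-- Is the end of the dart after `b` uncovered? -/
def unc (F : Set V) (R : H.RotationSystem) (b : H.Dart) : ℕ :=
  (uncovered (letter F R b) (letter F R (R.next b)) (letter F R (R.next (R.next b)))).toNat

theorem unc_eq_one {b : H.Dart} (hb : KindB H F (R.next b).snd)
    (h1 : Tri R b → ¬ KindA H F b.snd)
    (h2 : Tri R (R.next b) → ¬ KindA H F (R.next (R.next b)).snd) : unc F R b = 1 := by
  rw [unc, uncovered, letter_isB.2 hb]
  rw [← letter_isA (R := R), ← letter_snd (F := F)] at h1 h2
  revert h1 h2
  generalize (letter F R b).1.isA = x1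
  generalize (letter F R b).2 = x4
  generalize (letter F R (R.next b)).2 = x3
  generalize (letter F R (R.next (R.next b))).1.isA = y1
  revert x1 x3 x4 y1
  decide

/-- The neighbors of kind `A`. -/
def nbrA (H : SimpleGraph V) (F : Set V) (v : V) : Finset V := {z ∈ nbr H v | KindA H F z}

theorem mem_nbrA {v z : V} : z ∈ nbrA H F v ↔ H.Adj v z ∧ KindA H F z := by simp [nbrA]

/-- Of the four neighbors, `w` is not needy, so the sum is at most 4 + 3. -/
theorem flex_nbrA {w : V} (hw : KindN H F w) :
    ∀ v ∈ nbrA H F w, deg H v + #{z ∈ nbr H v | Needy H F z} ≤ 7 := by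
  intro v hv
  rw [mem_nbrA] at hv
  have h1 : ({z ∈ nbr H v | Needy H F z} : Finset V) ⊆ (nbr H v).erase w := by
    intro z hz
    rw [mem_filter] at hz
    exact mem_erase.2 ⟨fun e => hw.2 (e ▸ hz.2), hz.1⟩
  have h2 := card_le_card h1
  rw [card_erase_of_mem (mem_nbr.2 hv.1.symm)] at h2
  have h3 : #(nbr H v) = 4 := hv.2.2
  have h4 : deg H v = 4 := hv.2.2
  omega

theorem sum_mem_dartsAt (R : H.RotationSystem) {v : V} {Z : Finset V} (hZ : Z ⊆ nbr H v) :
    ∑ b ∈ dartsAt H v, (if (R.next b).snd ∈ Z then 1 else 0) = #Z := by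
  rw [sum_dartsAt_next R (fun b => if b.snd ∈ Z then 1 else 0),
    sum_dartsAt_snd (fun z => if z ∈ Z then 1 else 0), ← card_filter]
  congr 1
  ext z
  simp only [mem_filter]
  exact ⟨fun h => h.2, fun h => ⟨hZ h, h⟩⟩

theorem unc_of_mem {v : V} {b : H.Dart} (hb : b.fst = v)
    (hz : (R.next b).snd ∈ ({z ∈ nbr H v \ nbrA H F v | Needy H F z ∧
      Disjoint (nbr H z) (nbrA H F v)} : Finset V)) : unc F R b = 1 := by
  simp only [mem_filter, mem_sdiff, mem_nbr, mem_nbrA, not_and] at hz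
  obtain ⟨⟨h1, h2⟩, h3, h4⟩ := hz
  have hB : KindB H F (R.next b).snd := h3.kind.resolve_left (h2 h1)
  rw [Finset.disjoint_left] at h4
  refine unc_eq_one hB (fun t ha => ?_) (fun t ha => ?_)
  · exact h4 (mem_nbr.2 t.adj.symm) (mem_nbrA.2 ⟨hb ▸ b.adj, ha⟩)
  · refine h4 (mem_nbr.2 t.adj) (mem_nbrA.2 ⟨?_, ha⟩)
    have := (R.next (R.next b)).adj
    rwa [R.fst_next, R.fst_next, hb] at this

/-- `unc` detects adjacency to a neighbor of kind A only across triangular corners. It can overcount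
the vertices of the left-hand side but never miss one, which is the direction needed for lower
bounds. -/
theorem card_le_sum_unc (R : H.RotationSystem) (v : V) :
    #{z ∈ nbr H v \ nbrA H F v | Needy H F z ∧ Disjoint (nbr H z) (nbrA H F v)} ≤
      ∑ b ∈ dartsAt H v, unc F R b := by
  rw [← sum_mem_dartsAt R ((filter_subset _ _).trans sdiff_subset)]
  refine Finset.sum_le_sum fun b hb => ?_
  split_ifs with hz
  · exact (unc_of_mem (mem_dartsAt.1 hb) hz).ge
  · exact Nat.zero_le _

theorem Irred.eight_le_unc (h : Irred G H F) {v : V} (hv : KindN H F v) :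
    8 ≤ deg H v + ∑ b ∈ dartsAt H v, unc F R b :=
  (h.eight_le hv.1 hv.2 (filter_subset _ _) (flex_nbrA hv)).trans
    (Nat.add_le_add_left (card_le_sum_unc R v) _)

theorem Irred.nine_le_unc (h : Irred G H F) {b : H.Dart} (hv : KindN H F b.fst) (h1 : Tri R b)
    (h2 : KindA H F (R.next b).snd) (h3 : Tri R (R.next b)) :
    9 ≤ deg H b.fst + ∑ b ∈ dartsAt H b.fst, unc F R b := by
  have e2 : H.Adj b.fst (R.next (R.next b)).snd := by
    have := adj_snd_next (R := R) (R.next b); rwa [R.fst_next] at this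
  have hne := snd_pow_next_ne R b (i := 2) (by norm_num)
    (by have := h.four_le_deg_fst b; omega)
  simp only [pow_succ, pow_zero, one_mul, Equiv.Perm.mul_apply] at hne
  refine (h.nine_le hv.1 hv.2 (filter_subset _ _) (flex_nbrA hv)
    (v := (R.next b).snd) (n₁ := b.snd) (n₂ := (R.next (R.next b)).snd)
    (mem_nbrA.2 ⟨adj_snd_next b, h2⟩) h2.2 hne.symm ?_ ?_ (mem_nbr.2 h1.adj.symm)
    (mem_nbr.2 h3.adj)).trans (Nat.add_le_add_left (card_le_sum_unc R _) _)
  · exact mem_sdiff.2 ⟨mem_nbr.2 b.adj, fun hc => h.not_adj_kindA (mem_nbrA.1 hc).2 h2 h1.adj⟩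
  · exact mem_sdiff.2 ⟨mem_nbr.2 e2, fun hc => h.not_adj_kindA h2 (mem_nbrA.1 hc).2 h3.adj⟩

/-- The poor vertex lies between two neighbors of kind B, both adjacent to it. They are therefore
left out of the count in `Irred.eight_le_of_poor`, and whatever `unc` assigns to them can be added
on the left. -/
theorem Irred.eight_le_unc_of_poor (h : Irred G H F) {b : H.Dart} (hv : KindN H F b.fst)
    (hp : Poor F R (R.next (R.next b)).snd) :
    8 + unc F R b + unc F R (R.next (R.next b)) ≤
      deg H b.fst + ∑ b ∈ dartsAt H b.fst, unc F R b := by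
  set v := b.fst with hvd
  set b1 := R.next b with hb1
  set b2 := R.next b1 with hb2
  set b3 := R.next b2 with hb3
  have f1 : b1.fst = v := R.fst_next b
  have f2 : b2.fst = v := (R.fst_next b1).trans f1
  have f3 : b3.fst = v := (R.fst_next b2).trans f2
  obtain ⟨t1, u1⟩ := Poor.of_snd_next (R := R) (b := b1) (by rwa [f1]) hp
  obtain ⟨t2, u2⟩ := Poor.next_of_snd (R := R) (b := b2) (by rwa [f2]) hp
  have h4 : 4 ≤ deg H v := h.four_le_deg_fst b
  have hne : b1.snd ≠ b3.snd := by
    have := snd_pow_next_ne R b1 (i := 2) (by norm_num) (by rw [f1]; omega)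
    simp only [pow_succ, pow_zero, one_mul, Equiv.Perm.mul_apply] at this
    exact this.symm
  have hne2 : b ≠ b2 := by
    have := pow_next_ne R b (i := 2) (by norm_num) (show 2 < deg H v by omega)
    simp only [pow_succ, pow_zero, one_mul, Equiv.Perm.mul_apply] at this
    exact this.symm
  have hYx : ∀ y ∈ nbrA H F v, ¬ H.Adj b2.snd y := by
    intro y hy hadj
    exact Poor.not_kindA (R := R) (b := (⟨(b2.snd, y), hadj⟩ : H.Dart)) hp (mem_nbrA.1 hy).2
  have hC := h.eight_le_of_poor (w := v) (x := b2.snd) (Y := nbrA H F v) hv.2 hp.1.2 (f2 ▸ b2.adj) hp.2.1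
    hp.card_needy.le (filter_subset _ _) (flex_nbrA hv)
    (fun hx => hp.not_kindA_self (mem_nbrA.1 hx).2) hYx u1.1 u2.1 hne (f1 ▸ b1.adj) (f3 ▸ b3.adj)
    t1.adj.symm t2.adj
  set Z : Finset V := {z ∈ nbr H v \ insert b2.snd (nbrA H F v) | Needy H F z ∧
    Disjoint (nbr H z) (insert b2.snd (nbrA H F v))} with hZ
  have hn1 : b1.snd ∉ Z := fun hz =>
    Finset.disjoint_left.1 (mem_filter.1 hz).2.2 (mem_nbr.2 t1.adj) (mem_insert_self _ _)
  have hn3 : b3.snd ∉ Z := fun hz =>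
    Finset.disjoint_left.1 (mem_filter.1 hz).2.2 (mem_nbr.2 t2.adj.symm) (mem_insert_self _ _)
  -- The positions `b` and `b2` belong to the two neighbors next to the poor one, since `unc` refers
  -- to the end of the following dart.
  have key : ∑ c ∈ dartsAt H v, ((if (R.next c).snd ∈ Z then 1 else 0) +
      (if c = b then unc F R b else 0) + (if c = b2 then unc F R b2 else 0)) ≤
      ∑ c ∈ dartsAt H v, unc F R c := by
    refine Finset.sum_le_sum fun c hc => ?_
    rw [mem_dartsAt] at hc
    by_cases c1 : c = b
    · subst c1
      rw [if_neg hn1, if_pos rfl, if_neg hne2]; omega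
    · by_cases c2 : c = b2
      · rw [c2, if_neg hn3, if_neg hne2.symm, if_pos rfl]; omega
      · rw [if_neg c1, if_neg c2]
        split_ifs with hz
        · refine (unc_of_mem hc ?_).ge
          simp only [hZ, mem_filter, mem_sdiff, mem_insert, not_or, disjoint_insert_right] at hz ⊢
          exact ⟨⟨hz.1.1, hz.1.2.2⟩, hz.2.1, hz.2.2.2⟩
        · exact Nat.zero_le _
  rw [Finset.sum_add_distrib, Finset.sum_add_distrib,
    sum_mem_dartsAt R (Z := Z) ((filter_subset _ _).trans sdiff_subset), Finset.sum_ite_eq',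
    Finset.sum_ite_eq', if_pos (mem_dartsAt.2 rfl), if_pos (mem_dartsAt.2 f2)] at key
  omega

end

/-! ### From words to final charges -/

section

variable {V : Type*} [Fintype V] {G H : SimpleGraph V} {F : Set V} {R : H.RotationSystem}

/-- The word that describes the neighborhood of a vertex. -/
def word (F : Set V) (R : H.RotationSystem) (b : H.Dart) (i : ℕ) : Letter :=
  letter F R ((R.next ^ i) b)

theorem word_succ (b : H.Dart) (i : ℕ) :
    word F R b (i + 1) = letter F R (R.next ((R.next ^ i) b)) := by
  rw [word, pow_succ', Equiv.Perm.mul_apply]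

theorem word_add_two (b : H.Dart) (i : ℕ) :
    word F R b (i + 2) = letter F R (R.next (R.next ((R.next ^ i) b))) := by
  rw [word, pow_succ', pow_succ', Equiv.Perm.mul_apply, Equiv.Perm.mul_apply]

theorem word_add_three (b : H.Dart) (i : ℕ) :
    word F R b (i + 3) = letter F R (R.next (R.next (R.next ((R.next ^ i) b)))) := by
  rw [show i + 3 = (i + 1) + 2 from rfl, word_add_two, pow_succ', Equiv.Perm.mul_apply]

theorem word_add_four (b : H.Dart) (i : ℕ) :
    word F R b (i + 4) = letter F R (R.next (R.next (R.next (R.next ((R.next ^ i) b))))) := by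
  rw [show i + 4 = (i + 2) + 2 from rfl, word_add_two, pow_succ', pow_succ',
    Equiv.Perm.mul_apply, Equiv.Perm.mul_apply]

theorem word_add_deg (b : H.Dart) (i : ℕ) : word F R b (i + deg H b.fst) = word F R b i := by
  rw [word, word, pow_add, Equiv.Perm.mul_apply, pow_deg_next]

theorem sumUpTo_word (b : H.Dart) (f : H.Dart → ℕ) :
    sumUpTo (fun i => f ((R.next ^ i) b)) (deg H b.fst) = ∑ c ∈ dartsAt H b.fst, f c := by
  rw [sumUpTo_eq, sum_dartsAt_pow R f b]

theorem numUncovered_word (b : H.Dart) :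
    numUncovered (deg H b.fst) (word F R b) = ∑ c ∈ dartsAt H b.fst, unc F R c := by
  rw [← sumUpTo_word (R := R) b]
  simp only [numUncovered, word_add_two]
  simp only [word_succ]
  rfl

theorem Irred.okWord_word (h : Irred G H F) {b : H.Dart} (hv : KindN H F b.fst) :
    okWord (deg H b.fst) (word F R b) = true := by
  refine allUpTo_iff.2 fun i _ => ?_
  rw [word_add_two, word_succ, Bool.and_eq_true]
  exact ⟨h.okPair_letter (by rwa [fst_pow_next]), h.okTriple_letter _⟩

theorem Irred.irredWord_word (h : Irred G H F) {b : H.Dart} (hv : KindN H F b.fst) :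
    irredWord (deg H b.fst) (word F R b) = true := by
  have hf : ∀ i, ((R.next ^ i) b).fst = b.fst := fst_pow_next R b
  have h8 := h.eight_le_unc (R := R) hv
  rw [← numUncovered_word] at h8
  simp only [irredWord, Bool.and_eq_true, Bool.or_eq_true, Nat.ble_eq]
  refine ⟨⟨⟨?_, h8⟩, ?_⟩, ?_⟩
  · refine h8.trans (Nat.add_le_add_left ?_ _)
    rw [numUncovered, sumUpTo_eq, sumUpTo_eq]
    refine Finset.sum_le_sum fun i _ => ?_
    rw [uncovered]
    cases (word F R b (i + 1)).1.isB <;> simp [Bool.toNat_le]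
  · rw [or_iff_not_imp_left]
    intro h9
    refine allUpTo_iff.2 fun i _ => ?_
    rw [word_succ, Bool.not_eq_true']
    by_contra hc
    simp only [Bool.not_eq_false, Bool.and_eq_true, letter_snd, letter_isA, word] at hc
    obtain ⟨⟨t1, ha⟩, t2⟩ := hc
    have := h.nine_le_unc (by rwa [hf]) t1 ha t2
    rw [hf, ← numUncovered_word] at this
    exact h9 this
  · refine allUpTo_iff.2 fun i _ => ?_
    rw [Bool.or_eq_true, Bool.not_eq_true', or_iff_not_imp_left, Bool.not_eq_false, Nat.ble_eq]
    rw [word_add_four, word_add_three, word_add_two, word_succ, letter_isP, numUncovered_word]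
    intro hp
    have := h.eight_le_unc_of_poor (by rwa [hf]) hp
    rwa [hf] at this

theorem Irred.fineWord_word (h : Irred G H F) {b : H.Dart} (hv : KindN H F b.fst) :
    fineWord (deg H b.fst) (word F R b) = true :=
  fineWord_of_okWord (word_add_deg b) (h.okWord_word hv) (h.irredWord_word hv)

theorem Irred.cornerValue_letter (h : Irred G H F) {b : H.Dart} (hv : KindN H F b.fst) :
    (cornerValue (letter F R b) (letter F R (R.next b)) : ℤ) =
      4 + 2 * corner F R b - ind (Poor F R) b.snd - ind (Poor F R) (R.next b).snd := by
  have h1 : ¬ (Tri R b ∧ KindA H F b.snd ∧ KindA H F (R.next b).snd) := fun ⟨t, a, a'⟩ =>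
    h.not_adj_kindA a a' t.adj
  have hvA : ¬ KindA H F b.fst := fun h' => h'.not_kindN hv
  have hvB : ¬ KindB H F b.fst := fun h' => h'.not_kindN hv
  rcases kindOf_cases F R (deg_snd_pos b) with ⟨k, k1, k2, k3, k4⟩ | ⟨k, k1, k2, k3, k4⟩ |
    ⟨k, k1, k2, k3, k4⟩ | ⟨k, k1, k2, k3, k4⟩ <;>
  rcases kindOf_cases F R (deg_snd_pos (R.next b)) with ⟨l, l1, l2, l3, l4⟩ | ⟨l, l1, l2, l3, l4⟩ |
    ⟨l, l1, l2, l3, l4⟩ | ⟨l, l1, l2, l3, l4⟩ <;>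
  by_cases ht : Tri R b <;>
  simp [cornerValue, letter, corner, ind, k, k1, k2, k4, l, l1, l2, l4, ht, hv, hvA, hvB,
    Kind.isA, Kind.isB, Kind.isP]

/-- The unit paid to a poor neighbor is split between the two corners next to it, which is why
everything is doubled. Of the 8 per corner in the doubled charge, `cornerValue` contains 4, and the
other 4 give the term `4 * deg`. -/
theorem Irred.total_word (h : Irred G H F) {b : H.Dart} (hv : KindN H F b.fst) :
    2 * final F R b.fst = total (deg H b.fst) (word F R b) + 4 * deg H b.fst - 48 +
      2 * ∑ c ∈ dartsAt H b.fst, ind (Poor F R) b.fst * ind (KindN H F) c.snd := by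
  have e1 : total (deg H b.fst) (word F R b) = ∑ c ∈ dartsAt H b.fst,
      cornerValue (letter F R c) (letter F R (R.next c)) := by
    rw [← sumUpTo_word (R := R) b]
    simp only [total, word_succ]
    rfl
  have e2 : ∀ c ∈ dartsAt H b.fst, (cornerValue (letter F R c) (letter F R (R.next c)) : ℤ) =
      4 + 2 * corner F R c - ind (Poor F R) c.snd - ind (Poor F R) (R.next c).snd := by
    intro c hc
    exact h.cornerValue_letter (by rwa [mem_dartsAt.1 hc])
  have e3 := sum_dartsAt_next R (fun c => ind (Poor F R) c.snd) b.fst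
  rw [e1, Nat.cast_sum, Finset.sum_congr rfl e2]
  simp only [final, ind_of hv, Finset.sum_add_distrib, Finset.sum_sub_distrib, e3,
    Finset.sum_const, card_dartsAt, ← Finset.mul_sum, one_mul]
  simp
  ring

/-- A poor vertex with its two neighbors of kind `N`. -/
theorem Poor.sum_ind {v : V} (h : Poor F R v) :
    ∑ c ∈ dartsAt H v, ind (Poor F R) v * ind (KindN H F) c.snd = 2 := by
  obtain ⟨u₁, u₂, u₃, y₁, y₂, h1, h2, h3, h4, h5, h6⟩ := h.sum_eq (ind (KindN H F))
  rw [← Finset.mul_sum, h6, ind_of h, ind_of h4, ind_of h5, ind_of_not h1.not_kindN,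
    ind_of_not h2.not_kindN, ind_of_not h3.not_kindN]
  norm_num

theorem exists_pow_of_fst_eq (R : H.RotationSystem) {b c : H.Dart} (h : c.fst = b.fst) :
    ∃ i < deg H b.fst, (R.next ^ i) b = c := by
  obtain ⟨n, hn, hc⟩ := (isCycleOn_dartsAt R b.fst).exists_pow_eq (a := b) (b := c)
    (by simp) (by simpa using h)
  exact ⟨n, by rwa [card_dartsAt] at hn, hc⟩

theorem noAP_word {b : H.Dart} (h : noAP (deg H b.fst) (word F R b) = true) {c : H.Dart}
    (hc : c.fst = b.fst) : ¬ KindA H F c.snd ∧ ¬ Poor F R c.snd := by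
  obtain ⟨i, hi, rfl⟩ := exists_pow_of_fst_eq R hc
  have := allUpTo_iff.1 h i hi
  rw [← letter_isA (R := R), ← letter_isP]
  simpa [word] using this

theorem noBB_word {b : H.Dart} (h : noBB (deg H b.fst) (word F R b) = true) {c : H.Dart}
    (hc : c.fst = b.fst) : ¬ (Tri R c ∧ KindB H F c.snd ∧ KindB H F (R.next c).snd) := by
  obtain ⟨i, hi, rfl⟩ := exists_pow_of_fst_eq R hc
  have := allUpTo_iff.1 h i hi
  rw [word_succ, word, Bool.not_eq_true'] at this
  rintro ⟨h1, h2, h3⟩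
  rw [letter_snd.2 h1, letter_isB.2 h2, letter_isB.2 h3] at this
  exact absurd this (by decide)

theorem poor_of_poorWord {b : H.Dart} (hv : KindN H F b.fst)
    (h : poorWord (deg H b.fst) (word F R b) = true) : Poor F R b.fst := by
  simp only [poorWord, Bool.and_eq_true, Nat.beq_eq, Bool.not_eq_true'] at h
  obtain ⟨⟨h5, ht⟩, hp⟩ := h
  refine ⟨hv, h5, fun c hc => ?_, ?_⟩
  · obtain ⟨i, hi, rfl⟩ := exists_pow_of_fst_eq R hc
    exact letter_snd.1 (allUpTo_iff.1 ht i hi)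
  · have hp' : ∃ i < deg H b.fst, poorAt (word F R b) i = true := by
      by_contra! hc
      refine absurd (allUpTo_iff.2 fun i hi => ?_) (Bool.eq_false_iff.1 hp)
      simpa using hc i hi
    obtain ⟨i, hi, hp'⟩ := hp'
    rw [poorAt, word_add_four, word_add_three, word_add_two, word_succ] at hp'
    simp only [Bool.and_eq_true] at hp'
    obtain ⟨⟨⟨⟨h0, h1⟩, h2⟩, h3⟩, h4⟩ := hp'
    exact ⟨(R.next ^ i) b, fst_pow_next R b i, letter_isB.1 h0, kindN_of_letter h1,
      letter_isB.1 h2, kindN_of_letter h3, letter_isB.1 h4⟩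

/-- The three outcomes of `fineWord` become: positive charge, charge zero, and charge -2 before the
two units that a poor vertex receives from its two neighbors of kind N. -/
theorem Irred.final_kindN (h : Irred G H F) {v : V} (hv : KindN H F v) : 0 ≤ final F R v ∧
    (final F R v = 0 → (∀ b : H.Dart, b.fst = v → ¬ KindA H F b.snd ∧ ¬ Poor F R b.snd) ∧
      (Poor F R v ∨ ∀ b : H.Dart, b.fst = v →
        ¬ (Tri R b ∧ KindB H F b.snd ∧ KindB H F (R.next b).snd))) := by
  obtain ⟨u, hu⟩ := card_pos.1 hv.1
  set b : H.Dart := ⟨(v, u), mem_nbr.1 hu⟩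
  have hv' : KindN H F b.fst := hv
  have hfine := h.fineWord_word (R := R) hv'
  have htot := h.total_word (R := R) hv'
  have hnn : 0 ≤ ∑ c ∈ dartsAt H b.fst, ind (Poor F R) b.fst * ind (KindN H F) c.snd :=
    Finset.sum_nonneg fun _ _ => mul_nonneg (ind_nonneg _ _) (ind_nonneg _ _)
  change 0 ≤ final F R b.fst ∧ (final F R b.fst = 0 →
    (∀ c : H.Dart, c.fst = b.fst → ¬ KindA H F c.snd ∧ ¬ Poor F R c.snd) ∧
      (Poor F R b.fst ∨ ∀ c : H.Dart, c.fst = b.fst →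
        ¬ (Tri R c ∧ KindB H F c.snd ∧ KindB H F (R.next c).snd)))
  simp only [fineWord, Bool.or_eq_true, Bool.and_eq_true, Nat.blt, Nat.beq_eq, Nat.ble_eq] at hfine
  rcases hfine with (hfine | ⟨⟨hfine, hap⟩, hbb⟩) | ⟨⟨hfine, hap⟩, hp⟩
  · have : 0 < final F R b.fst := by omega
    exact ⟨this.le, fun h0 => absurd h0 this.ne'⟩
  · exact ⟨by omega, fun _ => ⟨fun c hc => noAP_word hap hc, Or.inr fun c hc => noBB_word hbb hc⟩⟩
  · have hp' := poor_of_poorWord hv' hp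
    rw [hp'.sum_ind] at htot
    exact ⟨by omega, fun _ => ⟨fun c hc => noAP_word hap hc, Or.inl hp'⟩⟩

/-! ### There are no irreducible graphs -/

/-- All final charges are nonnegative with sum at most zero, so each one vanishes and the equality
cases hold everywhere. They exclude poor vertices first, then needy neighbors of B vertices, then
kind A. -/
theorem Irred.forall_not_adj (h : Irred G H F) (u w : V) : ¬ H.Adj u w := by
  intro huw
  obtain ⟨R, hg⟩ := h.tor
  have hsum := sum_final_le F R hg (h.next_ne R) ⟨(u, w), huw⟩
  have hnn : ∀ v, 0 < deg H v → 0 ≤ final F R v := by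
    intro v hv
    rcases kind_of_pos (F := F) hv with hk | hk | hk
    · exact h.final_kindA hk
    · exact (h.final_kindB hk).1
    · exact (h.final_kindN hk).1
  have hz : ∀ v, 0 < deg H v → final F R v = 0 := by
    have h0 : ∀ v ∈ ({v | 0 < deg H v} : Finset V), 0 ≤ final F R v := fun v hv =>
      hnn v (by simpa using hv)
    intro v hv
    exact (Finset.sum_eq_zero_iff_of_nonneg h0).1 (le_antisymm hsum (Finset.sum_nonneg h0)) v
      (by simpa using hv)
  have hN : ∀ v, KindN H F v → (∀ b : H.Dart, b.fst = v → ¬ KindA H F b.snd ∧ ¬ Poor F R b.snd) ∧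
      (Poor F R v ∨ ∀ b : H.Dart, b.fst = v →
        ¬ (Tri R b ∧ KindB H F b.snd ∧ KindB H F (R.next b).snd)) := fun v hv =>
    (h.final_kindN hv).2 (hz v hv.1)
  have noPoor : ∀ x, ¬ Poor F R x := by
    intro x hx
    obtain ⟨b, rfl, -, hy, -⟩ := hx.exists_dart
    -- A poor vertex has a neighbor of kind N, and that neighbor, having charge zero, admits no poor
    -- neighbor.
    refine ((hN _ hy).1 (R.next b).symm rfl).2 ?_
    change Poor F R (R.next b).fst
    rwa [R.fst_next]
  have noBB : ∀ b : H.Dart, KindN H F b.fst → Tri R b → KindB H F b.snd →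
      ¬ KindB H F (R.next b).snd := fun b hb ht h1 h2 =>
    ((hN _ hb).2.resolve_left (noPoor _)) b rfl ⟨ht, h1, h2⟩
  have noNA : ∀ x y, H.Adj x y → KindN H F x → ¬ KindA H F y := fun x y hxy hx =>
    ((hN _ hx).1 ⟨(x, y), hxy⟩ rfl).1
  -- vertices of kind `B` have no needy neighbors
  have hB : ∀ x y, H.Adj x y → KindB H F x → ¬ Needy H F y := by
    intro x y hxy hx hy
    obtain ⟨c, rfl, ht, hc⟩ := ((h.final_kindB hx).2 (hz x hx.1.2.1)).2 ⟨(x, y), hxy⟩ rfl hy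
    rcases hc with ⟨hn, hm⟩ | ⟨hm, hn⟩
    -- Equality at the B vertex yields a triangle with a further needy vertex and an N vertex. The
    -- needy one is of kind B, so the N vertex lies in a triangle with two B vertices; `turn` moves
    -- the corner to the N vertex.
    · have hnB : KindB H F c.snd := hn.kind.resolve_left (noNA _ _ ht.adj.symm hm)
      refine noBB (turn R c) hm (tri_turn.2 ht) ?_ ?_
      · rwa [snd_turn]
      · rwa [ht.snd_next_turn]
    · have hnB : KindB H F (R.next c).snd := hn.kind.resolve_left (noNA _ _ ht.adj hm)
      refine noBB (turn R (turn R c)) ?_ (tri_turn.2 (tri_turn.2 ht)) ?_ ?_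
      · rwa [ht.fst_turn_turn]
      · rwa [snd_turn]
      · rwa [(tri_turn.2 ht).snd_next_turn, snd_turn]
  have noA : ∀ x, ¬ KindA H F x := by
    intro x hx
    obtain ⟨y, hy⟩ := card_pos.1 hx.1.2.1
    rw [mem_nbr] at hy
    rcases kind_of_pos (F := F) (deg_pos_of_adj hy.symm) with hk | hk | hk
    · exact h.not_adj_kindA hx hk hy
    · exact hB y x hy.symm hk hx.1
    · exact noNA y x hy.symm hk hx
  -- there is a vertex of kind `N`
  have hex : ∃ v, KindN H F v := by
    rcases kind_of_pos (F := F) (deg_pos_of_adj huw) with hk | hk | hk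
    · exact absurd hk (noA _)
    · exact ⟨w, deg_pos_of_adj huw.symm, hB u w huw hk⟩
    · exact ⟨u, hk⟩
  obtain ⟨v, hv⟩ := hex
  have hcorner : ∀ b ∈ dartsAt H v, 0 ≤ corner F R b := by
    intro b hb
    rw [mem_dartsAt] at hb
    have hvA := noA v
    have hvB : ¬ KindB H F v := fun h' => h'.not_kindN hv
    have n1 := ind_nonneg (KindB H F) b.snd
    have n2 := ind_nonneg (KindB H F) (R.next b).snd
    simp only [corner, hb, ind_of hv, ind_of_not hvB, ind_of_not hvA, ind_of_not (noA _)]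
    split_ifs
    · have := mul_nonneg n1 n2
      linarith
    · linarith
  have hdeg : deg H v ≤ 6 := by
    have h0 := hz v hv.1
    simp only [final, ind_of_not (noPoor _), Finset.sum_add_distrib, Finset.sum_sub_distrib] at h0
    have := Finset.sum_nonneg hcorner
    simp [card_dartsAt] at h0
    have : (deg H v : ℤ) ≤ 6 := by linarith
    exact_mod_cast this
  have hlight : ∀ y ∈ ({z ∈ nbr H v | Needy H F z} : Finset V),
      deg H y + #{z ∈ nbr H y | Needy H F z} ≤ 7 := by
    intro y hy
    simp only [mem_filter, mem_nbr] at hy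
    have hyB : KindB H F y := hy.2.kind.resolve_left (noA _)
    have e : ({z ∈ nbr H y | Needy H F z} : Finset V) = ∅ := by
      refine filter_eq_empty_iff.2 fun {z} hz => hB y z (mem_nbr.1 hz) hyB
    rw [e, card_empty]
    have := ((h.final_kindB hyB).2 (hz y hyB.1.2.1)).1
    omega
  -- All needy neighbors of `v` have degree at most six and no needy neighbors, so they can all be
  -- colored after `v`. No kill remains to be counted besides theirs, and 8 ≤ deg ≤ 6 is absurd.
  have h8 := h.eight_le hv.1 hv.2 (filter_subset _ _) hlight
  have e : ({z ∈ nbr H v \ {z ∈ nbr H v | Needy H F z} | Needy H F z ∧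
      Disjoint (nbr H z) {z ∈ nbr H v | Needy H F z}} : Finset V) = ∅ := by
    refine filter_eq_empty_iff.2 fun {z} hz hn => ?_
    rw [mem_sdiff, mem_filter] at hz
    exact hz.2 ⟨hz.1, hn.1⟩
  rw [e, card_empty] at h8
  omega

end

/-! ### The induction -/

section

variable {V : Type*} [Fintype V] {G H K : SimpleGraph V} {F : Set V}

theorem esize_lt_of_lt (h : K < H) : esize K < esize H :=
  Set.ncard_lt_ncard (SimpleGraph.edgeSet_ssubset_edgeSet.2 h) (Set.toFinite _)

theorem del_lt {X : Finset V} (hX : ∃ x ∈ X, 0 < deg H x) : del H X < H := by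
  refine lt_of_le_of_ne del_le fun he => ?_
  obtain ⟨x, hx, hd⟩ := hX
  obtain ⟨y, hy⟩ := card_pos.1 hd
  rw [mem_nbr, ← he] at hy
  exact hy.2.1 hx

/-- `K` arises from `H` by removal of the vertex `v` of degree two with neighbors `u` and `w`, which
are joined by an edge. -/
structure Suppressed (H K : SimpleGraph V) (v u w : V) : Prop where
  ne : u ≠ w
  adj_left : ∀ x, H.Adj v x ↔ x = u ∨ x = w
  adj : ∀ a b, K.Adj a b ↔ (H.Adj a b ∧ a ≠ v ∧ b ≠ v) ∨ (a = u ∧ b = w) ∨ (a = w ∧ b = u)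

/-- If the two neighbors are already adjacent, removing the edges at `v` suffices. -/
theorem exists_suppressed (hT : H.IsToroidal) {v : V} (hv : deg H v = 2) :
    ∃ K u w, Suppressed H K v u w ∧ K.IsToroidal := by
  obtain ⟨u, w, huw, hn⟩ := card_eq_two.1 hv
  have hadj : ∀ x, H.Adj v x ↔ x = u ∨ x = w := by
    intro x
    rw [← mem_nbr, hn, mem_insert, mem_singleton]
  have hu : u ≠ v := ((hadj u).2 (Or.inl rfl)).ne'
  have hw : w ≠ v := ((hadj w).2 (Or.inr rfl)).ne'
  by_cases h : H.Adj u w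
  · refine ⟨del H {v}, u, w, ⟨huw, hadj, fun a b => ?_⟩, IsToroidal.mono hT del_le⟩
    simp only [del, mem_singleton]
    constructor
    · exact Or.inl
    · rintro (h1 | ⟨rfl, rfl⟩ | ⟨rfl, rfl⟩)
      · exact h1
      · exact ⟨h, hu, hw⟩
      · exact ⟨h.symm, hw, hu⟩
  · refine ⟨suppress H v u w, u, w, ⟨huw, hadj, fun a b => ?_⟩, IsToroidal.suppress hT huw hadj h⟩
    simp [suppress, huw]

theorem Suppressed.esize_lt {v u w : V} (h : Suppressed H K v u w) : esize K < esize H := by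
  have hu : H.Adj v u := (h.adj_left u).2 (Or.inl rfl)
  have hw : H.Adj v w := (h.adj_left w).2 (Or.inr rfl)
  have hsub : K.edgeSet ⊆ insert s(u, w) (H.edgeSet \ {s(v, u), s(v, w)}) := by
    intro e
    induction e using Sym2.ind with
    | _ a b =>
      intro he
      rw [SimpleGraph.mem_edgeSet, h.adj] at he
      rcases he with ⟨h1, h2, h3⟩ | ⟨rfl, rfl⟩ | ⟨rfl, rfl⟩
      · refine Or.inr ⟨h1, ?_⟩
        simp only [Set.mem_insert_iff, Set.mem_singleton_iff, Sym2.eq_iff]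
        tauto
      · exact Or.inl rfl
      · exact Or.inl Sym2.eq_swap
  have h1 := (Set.ncard_le_ncard hsub (Set.toFinite _)).trans (Set.ncard_insert_le _ _)
  have hne : s(v, u) ≠ s(v, w) := by
    rw [Ne, Sym2.congr_right]; exact h.ne
  have hpair : ({s(v, u), s(v, w)} : Set (Sym2 V)) ⊆ H.edgeSet := by
    rintro _ (rfl | rfl)
    · exact hu
    · exact hw
  have h2 := Set.ncard_sdiff_add_ncard_of_subset hpair (Set.toFinite _)
  rw [Set.ncard_pair hne] at h2
  simp only [esize]
  omega

/-- In `K` the vertices `u` and `w` have different colors, which makes `v` odd. Their own oddness is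
left open by declaring them free in `K`, and is restored when `v` is colored: two colors and at most
two kills are to be avoided. All other neighborhoods agree in `H` and `K`. -/
theorem Suppressed.good {v u w : V} (h : Suppressed H K v u w) (hv : v ∉ F)
    (hK : Good K (F ∪ {u, w})) : Good H F := by
  obtain ⟨c, hc⟩ := hK
  have hn : nbr H v = {u, w} := by
    ext x; rw [mem_nbr, h.adj_left, mem_insert, mem_singleton]
  have huv : u ≠ v := ((h.adj_left u).2 (Or.inl rfl)).ne'
  have hwv : w ≠ v := ((h.adj_left w).2 (Or.inr rfl)).ne'
  have hcuw : c u ≠ c w :=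
    hc.proper u w (by simp) (by simp) ((h.adj _ _).2 (Or.inr (Or.inl ⟨rfl, rfl⟩)))
  have hp : PartialOdd H F c {v} := by
    refine ⟨fun a b ha hb hab => hc.proper a b (by simp) (by simp)
      ((h.adj _ _).2 (Or.inl ⟨hab, by simpa using ha, by simpa using hb⟩)), fun z hz hd => ?_⟩
    by_cases hzv : z = v
    · subst hzv
      refine ⟨c u, ?_⟩
      have e : ({x ∈ nbr H z \ {z} | c x = c u} : Finset V) = {u} := by
        ext x
        simp only [hn, mem_filter, mem_sdiff, mem_insert, mem_singleton]
        constructor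
        · rintro ⟨⟨rfl | rfl, -⟩, h2⟩
          · rfl
          · exact absurd h2.symm hcuw
        · rintro rfl
          exact ⟨⟨Or.inl rfl, huv⟩, rfl⟩
      rw [mem_oddAt, e, card_singleton]
      exact odd_one
    · have hzv' : ¬ H.Adj v z := fun hvz =>
        Finset.disjoint_left.1 hd (mem_nbr.2 hvz.symm) (mem_singleton_self v)
      rw [h.adj_left, not_or] at hzv'
      have e : nbr K z = nbr H z := by
        ext x
        rw [mem_nbr, mem_nbr, h.adj]
        constructor
        · rintro (h1 | ⟨rfl, -⟩ | ⟨rfl, -⟩)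
          · exact h1.1
          · exact absurd rfl hzv'.1
          · exact absurd rfl hzv'.2
        · intro hzx
          refine Or.inl ⟨hzx, hzv, ?_⟩
          rintro rfl
          exact Finset.disjoint_left.1 hd (mem_nbr.2 hzx) (mem_singleton_self x)
      have hz' : Needy K (F ∪ {u, w}) z := by
        refine ⟨?_, by simpa only [deg, e] using hz.2⟩
        rintro (h1 | h1)
        · exact hz.1 h1
        · simp only [Set.mem_insert_iff, Set.mem_singleton_iff] at h1
          tauto
      have := hc.odd z hz' (by simp)
      have e2 : nbr H z \ {v} = nbr H z := sdiff_eq_self_of_disjoint hd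
      simpa only [oddAt, e, sdiff_empty, e2] using this
  obtain ⟨a, -, ha⟩ := hp.step (x := v) (by simp)
    ((nbr H v).image c ∪ (nbr H v).image (kill H c {v}))
    (by
      have h1 := card_image_le (s := nbr H v) (f := c)
      have h2 := card_image_le (s := nbr H v) (f := kill H c {v})
      have h3 := card_union_le ((nbr H v).image c) ((nbr H v).image (kill H c {v}))
      have h4 : #(nbr H v) = 2 := by rw [hn, card_pair h.ne]
      omega)
    (fun z hz _ => mem_union_left _ (mem_image_of_mem _ hz))
    (fun z hz _ _ o ho => mem_union_right _ (mem_image.2 ⟨z, hz, kill_eq ho⟩))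
  exact ⟨_, by simpa using ha⟩

theorem good_of_isToroidal (hG : G.NoAdjacentTriangles) (H : SimpleGraph V) (F : Set V)
    (hT : H.IsToroidal) (hreal : ∀ u w, u ∉ F → H.Adj u w → G.Adj u w) : Good H F := by
  induction hn : esize H using Nat.strong_induction_on generalizing H F with
  | _ n ih =>
    subst hn
    by_contra hbad
    have hirr : Irred G H F := by
      refine ⟨hT, hG, hreal, hbad, fun X hX => ?_, fun v hv hd => hbad ?_⟩
      · exact ih _ (esize_lt_of_lt (del_lt hX)) _ F (IsToroidal.mono hT del_le)
          (fun u w hu huw => hreal u w hu huw.1) rfl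
      · obtain ⟨K, u, w, hK, hKT⟩ := exists_suppressed hT hd
        -- The only edge of `K` that may be absent from `G` joins `u` and `w`, both of which are now
        -- free.
        refine hK.good hv (ih _ hK.esize_lt K _ hKT (fun a b ha hab => ?_) rfl)
        simp only [Set.mem_union, Set.mem_insert_iff, Set.mem_singleton_iff, not_or] at ha
        rcases (hK.adj a b).1 hab with h1 | ⟨h1, -⟩ | ⟨h1, -⟩
        · exact hreal a b ha.1 h1.1
        · exact absurd h1 ha.2.1
        · exact absurd h1 ha.2.2
    have hno := hirr.forall_not_adj
    refine hbad ⟨fun _ => 0, fun a b _ _ hab => absurd hab (hno a b), fun z hz _ => ?_⟩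
    obtain ⟨y, hy⟩ := card_pos.1 hz.2.1
    exact absurd (mem_nbr.1 hy) (hno z y)

/-- At a vertex of odd degree the color counts have an odd sum, so one of them is odd in any
coloring. -/
theorem Good.oddColorable (h : Good G ∅) : G.OddColorable 8 := by
  obtain ⟨c, hc⟩ := h
  refine ⟨Coloring.mk c fun {a b} hab => hc.proper a b (by simp) (by simp) hab, ?_⟩
  rintro v ⟨w, hw⟩
  have hncard : ∀ a, {x | G.Adj v x ∧ c x = a}.ncard = #{x ∈ nbr G v | c x = a} := by
    intro a
    rw [← Set.ncard_coe_finset]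
    congr 1
    ext x
    simp
  change ∃ a, Odd {x | G.Adj v x ∧ c x = a}.ncard
  simp only [hncard]
  by_cases he : Even (deg G v)
  · obtain ⟨a, ha⟩ := hc.odd v ⟨by simp, deg_pos_of_adj hw, he⟩ (by simp)
    exact ⟨a, by simpa [mem_oddAt] using ha⟩
  · by_contra! hcon
    refine he ?_
    rw [deg, card_eq_sum_card_fiberwise (f := c) (t := univ) (fun _ _ => by simp)]
    exact Finset.even_sum _ fun a _ => Nat.not_odd_iff_even.1 (hcon a)

end

end

end OddToroidal

theorem theorem1 {V : Type*} [Fintype V] (G : SimpleGraph V)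
    (hT : G.IsToroidal) (hA : G.NoAdjacentTriangles) :
    G.oddChromaticNumber ≤ 8 := by
  have h := (OddToroidal.good_of_isToroidal hA G ∅ hT fun _ _ _ h => h).oddColorable
  exact iInf₂_le 8 h
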